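/- Conventions. For a topological space $X$ and a commutative unital ring $R$, let $\widetilde H^*(X;R)$ be the reduced singular cohomology ring; if $X$ is path-connected, its non-zero homogeneous elements are the non-zero classes $u\in H^{q}(X;R)$ with $q\ge 1$, and we write $|u|=q$. A good cover of $X$ is an open cover all of whose elements, and all of whose non-empty finite intersections of elements, are contractible. The strict covering type $\mathrm{sct}(X)$ is the least cardinality of a good cover of $X$ ($\infty$ if there is no finite good cover), and the covering type $\mathrm{ct}(X)$ is the least value of $\mathrm{sct}(Y)$ over all spaces $Y$ homotopy equivalent to $X$. The category $\mathrm{cat}(f)$ of a map $f\colon A\to X$ is the least $k$ such that $A$ is covered by $k$ open sets on each of which $f$ is null-homotopic. For a non-zero homogeneous class $u\in\widetilde H^*(X;R)$, its strict category weight $\mathrm{swgt}(u)$ is the largest integer $k$ such that $f^*(u)=0$ for every map $f\colon A\to X$ with $\mathrm{cat}(f)\le k$. A strict weight estimator over $R$ is a function $\mathbf w$ that assigns to every non-zero homogeneous $u\in\widetilde H^*(X;R)$ an integer $\mathbf w(u)$ with $1\le\mathbf w(u)\le\mathrm{swgt}(u)$. For a finite sequence $s=(u_1,\dots,u_n)$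 of homogeneous classes of $\widetilde H^*(X;R)$ put $\widehat s=u_1\cdots u_n$ and $\mathbf w(s)=\mathbf w(u_1)+\dots+\mathbf w(u_n)$; for the empty sequence, $\mathbf w(s)=0$, $\widehat s=1$, and by convention $|\widehat s|=-1$. Write $s'\le s$ if $s'$ is a (possibly empty) subsequence of a permutation of $s$. If $\widehat s\neq 0$, put $$\mathrm{wct}(s;\mathbf w)=1+\mathbf w(s)+\sum_{k=1}^{\mathbf w(s)}\max\{\,|\widehat{s'}| \;:\; s'\le s,\ \mathbf w(s')\le k\,\},$$ and let $\mathrm{swct}(X)$ be the maximum of $\mathrm{wct}(s;\mathrm{swgt})$ over all commutative unital rings $R$ and all finite sequences $s$ of homogeneous elements of $\widetilde H^*(X;R)$ with $\widehat s\ne 0$. Theorem. Let $X$ be a path-connected space that admits a finite good cover. Then: 1. the maximum that defines $\mathrm{swct}(X)$ exists, so $\mathrm{swct}(X)$ is an integer; 2. $\mathrm{swct}(X)$ is a homotopy invariant: $\mathrm{swct}(Y)=\mathrm{swct}(X)$ for every space $Y$ homotopy equivalent to $X$; 3. $\mathrm{ct}(X)$ is finite and $\mathrm{ct}(X)\ge\mathrm{swct}(X)$;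 4. for every commutative unital ring $R$, every strict weight estimator $\mathbf w$ over $R$ and every finite sequence $s$ of homogeneous elements of $\widetilde H^*(X;R)$ with $\widehat s\ne0$, $\mathrm{swct}(X)\ge\mathrm{wct}(s;\mathbf w)$. -/

import Mathlib

universe u v

/-! ## Singular cohomology and its cup product -/

namespace CoveringType

noncomputable section

section Simplicial

open CategoryTheory Simplicial

variable (S : SSet.{u}) (R : Type v) [CommRing R]

/-- `R`-valued simplicial `n`-cochains: functions on the `n`-simplices. -/
abbrev Cochain (n : ℕ) : Type (max u v) := S _⦋n⦌ → R

/-- The coboundary `(δφ)(x) = ∑ i, (-1) ^ i φ(dᵢ x)`. -/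
def coboundary (n : ℕ) : Cochain S R n →ₗ[R] Cochain S R (n + 1) where
  toFun φ := fun x => ∑ i : Fin (n + 2), (-1) ^ (i : ℕ) * φ (S.δ i x)
  map_add' φ ψ := by
    funext x
    simp [mul_add, Finset.sum_add_distrib]
  map_smul' r φ := by
    funext x
    simp [Finset.mul_sum, mul_left_comm]

/-- The cocycles in degree `n`. -/
abbrev cocycles (n : ℕ) : Submodule R (Cochain S R n) := LinearMap.ker (coboundary S R n)

/-- The coboundaries in degree `n` (only `0` in degree `0`). -/
def coboundaries (n : ℕ) : Submodule R (Cochain S R n) :=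
  match n with
  | 0 => ⊥
  | n + 1 => LinearMap.range (coboundary S R n)

/-- The cohomology in degree `n`: cocycles modulo coboundaries. -/
abbrev SCohomology (n : ℕ) : Type (max u v) :=
  cocycles S R n ⧸ (coboundaries S R n).comap (cocycles S R n).subtype

variable {S R}

/-- The cup product of cochains, front `p`-face times back `q`-face: `(φ ∪ ψ)(x) = φ(x|[0..p]) ψ(x|[p..p+q])`. -/
def cupCochain {p q n : ℕ} (h : p + q = n) (φ : Cochain S R p) (ψ : Cochain S R q) :
    Cochain S R n := fun x =>
  φ (S.map (SimplexCategory.subinterval 0 p (by omega)).op x) *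
    ψ (S.map (SimplexCategory.subinterval p q (by omega)).op x)

theorem map_map_op {a b c : SimplexCategory} (f : a ⟶ b) (g : b ⟶ c)
    (x : S.obj (Opposite.op c)) : S.map f.op (S.map g.op x) = S.map (f ≫ g).op x := by
  simp

theorem δ_eq_map {n : ℕ} (i : Fin (n + 2)) (x : S _⦋n + 1⦌) :
    S.δ i x = S.map (SimplexCategory.δ i).op x := rfl

theorem coboundary_eq_sum_range {n : ℕ} (φ : Cochain S R n) (x : S _⦋n + 1⦌) :
    coboundary S R n φ x =
      ∑ i ∈ Finset.range (n + 2), (-1) ^ i * φ (S.δ (Fin.ofNat (n + 2) i) x) := by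
  rw [← Fin.sum_univ_eq_sum_range
    (fun i => (-1) ^ i * φ (S.δ (Fin.ofNat (n + 2) i) x)) (n + 2)]
  simp [coboundary]

theorem δ_val {n : ℕ} (i : Fin (n + 2)) (j : Fin (n + 1)) :
    ((SimplexCategory.δ i).toOrderHom j : ℕ) = if (j : ℕ) < i then (j : ℕ) else j + 1 := by
  change ((Fin.succAbove i j : Fin (n + 2)) : ℕ) = _
  simp only [Fin.succAbove, Fin.lt_def, Fin.val_castSucc]
  split_ifs <;> simp

theorem subinterval_val {n j l : ℕ} (h : j + l ≤ n) (i : Fin (l + 1)) :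
    ((SimplexCategory.subinterval j l h).toOrderHom i : ℕ) = i + j := rfl

theorem hom_ext_val {a b : ℕ} (f g : ⦋a⦌ ⟶ ⦋b⦌)
    (h : ∀ i : Fin (a + 1), (f.toOrderHom i : ℕ) = (g.toOrderHom i : ℕ)) : f = g := by
  apply SimplexCategory.Hom.ext
  apply OrderHom.ext
  funext i
  exact Fin.ext (h i)

theorem ofNat_val {n i : ℕ} (h : i < n + 2) : ((Fin.ofNat (n + 2) i : Fin (n + 2)) : ℕ) = i := by
  simp [Nat.mod_eq_of_lt h]

/-- The Leibniz rule `δ(φ ∪ ψ) = δφ ∪ ψ + (-1) ^ p φ ∪ δψ`. -/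
theorem coboundary_cup {p q n : ℕ} (h : p + q = n) (φ : Cochain S R p) (ψ : Cochain S R q) :
    coboundary S R n (cupCochain h φ ψ) =
      cupCochain (p := p + 1) (by omega) (coboundary S R p φ) ψ +
        (-1) ^ p * cupCochain (q := q + 1) (by omega) φ (coboundary S R q ψ) := by
  subst h
  funext x
  have hf : ∀ (a b : SimplexCategory) (f g : a ⟶ b) (y : S.obj (Opposite.op b)), f = g →
      S.map f.op y = S.map g.op y := fun _ _ _ _ _ e => by rw [e]
  have hneg : ((-1 : Cochain S R (p + q + 1)) ^ p) x = (-1 : R) ^ p := by simp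
  rw [Pi.add_apply, Pi.mul_apply, hneg]
  simp only [cupCochain, coboundary_eq_sum_range]
  rw [show Finset.range (p + q + 2) = Finset.range ((p + 1) + (q + 1)) from
      congrArg Finset.range (by omega), Finset.sum_range_add,
    Finset.sum_range_succ _ (p + 1), Finset.sum_range_succ' _ (q + 1)]
  have e1 : ∀ i ∈ Finset.range (p + 1),
      (-1 : R) ^ i * (φ (S.map (SimplexCategory.subinterval 0 p (by omega)).op
          (S.δ (Fin.ofNat (p + q + 2) i) x)) *
        ψ (S.map (SimplexCategory.subinterval p q (by omega)).op
          (S.δ (Fin.ofNat (p + q + 2) i) x))) =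
      ((-1 : R) ^ i * φ (S.δ (Fin.ofNat (p + 2) i)
        (S.map (SimplexCategory.subinterval 0 (p + 1) (by omega)).op x))) *
        ψ (S.map (SimplexCategory.subinterval (p + 1) q (by omega)).op x) := by
    intro i hi
    rw [Finset.mem_range] at hi
    simp only [δ_eq_map, map_map_op]
    rw [mul_assoc]
    congr 3
    · congr 4
      apply hom_ext_val
      intro j
      have h1 := ofNat_val (n := p + q) (i := i) (by omega)
      have h2 := ofNat_val (n := p) (i := i) (by omega)
      simp only [SimplexCategory.comp_toOrderHom, OrderHom.comp_coe, Function.comp_apply,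
        δ_val, subinterval_val, h1, h2]
      split_ifs <;> omega
    · apply hf
      apply hom_ext_val
      intro j
      have h1 := ofNat_val (n := p + q) (i := i) (by omega)
      simp only [SimplexCategory.comp_toOrderHom, OrderHom.comp_coe, Function.comp_apply,
        δ_val, subinterval_val, h1]
      split_ifs <;> omega
  have e2 : ∀ i ∈ Finset.range (q + 1),
      (-1 : R) ^ (p + 1 + i) * (φ (S.map (SimplexCategory.subinterval 0 p (by omega)).op
          (S.δ (Fin.ofNat (p + q + 2) (p + 1 + i)) x)) *
        ψ (S.map (SimplexCategory.subinterval p q (by omega)).op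
          (S.δ (Fin.ofNat (p + q + 2) (p + 1 + i)) x))) =
      (-1 : R) ^ p * (φ (S.map (SimplexCategory.subinterval 0 p (by omega)).op x) *
        ((-1 : R) ^ (i + 1) * ψ (S.δ (Fin.ofNat (q + 2) (i + 1))
          (S.map (SimplexCategory.subinterval p (q + 1) (by omega)).op x)))) := by
    intro i hi
    rw [Finset.mem_range] at hi
    simp only [δ_eq_map, map_map_op]
    have a1 : SimplexCategory.subinterval 0 p (by omega) ≫
        SimplexCategory.δ (Fin.ofNat (p + q + 2) (p + 1 + i)) =
        SimplexCategory.subinterval 0 p (by omega) := by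
      apply hom_ext_val
      intro j
      have h1 := ofNat_val (n := p + q) (i := p + 1 + i) (by omega)
      simp only [SimplexCategory.comp_toOrderHom, OrderHom.comp_coe, Function.comp_apply,
        δ_val, subinterval_val, h1]
      split_ifs <;> omega
    have a2 : SimplexCategory.subinterval p q (by omega) ≫
        SimplexCategory.δ (Fin.ofNat (p + q + 2) (p + 1 + i)) =
        SimplexCategory.δ (Fin.ofNat (q + 2) (i + 1)) ≫
          SimplexCategory.subinterval p (q + 1) (by omega) := by
      apply hom_ext_val
      intro j
      have h1 := ofNat_val (n := p + q) (i := p + 1 + i) (by omega)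
      have h2 := ofNat_val (n := q) (i := i + 1) (by omega)
      simp only [SimplexCategory.comp_toOrderHom, OrderHom.comp_coe, Function.comp_apply,
        δ_val, subinterval_val, h1, h2]
      split_ifs <;> omega
    rw [a1, a2]
    ring
  have e3 : S.δ (Fin.ofNat (p + 2) (p + 1))
        (S.map (SimplexCategory.subinterval 0 (p + 1) (by omega)).op x) =
      S.map (SimplexCategory.subinterval 0 p (by omega)).op x := by
    simp only [δ_eq_map, map_map_op]
    apply hf
    apply hom_ext_val
    intro j
    have h1 := ofNat_val (n := p) (i := p + 1) (by omega)
    simp only [SimplexCategory.comp_toOrderHom, OrderHom.comp_coe, Function.comp_apply,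
      δ_val, subinterval_val, h1]
    split_ifs <;> omega
  have e4 : S.δ (Fin.ofNat (q + 2) 0)
        (S.map (SimplexCategory.subinterval p (q + 1) (by omega)).op x) =
      S.map (SimplexCategory.subinterval (p + 1) q (by omega)).op x := by
    simp only [δ_eq_map, map_map_op]
    apply hf
    apply hom_ext_val
    intro j
    have h1 := ofNat_val (n := q) (i := 0) (by omega)
    simp only [SimplexCategory.comp_toOrderHom, OrderHom.comp_coe, Function.comp_apply,
      δ_val, subinterval_val, h1]
    split_ifs <;> omega
  rw [Finset.sum_congr rfl e1, Finset.sum_congr rfl e2, e3, e4]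
  rw [← Finset.sum_mul, ← Finset.mul_sum, ← Finset.mul_sum]
  ring

theorem cupCochain_mem_cocycles {p q n : ℕ} (h : p + q = n) {φ : Cochain S R p}
    {ψ : Cochain S R q} (hφ : φ ∈ cocycles S R p) (hψ : ψ ∈ cocycles S R q) :
    cupCochain h φ ψ ∈ cocycles S R n := by
  rw [LinearMap.mem_ker] at *
  rw [coboundary_cup, hφ, hψ]
  funext x
  simp [cupCochain]

theorem cupCochain_left_mem {p q n : ℕ} (h : p + q = n) {φ : Cochain S R p}
    {ψ : Cochain S R q} (hφ : φ ∈ coboundaries S R p) (hψ : ψ ∈ cocycles S R q) :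
    cupCochain h φ ψ ∈ coboundaries S R n := by
  rw [LinearMap.mem_ker] at hψ
  cases p with
  | zero =>
    obtain rfl : φ = 0 := hφ
    convert (coboundaries S R n).zero_mem
    funext x
    simp [cupCochain]
  | succ p =>
    obtain ⟨θ, rfl⟩ := hφ
    obtain rfl : n = p + q + 1 := by omega
    refine ⟨cupCochain rfl θ ψ, ?_⟩
    rw [coboundary_cup, hψ]
    funext x
    simp [cupCochain]

theorem cupCochain_right_mem {p q n : ℕ} (h : p + q = n) {φ : Cochain S R p}
    {ψ : Cochain S R q} (hφ : φ ∈ cocycles S R p) (hψ : ψ ∈ coboundaries S R q) :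
    cupCochain h φ ψ ∈ coboundaries S R n := by
  rw [LinearMap.mem_ker] at hφ
  cases q with
  | zero =>
    obtain rfl : ψ = 0 := hψ
    convert (coboundaries S R n).zero_mem
    funext x
    simp [cupCochain]
  | succ q =>
    obtain ⟨θ, rfl⟩ := hψ
    obtain rfl : n = p + q + 1 := by omega
    refine ⟨(-1 : R) ^ p • cupCochain rfl φ θ, ?_⟩
    rw [map_smul, coboundary_cup, hφ]
    funext x
    have : (-1 : R) ^ p * (-1 : R) ^ p = 1 := by rw [← mul_pow]; simp
    simp [cupCochain, ← mul_assoc, this]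

/-- The cup product `H^p × H^q → H^(p+q)`, induced by the cup product of cocycles. -/
def cup {p q : ℕ} : SCohomology S R p → SCohomology S R q → SCohomology S R (p + q) :=
  Quotient.map₂
    (fun φ ψ => ⟨cupCochain rfl φ.1 ψ.1, cupCochain_mem_cocycles rfl φ.2 ψ.2⟩) (by
      intro φ φ' hφ ψ ψ' hψ
      rw [← Quotient.eq_iff_equiv] at hφ hψ ⊢
      have h1 := (Submodule.Quotient.eq _).1 hφ
      have h2 := (Submodule.Quotient.eq _).1 hψ
      refine (Submodule.Quotient.eq _).2 ?_
      rw [Submodule.mem_comap] at h1 h2 ⊢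
      have h3 := cupCochain_left_mem (rfl : p + q = p + q) h1 ψ.2
      have h4 := cupCochain_right_mem (rfl : p + q = p + q) φ'.2 h2
      convert add_mem h3 h4 using 1
      funext x
      simp [cupCochain]
      ring)

/-- The unit class in degree `0`, represented by the constant cochain `1`. -/
def unitClass : SCohomology S R 0 :=
  Submodule.Quotient.mk ⟨fun _ => 1, by
    rw [LinearMap.mem_ker]
    funext x
    simp [coboundary, Fin.sum_univ_succ]⟩

/-- The pullback of cochains along a simplicial map. -/
def cochainPullback {S T : SSet.{u}} (f : S ⟶ T) (R : Type v) [CommRing R] (n : ℕ) :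
    Cochain T R n →ₗ[R] Cochain S R n where
  toFun φ := fun x => φ (f.app (Opposite.op ⦋n⦌) x)
  map_add' _ _ := rfl
  map_smul' _ _ := rfl

theorem coboundary_pullback {S T : SSet.{u}} (f : S ⟶ T) (n : ℕ) (φ : Cochain T R n) :
    coboundary S R n (cochainPullback f R n φ) =
      cochainPullback f R (n + 1) (coboundary T R n φ) := by
  funext x
  simp only [coboundary, cochainPullback, LinearMap.coe_mk, AddHom.coe_mk, δ_eq_map]
  refine Finset.sum_congr rfl fun i _ => ?_
  rw [NatTrans.naturality_apply f]

/-- The map induced on cohomology by a simplicial map. -/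
def cohomologyPullback {S T : SSet.{u}} (f : S ⟶ T) (R : Type v) [CommRing R] (n : ℕ) :
    SCohomology T R n →ₗ[R] SCohomology S R n :=
  Submodule.mapQ _ _
    ((cochainPullback f R n).restrict (p := cocycles T R n) (q := cocycles S R n) (by
      intro φ hφ
      rw [LinearMap.mem_ker] at hφ ⊢
      rw [coboundary_pullback, hφ, map_zero])) (by
    rintro ⟨φ, hφ⟩ h
    change φ ∈ coboundaries T R n at h
    change cochainPullback f R n φ ∈ coboundaries S R n
    cases n with
    | zero =>
      obtain rfl : φ = 0 := h
      exact map_zero (cochainPullback f R 0)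
    | succ n =>
      obtain ⟨θ, rfl⟩ := h
      exact ⟨cochainPullback f R n θ, coboundary_pullback f n θ⟩)

end Simplicial

/-- The singular cohomology `H^n(X; R)`. -/
abbrev Cohomology (X : Type u) [TopologicalSpace X] (R : Type v) [CommRing R] (n : ℕ) :
    Type (max u v) :=
  SCohomology (TopCat.toSSet.obj (TopCat.of X)) R n

/-- The homomorphism `f^* : H^n(X; R) → H^n(A; R)` induced by a continuous map `f : A → X`. -/
def pullback {A X : Type u} [TopologicalSpace A] [TopologicalSpace X] (f : C(A, X))
    (R : Type v) [CommRing R] (n : ℕ) : Cohomology X R n →ₗ[R] Cohomology A R n :=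
  cohomologyPullback (TopCat.toSSet.map (TopCat.ofHom f)) R n

/-- Homogeneous cohomology classes: a degree together with a class in that degree. -/
abbrev HomogeneousClass (X : Type u) [TopologicalSpace X] (R : Type v) [CommRing R] :
    Type (max u v) :=
  Σ n : ℕ, Cohomology X R n

/-- The cup product `u₁ ⋯ uₙ` of a finite sequence of homogeneous classes (the unit for the empty
sequence). -/
def cupList {X : Type u} [TopologicalSpace X] {R : Type v} [CommRing R] :
    List (HomogeneousClass X R) → HomogeneousClass X R :=
  List.foldr (fun a b => ⟨a.1 + b.1, cup a.2 b.2⟩) ⟨0, unitClass⟩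

/-! ## Good covers and the covering type -/

/-- A good cover: an open cover whose members and whose non-empty finite intersections of members
are contractible. -/
structure IsGoodCover {X : Type u} [TopologicalSpace X] (𝒰 : Set (Set X)) : Prop where
  isOpen : ∀ U ∈ 𝒰, IsOpen U
  cover : ⋃₀ 𝒰 = Set.univ
  contractible : ∀ U ∈ 𝒰, ContractibleSpace U
  contractible_inter : ∀ 𝒱 ⊆ 𝒰, 𝒱.Finite → 𝒱.Nonempty → (⋂₀ 𝒱).Nonempty →
    ContractibleSpace (⋂₀ 𝒱 : Set X)

/-- The strict covering type: the least cardinality of a good cover; it is `⊤` if there is no finite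
good cover. -/
def strictCoveringType (X : Type u) [TopologicalSpace X] : ℕ∞ :=
  ⨅ (𝒰 : Set (Set X)) (_ : IsGoodCover 𝒰), 𝒰.encard

/-- The covering type: the least strict covering type of a space homotopy equivalent to `X`. -/
def coveringType (X : Type u) [TopologicalSpace X] : ℕ∞ :=
  ⨅ (Y : Type u) (_ : TopologicalSpace Y) (_ : Nonempty (ContinuousMap.HomotopyEquiv X Y)),
    strictCoveringType Y

/-! ## Category weight -/

/-- The category of a map `f : A → X`: the least `k` such that `A` is covered by `k` open sets on
each of which `f` is null-homotopic (`⊤` if there is no such `k`). -/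
def mapCategory {A X : Type u} [TopologicalSpace A] [TopologicalSpace X] (f : C(A, X)) : ℕ∞ :=
  ⨅ (k : ℕ) (_ : ∃ U : Fin k → Set A, (∀ i, IsOpen (U i)) ∧ (⋃ i, U i) = Set.univ ∧
    ∀ i, (f.restrict (U i)).Nullhomotopic), (k : ℕ∞)

/-- The strict category weight of a non-zero homogeneous class `u` of positive degree: the largest
`k` such that `f^* u = 0` for every map `f` into `X` of category at most `k`. (`k = 0` is always
admissible, and for `u ≠ 0` all admissible `k` are at most the degree of `u`.) -/
def swgt {X : Type u} [TopologicalSpace X] {R : Type v} [CommRing R]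
    (a : HomogeneousClass X R) : ℕ :=
  sSup {k : ℕ | ∀ (A : Type u) [TopologicalSpace A] (f : C(A, X)),
    mapCategory f ≤ k → pullback f R a.1 a.2 = 0}

/-! ## Weighted estimates

For a path-connected space the reduced cohomology vanishes in degree `0` and agrees with the
unreduced one in positive degrees. So its non-zero homogeneous classes are the non-zero classes of
positive degree. -/

/-- A strict weight estimator on the reduced cohomology of a path-connected space. -/
def IsStrictWeightEstimator {X : Type u} [TopologicalSpace X] {R : Type v} [CommRing R]
    (w : HomogeneousClass X R → ℕ) : Prop :=
  ∀ a : HomogeneousClass X R, 1 ≤ a.1 → a.2 ≠ 0 → 1 ≤ w a ∧ w a ≤ swgt a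

/-- A sequence of homogeneous classes of the reduced cohomology of a path-connected space whose
product does not vanish. -/
def IsAdmissible {X : Type u} [TopologicalSpace X] {R : Type v} [CommRing R]
    (s : List (HomogeneousClass X R)) : Prop :=
  (∀ a ∈ s, 1 ≤ a.1) ∧ (cupList s).2 ≠ 0

/-- The weight of a sequence: the sum of the weights of its members. -/
def seqWeight {X : Type u} [TopologicalSpace X] {R : Type v} [CommRing R]
    (w : HomogeneousClass X R → ℕ) (s : List (HomogeneousClass X R)) : ℕ :=
  (s.map w).sum

/-- The dimension of the product of a sequence, with the convention `-1` for the empty sequence. -/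
def seqDim {X : Type u} [TopologicalSpace X] {R : Type v} [CommRing R] :
    List (HomogeneousClass X R) → ℤ
  | [] => -1
  | a :: s => ((cupList (a :: s)).1 : ℤ)

/-- `wct(s; w) = 1 + w(s) + ∑_{k=1}^{w(s)} max {|ŝ'| : s' ≤ s, w(s') ≤ k}`, where `s'` runs over the
subsequences of the permutations of `s`. The maximum is over a finite set that contains `-1`. -/
def wct {X : Type u} [TopologicalSpace X] {R : Type v} [CommRing R]
    (s : List (HomogeneousClass X R)) (w : HomogeneousClass X R → ℕ) : ℤ :=
  1 + (seqWeight w s : ℤ) + ∑ k ∈ Finset.Icc 1 (seqWeight w s),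
    sSup {d : ℤ | ∃ s' : List (HomogeneousClass X R),
      s'.Subperm s ∧ seqWeight w s' ≤ k ∧ d = seqDim s'}

/-- The values `wct(s; swgt)` over all commutative rings and all sequences with non-zero product. -/
def swctValues (X : Type u) [TopologicalSpace X] : Set ℤ :=
  {m | ∃ (R : Type v) (_ : CommRing R) (s : List (HomogeneousClass X R)),
    IsAdmissible s ∧ m = wct s swgt}

/-- `swct(X)`, the maximum of the values `wct(s; swgt)`. -/
def swct (X : Type u) [TopologicalSpace X] : ℤ :=
  sSup (swctValues.{u, v} X)

end

end CoveringType

/-! The heart of the matter is `wct_le_ncard`: a good cover with n members forces wct(s; w) ≤ n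
whenever the product ŝ is non-zero and w ≤ swgt on s. The rest follows formally.

Passage to a polyhedron. Let K be the nerve of the cover. Since the non-empty intersections of
members are contractible, there is a map g from the polyhedron of K to X that carries slightly
shrunken stars of vertices into the corresponding members (`exists_map_polyhedron`). Comparing the
two families by Mayer-Vietoris, and passing from small simplices to all simplices, shows that g is
injective in cohomology (`pullback_injective_of_covers`). So g^*ŝ ≠ 0 on a space covered by n open
stars.

Counting vertices (`wct_le_of_cover`). Simplices are removed greedily. After j steps let T be the
set of removed vertices. Choose a part s' of s of weight at most w(s) - j and of the largest
dimension; the complementary part s'' has weight at least j. The open stars of the vertices of one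
simplex have a union that contracts in the polyhedron (`nullhomotopic_incl_iUnion_openStar`), so the
stars over T form a union of at most j categorical sets, and the product of s'' can be represented
by a cocycle that vanishes on an open cover of this union (`exists_vanishesOn_append`). If the
remaining vertices spanned no simplex of dimension |ŝ'|, then ŝ' would vanish on their stars
(`vanishesOn_of_nerve`), and ŝ would vanish everywhere. Hence a simplex with |ŝ'| + 1 new vertices
can be removed. After w(s) steps the stars over T still do not cover, so one more vertex is left.
The total is wct(s; w) (`wct_eq`).

Consequences. Every ingredient of wct is preserved by a homotopy equivalence (`wct_hpull`), so the
bound holds for good covers of all spaces homotopy equivalent to X, and the values of wct form a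
non-empty bounded set of integers. Estimators below swgt give smaller values by `wct_mono`. -/

namespace CoveringType

noncomputable section

/-! ### Cochains on families of simplices: Mayer-Vietoris and the five lemma. -/

section LocalCohomology

open CategoryTheory Simplicial

variable {S T : SSet.{u}} {R : Type v} [CommRing R]

/-- By the simplicial identities the term (i, j) with i ≤ j cancels against the term (j + 1, i). -/
theorem coboundary_coboundary {n : ℕ} (φ : Cochain S R n) :
    coboundary S R (n + 1) (coboundary S R n φ) = 0 := by
  funext x
  simp only [coboundary, LinearMap.coe_mk, AddHom.coe_mk, Finset.mul_sum, Pi.zero_apply,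
    ← mul_assoc]
  rw [Finset.sum_sigma', Finset.univ_sigma_univ]
  let P := (_ : Fin (n + 3)) × Fin (n + 2)
  let I : Finset P := Finset.univ.filter fun ij => (ij.1 : ℕ) ≤ (ij.2 : ℕ)
  rw [← Finset.sum_add_sum_compl I, ← eq_neg_iff_add_eq_zero, ← Finset.sum_neg_distrib]
  let e : ∀ ij : P, ij ∈ I → P := fun ij hij =>
    ⟨ij.2.succ, Fin.castLT ij.1
      (lt_of_le_of_lt (Finset.mem_filter.mp hij).right (Fin.is_lt ij.2))⟩
  refine Finset.sum_bij e ?_ ?_ ?_ ?_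
  · intro ij hij
    simp_rw [I, e, Finset.compl_filter, Finset.mem_filter_univ, Fin.val_succ,
      Fin.val_castLT] at hij ⊢
    lia
  · rintro ⟨i, j⟩ hij ⟨i', j'⟩ hij' h
    have h1 : (j : ℕ) + 1 = j' + 1 := congrArg (fun p : P => (p.1 : ℕ)) h
    have h2 : (i : ℕ) = i' := congrArg (fun p : P => (p.2 : ℕ)) h
    obtain rfl := Fin.ext h2
    obtain rfl : j = j' := Fin.ext (by omega)
    rfl
  · rintro ⟨i', j'⟩ hij'
    simp_rw [I, Finset.compl_filter, Finset.mem_filter_univ, not_le] at hij'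
    refine ⟨⟨Fin.castSucc j', i'.pred ?_⟩, ?_, ?_⟩
    · rintro rfl
      simp only [Fin.val_zero, not_lt_zero] at hij'
    · simpa [I] using! Nat.le_sub_one_of_lt hij'
    · simp only [e, Fin.castLT_castSucc, Fin.succ_pred]
  · rintro ⟨i, j⟩ hij
    have hij' : (i : ℕ) ≤ j := by simpa [I] using! hij
    have h := SSet.δ_comp_δ''_apply (S := S) (i := i) (j := j) hij' x
    simp only [e, Fin.val_succ, Fin.val_castLT]
    rw [h, pow_succ]
    ring

theorem coboundary_eq_zero_of_mem {n : ℕ} {β : Cochain S R n} (h : β ∈ coboundaries S R n) :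
    coboundary S R n β = 0 := by
  cases n with
  | zero =>
    obtain rfl : β = 0 := h
    exact map_zero _
  | succ n =>
    obtain ⟨θ, rfl⟩ := h
    exact coboundary_coboundary θ

theorem cochainPullback_mem_coboundaries (f : S ⟶ T) {n : ℕ} {β : Cochain T R n}
    (h : β ∈ coboundaries T R n) : cochainPullback f R n β ∈ coboundaries S R n := by
  cases n with
  | zero =>
    obtain rfl : β = 0 := h
    exact map_zero (cochainPullback f R 0)
  | succ n =>
    obtain ⟨θ, rfl⟩ := h
    exact ⟨cochainPullback f R n θ, coboundary_pullback f n θ⟩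

/-- A coboundary on the source of a levelwise injective map extends to a coboundary. -/
theorem exists_coboundary_extend (j : S ⟶ T)
    (hj : ∀ n : ℕ, Function.Injective (j.app (Opposite.op ⦋n⦌))) {n : ℕ} {β : Cochain S R n}
    (hβ : β ∈ coboundaries S R n) :
    ∃ γ ∈ coboundaries T R n, cochainPullback j R n γ = β := by
  cases n with
  | zero =>
    obtain rfl : β = 0 := hβ
    exact ⟨0, Submodule.zero_mem _, map_zero _⟩
  | succ n =>
    obtain ⟨θ, rfl⟩ := hβ
    -- Only the primitive has to be extended, and a primitive is an arbitrary cochain; extension by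
    -- zero will do.
    refine ⟨_, ⟨Function.extend (j.app (Opposite.op ⦋n⦌)) θ 0, rfl⟩, ?_⟩
    rw [← coboundary_pullback]
    congr 1
    funext x
    exact (hj n).extend_apply θ 0 x

variable (S) in
/-- A set of simplices in every dimension. -/
abbrev SimplexFamily := ∀ n : ℕ, Set (S _⦋n⦌)

/-- Families that contain the faces of their members. -/
def FaceClosed (A : SimplexFamily S) : Prop :=
  ∀ (n : ℕ) (i : Fin (n + 2)) (x : S _⦋n + 1⦌), x ∈ A (n + 1) → S.δ i x ∈ A n

/-- The cochain `φ` restricts to a cocycle on `A`. -/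
def CocycleOn (A : SimplexFamily S) {n : ℕ} (φ : Cochain S R n) : Prop :=
  ∀ x ∈ A (n + 1), coboundary S R n φ x = 0

/-- The cochain `φ` restricts to a coboundary on `A`. -/
def ExactOn (A : SimplexFamily S) {n : ℕ} (φ : Cochain S R n) : Prop :=
  ∃ β ∈ coboundaries S R n, ∀ x ∈ A n, φ x = β x

theorem FaceClosed.inf {A B : SimplexFamily S} (hA : FaceClosed A) (hB : FaceClosed B) :
    FaceClosed (A ⊓ B) := fun n i x hx => ⟨hA n i x hx.1, hB n i x hx.2⟩

/-- This allows cochains on A to be represented by cochains on all of S: their values off A are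
irrelevant to the coboundary on A. -/
theorem coboundary_congr {A : SimplexFamily S} (hA : FaceClosed A) {n : ℕ} {φ ψ : Cochain S R n}
    (h : ∀ x ∈ A n, φ x = ψ x) :
    ∀ x ∈ A (n + 1), coboundary S R n φ x = coboundary S R n ψ x := by
  intro x hx
  simp only [coboundary, LinearMap.coe_mk, AddHom.coe_mk]
  exact Finset.sum_congr rfl fun i _ => by rw [h _ (hA n i x hx)]

theorem CocycleOn.mono {A B : SimplexFamily S} (h : A ≤ B) {n : ℕ} {φ : Cochain S R n}
    (hφ : CocycleOn B φ) : CocycleOn A φ := fun x hx => hφ x (h _ hx)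

theorem ExactOn.mono {A B : SimplexFamily S} (h : A ≤ B) {n : ℕ} {φ : Cochain S R n}
    (hφ : ExactOn B φ) : ExactOn A φ :=
  let ⟨β, hβ, e⟩ := hφ
  ⟨β, hβ, fun x hx => e x (h _ hx)⟩

theorem CocycleOn.sub {A : SimplexFamily S} {n : ℕ} {φ ψ : Cochain S R n}
    (hφ : CocycleOn A φ) (hψ : CocycleOn A ψ) : CocycleOn A (φ - ψ) := fun x hx => by
  rw [map_sub, Pi.sub_apply, hφ x hx, hψ x hx, sub_zero]

-- This replaces the short exact sequence of Mayer-Vietoris. Cochains are arbitrary functions, so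
-- agreement on the common simplices is the only obstruction to gluing.
open scoped Classical in
theorem exists_glue {R : Type v} (A B : SimplexFamily S) {n : ℕ} (φ ψ : Cochain S R n)
    (h : ∀ x ∈ (A ⊓ B) n, φ x = ψ x) :
    ∃ γ : Cochain S R n, (∀ x ∈ A n, γ x = φ x) ∧ ∀ x ∈ B n, γ x = ψ x := by
  refine ⟨fun x => if x ∈ A n then φ x else ψ x, fun x hx => if_pos hx, fun x hx => ?_⟩
  by_cases hA : x ∈ A n
  · simp only [if_pos hA]
    exact h x ⟨hA, hx⟩
  · simp only [if_neg hA]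

/-- Mayer-Vietoris: the cohomology in a degree vanishes on a union. -/
theorem exactOn_sup {A B : SimplexFamily S} (hA : FaceClosed A) (hB : FaceClosed B) {n : ℕ}
    {φ : Cochain S R (n + 1)} (h1 : ExactOn A φ) (h2 : ExactOn B φ)
    (h : ∀ ψ : Cochain S R n, CocycleOn (A ⊓ B) ψ → ExactOn (A ⊓ B) ψ) : ExactOn (A ⊔ B) φ := by
  obtain ⟨_, ⟨a, rfl⟩, ha⟩ := h1
  obtain ⟨_, ⟨b, rfl⟩, hb⟩ := h2
  -- Two primitives of φ differ on the intersection by a cocycle, which is exact there. Adding the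
  -- global coboundary β to b makes them agree without changing the coboundary of b.
  obtain ⟨β, hβ, e⟩ := h (a - b) fun x hx => by
    rw [map_sub, Pi.sub_apply, ← ha x hx.1, ← hb x hx.2, sub_self]
  obtain ⟨c, c1, c2⟩ := exists_glue A B a (b + β) fun x hx => by
    rw [Pi.add_apply, ← e x hx]
    simp
  refine ⟨_, ⟨c, rfl⟩, fun x hx => ?_⟩
  rcases hx with hx | hx
  · rw [ha x hx, coboundary_congr hA c1 x hx]
  · rw [hb x hx, coboundary_congr hB c2 x hx, map_add, coboundary_eq_zero_of_mem hβ, add_zero]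

/-- The map `f` induces an isomorphism from the cohomology of `B` to that of `A`. -/
structure IsoOn (f : S ⟶ T) (R : Type v) [CommRing R] (A : SimplexFamily S)
    (B : SimplexFamily T) : Prop where
  inj : ∀ (n : ℕ) (φ : Cochain T R n), CocycleOn B φ → ExactOn A (cochainPullback f R n φ) →
    ExactOn B φ
  surj : ∀ (n : ℕ) (ψ : Cochain S R n), CocycleOn A ψ →
    ∃ φ : Cochain T R n, CocycleOn B φ ∧ ExactOn A (ψ - cochainPullback f R n φ)

/-- The five lemma for two Mayer-Vietoris sequences, chased on cochains. Degree 0 is separate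
because its only coboundary is 0. -/
theorem IsoOn.sup {f : S ⟶ T} {A₁ A₂ : SimplexFamily S} {B₁ B₂ : SimplexFamily T}
    (hA₁ : FaceClosed A₁) (hA₂ : FaceClosed A₂) (hB₁ : FaceClosed B₁) (hB₂ : FaceClosed B₂)
    (f₁ : ∀ n, ∀ x ∈ A₁ n, f.app (Opposite.op ⦋n⦌) x ∈ B₁ n)
    (f₂ : ∀ n, ∀ x ∈ A₂ n, f.app (Opposite.op ⦋n⦌) x ∈ B₂ n)
    (h₁ : IsoOn f R A₁ B₁) (h₂ : IsoOn f R A₂ B₂) (h : IsoOn f R (A₁ ⊓ A₂) (B₁ ⊓ B₂)) :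
    IsoOn f R (A₁ ⊔ A₂) (B₁ ⊔ B₂) where
  inj := by
    intro n φ hφ hex
    have e1 := h₁.inj n φ (hφ.mono le_sup_left) (hex.mono le_sup_left)
    have e2 := h₂.inj n φ (hφ.mono le_sup_right) (hex.mono le_sup_right)
    cases n with
    | zero =>
      obtain ⟨β₁, z1, e1⟩ := e1
      obtain ⟨β₂, z2, e2⟩ := e2
      obtain rfl : β₁ = 0 := z1
      obtain rfl : β₂ = 0 := z2
      exact ⟨0, Submodule.zero_mem _, fun x hx => hx.elim (e1 x) (e2 x)⟩
    | succ n =>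
      obtain ⟨_, ⟨b₁, rfl⟩, e1⟩ := e1
      obtain ⟨_, ⟨b₂, rfl⟩, e2⟩ := e2
      obtain ⟨_, ⟨a, rfl⟩, ea⟩ := hex
      -- The primitives b₁ and b₂ of φ may differ by a non-trivial class. Adding suitable cocycles
      -- c₁ and c₂ makes both pullbacks cohomologous to the given primitive a, so that the new
      -- primitives become cohomologous on the intersection.
      obtain ⟨c₁, hc₁, γ₁, hγ₁, g₁⟩ := h₁.surj n (a - cochainPullback f R n b₁) fun x hx => by
        rw [map_sub, Pi.sub_apply, coboundary_pullback, ← ea x (Or.inl hx)]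
        exact sub_eq_zero.2 (e1 _ (f₁ _ _ hx))
      obtain ⟨c₂, hc₂, γ₂, hγ₂, g₂⟩ := h₂.surj n (a - cochainPullback f R n b₂) fun x hx => by
        rw [map_sub, Pi.sub_apply, coboundary_pullback, ← ea x (Or.inr hx)]
        exact sub_eq_zero.2 (e2 _ (f₂ _ _ hx))
      obtain ⟨β, hβ, eβ⟩ := h.inj n ((b₁ + c₁) - (b₂ + c₂)) (fun x hx => by
          simp only [map_sub, map_add, Pi.sub_apply, Pi.add_apply, hc₁ x hx.1, hc₂ x hx.2,
            ← e1 x hx.1, ← e2 x hx.2]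
          simp)
        ⟨γ₂ - γ₁, Submodule.sub_mem _ hγ₂ hγ₁, fun x hx => by
          simp only [Pi.sub_apply, map_sub, map_add, Pi.add_apply, ← g₁ x hx.1, ← g₂ x hx.2]
          ring⟩
      obtain ⟨c, k1, k2⟩ := exists_glue B₁ B₂ (b₁ + c₁) (b₂ + c₂ + β) fun x hx => by
        rw [Pi.add_apply (b₂ + c₂), ← eβ x hx]
        simp
      refine ⟨_, ⟨c, rfl⟩, fun x hx => ?_⟩
      rcases hx with hx | hx
      · rw [coboundary_congr hB₁ k1 x hx, map_add, Pi.add_apply, hc₁ x hx, add_zero, e1 x hx]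
      · rw [coboundary_congr hB₂ k2 x hx, map_add, map_add, Pi.add_apply, Pi.add_apply, hc₂ x hx,
          coboundary_eq_zero_of_mem hβ, Pi.zero_apply, add_zero, add_zero, e2 x hx]
  surj := by
    intro n ψ hψ
    obtain ⟨φ₁, hφ₁, β₁, hβ₁, e1⟩ := h₁.surj n ψ (hψ.mono le_sup_left)
    obtain ⟨φ₂, hφ₂, β₂, hβ₂, e2⟩ := h₂.surj n ψ (hψ.mono le_sup_right)
    obtain ⟨γ, hγ, eγ⟩ := h.inj n (φ₁ - φ₂)
      ((hφ₁.mono inf_le_left).sub (hφ₂.mono inf_le_right))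
      ⟨β₂ - β₁, Submodule.sub_mem _ hβ₂ hβ₁, fun x hx => by
        simp only [Pi.sub_apply, map_sub, ← e1 x hx.1, ← e2 x hx.2]
        ring⟩
    obtain ⟨φ, k1, k2⟩ := exists_glue B₁ B₂ φ₁ (φ₂ + γ) fun x hx => by
      rw [Pi.add_apply, ← eγ x hx]
      simp
    have hφ : CocycleOn (B₁ ⊔ B₂) φ := by
      intro x hx
      rcases hx with hx | hx
      · rw [coboundary_congr hB₁ k1 x hx, hφ₁ x hx]
      · rw [coboundary_congr hB₂ k2 x hx, map_add, coboundary_eq_zero_of_mem hγ, add_zero,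
          hφ₂ x hx]
    have d1 : ∀ x ∈ A₁ n, (ψ - cochainPullback f R n φ) x = β₁ x := fun x hx => by
      rw [← e1 x hx]
      change ψ x - φ _ = ψ x - φ₁ _
      rw [k1 _ (f₁ _ _ hx)]
    have d2 : ∀ x ∈ A₂ n,
        (ψ - cochainPullback f R n φ) x = (β₂ - cochainPullback f R n γ) x := fun x hx => by
      rw [Pi.sub_apply, Pi.sub_apply, ← e2 x hx]
      change ψ x - φ _ = ψ x - φ₂ _ - γ _
      rw [k2 _ (f₂ _ _ hx), Pi.add_apply]
      ring
    have hβ₂' := Submodule.sub_mem _ hβ₂ (cochainPullback_mem_coboundaries f hγ)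
    generalize β₂ - cochainPullback f R n γ = β₂' at d2 hβ₂'
    cases n with
    | zero =>
      obtain rfl : β₁ = 0 := hβ₁
      obtain rfl : β₂' = 0 := hβ₂'
      exact ⟨φ, hφ, 0, Submodule.zero_mem _, fun x hx => hx.elim (d1 x) (d2 x)⟩
    | succ n =>
      obtain ⟨a₁, rfl⟩ := hβ₁
      obtain ⟨a₂, rfl⟩ := hβ₂'
      -- On the intersection a₁ - a₂ is a cocycle that may not be exact. Its class comes from some
      -- c; subtracting the coboundary of c from φ on B₂ alone, which is harmless on B₁ ∩ B₂,
      -- removes it.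
      obtain ⟨c, hc, β, hβ, eβ⟩ := h.surj n (a₁ - a₂) fun x hx => by
        rw [map_sub, Pi.sub_apply, ← d1 x hx.1, ← d2 x hx.2, sub_self]
      obtain ⟨φ', l1, l2⟩ := exists_glue B₁ B₂ φ (φ - coboundary T R n c) fun x hx => by
        rw [Pi.sub_apply, hc x hx, sub_zero]
      obtain ⟨a, m1, m2⟩ := exists_glue A₁ A₂ a₁ (a₂ + cochainPullback f R n c + β)
        fun x hx => by
          rw [Pi.add_apply, ← eβ x hx]
          simp
      refine ⟨φ', fun x hx => ?_, _, ⟨a, rfl⟩, fun x hx => ?_⟩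
      · rcases hx with hx | hx
        · rw [coboundary_congr hB₁ l1 x hx, hφ x (Or.inl hx)]
        · rw [coboundary_congr hB₂ l2 x hx, map_sub, coboundary_coboundary, sub_zero,
            hφ x (Or.inr hx)]
      · rcases hx with hx | hx
        · rw [coboundary_congr hA₁ m1 x hx, ← d1 x hx]
          change ψ x - φ' _ = ψ x - φ _
          rw [l1 _ (f₁ _ _ hx)]
        · rw [coboundary_congr hA₂ m2 x hx, map_add, map_add, coboundary_eq_zero_of_mem hβ,
            add_zero, Pi.add_apply, ← d2 x hx, coboundary_pullback]
          change ψ x - φ' _ = ψ x - φ _ + coboundary T R n c _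
          rw [l2 _ (f₂ _ _ hx), Pi.sub_apply]
          ring

/-- The family `A` has the cohomology of a point (and is not empty). -/
structure Acyclic (R : Type v) [CommRing R] (A : SimplexFamily S) : Prop where
  nonempty : (A 0).Nonempty
  const : ∀ φ : Cochain S R 0, CocycleOn A φ → ∃ r : R, ∀ x ∈ A 0, φ x = r
  exact : ∀ (n : ℕ) (φ : Cochain S R (n + 1)), CocycleOn A φ → ExactOn A φ

theorem IsoOn.of_acyclic (f : S ⟶ T) {A : SimplexFamily S} {B : SimplexFamily T}
    (hf : ∀ n, ∀ x ∈ A n, f.app (Opposite.op ⦋n⦌) x ∈ B n) (hA : Acyclic R A)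
    (hB : Acyclic R B) : IsoOn f R A B where
  inj := by
    intro n φ hφ hex
    cases n with
    | succ n => exact hB.exact n φ hφ
    | zero =>
      obtain ⟨r, hr⟩ := hB.const φ hφ
      obtain ⟨β, z, e⟩ := hex
      obtain rfl : β = 0 := z
      obtain ⟨x, hx⟩ := hA.nonempty
      have h0 : φ (f.app (Opposite.op ⦋0⦌) x) = 0 := e x hx
      rw [hr _ (hf _ _ hx)] at h0
      exact ⟨0, Submodule.zero_mem _, fun y hy => by rw [hr y hy, h0]; rfl⟩
  surj := by
    intro n ψ hψ
    cases n with
    | succ n => exact ⟨0, fun x _ => by simp, by simpa using hA.exact n ψ hψ⟩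
    | zero =>
      obtain ⟨r, hr⟩ := hA.const ψ hψ
      refine ⟨fun _ => r, fun x _ => by simp [coboundary, Fin.sum_univ_succ], 0,
        Submodule.zero_mem _, fun x hx => ?_⟩
      change ψ x - r = 0
      rw [hr x hx, sub_self]

theorem IsoOn.of_empty (f : S ⟶ T) {A : SimplexFamily S} {B : SimplexFamily T}
    (hA : ∀ n, A n = ∅) (hB : ∀ n, B n = ∅) : IsoOn f R A B where
  inj := fun n _ _ _ => ⟨0, Submodule.zero_mem _, fun x hx => by simp [hB n] at hx⟩
  surj := fun n _ _ => ⟨0, fun x hx => by simp [hB] at hx,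
    0, Submodule.zero_mem _, fun x hx => by simp [hA n] at hx⟩

variable {ι : Type*}

/-- The union of the families `A i`, `i ∈ s`. -/
def unionOn (A : ι → SimplexFamily S) (s : Finset ι) : SimplexFamily S :=
  fun n => ⋃ i ∈ s, A i n

/-- The intersection of the families `A i`, `i ∈ s`. -/
def interOn (A : ι → SimplexFamily S) (s : Finset ι) : SimplexFamily S :=
  fun n => ⋂ i ∈ s, A i n

theorem faceClosed_unionOn {A : ι → SimplexFamily S} (hA : ∀ i, FaceClosed (A i))
    (s : Finset ι) : FaceClosed (unionOn A s) := by
  intro n i x hx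
  simp only [unionOn, Set.mem_iUnion] at hx ⊢
  obtain ⟨j, hj, hx⟩ := hx
  exact ⟨j, hj, hA j n i x hx⟩

theorem unionOn_inf (A : ι → SimplexFamily S) (j : ι) (s : Finset ι) :
    unionOn A s ⊓ A j = unionOn (fun i => A i ⊓ A j) s := by
  funext n
  ext x
  simp only [unionOn, Pi.inf_apply, Set.inf_eq_inter, Set.mem_inter_iff, Set.mem_iUnion,
    exists_prop]
  exact ⟨fun ⟨⟨i, hi, hx⟩, hj⟩ => ⟨i, hi, hx, hj⟩, fun ⟨i, hi, hx, hj⟩ => ⟨⟨i, hi, hx⟩, hj⟩⟩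

theorem interOn_singleton (A : ι → SimplexFamily S) (j : ι) : interOn A {j} = A j := by
  funext n
  simp [interOn]

variable [DecidableEq ι]

theorem unionOn_insert (A : ι → SimplexFamily S) (j : ι) (s : Finset ι) :
    unionOn A (insert j s) = unionOn A s ⊔ A j := by
  funext n
  ext x
  simp [unionOn, or_comm]

theorem interOn_insert (A : ι → SimplexFamily S) (j : ι) (s : Finset ι) (hs : s.Nonempty) :
    interOn (fun i => A i ⊓ A j) s = interOn A (insert j s) := by
  obtain ⟨k, hk⟩ := hs
  funext n
  ext x
  simp only [interOn, Pi.inf_apply, Set.inf_eq_inter, Set.mem_iInter, Set.mem_inter_iff,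
    Finset.mem_insert, forall_eq_or_imp]
  exact ⟨fun h => ⟨(h k hk).2, fun i hi => (h i hi).1⟩, fun h i hi => ⟨h.2 i hi, h.1⟩⟩

/-- Induction on the number of members. The union of the first members meets a new one in the union
of the pairwise intersections, and the intersections of those are again intersections of the
original family. -/
theorem IsoOn.unionOn (f : S ⟶ T) (s : Finset ι) :
    ∀ (A : ι → SimplexFamily S) (B : ι → SimplexFamily T), (∀ i, FaceClosed (A i)) →
      (∀ i, FaceClosed (B i)) → (∀ i n, ∀ x ∈ A i n, f.app (Opposite.op ⦋n⦌) x ∈ B i n) →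
      (∀ σ ⊆ s, σ.Nonempty → IsoOn f R (interOn A σ) (interOn B σ)) →
      IsoOn f R (unionOn A s) (unionOn B s) := by
  induction s using Finset.induction_on with
  | empty =>
    intro A B _ _ _ _
    exact IsoOn.of_empty f (fun n => by simp [CoveringType.unionOn])
      (fun n => by simp [CoveringType.unionOn])
  | insert j s hj ih =>
    intro A B hA hB hf h
    rw [unionOn_insert, unionOn_insert]
    refine IsoOn.sup (faceClosed_unionOn hA s) (hA j) (faceClosed_unionOn hB s) (hB j)
      ?_ (hf j) ?_ ?_ ?_
    · intro n x hx
      simp only [CoveringType.unionOn, Set.mem_iUnion] at hx ⊢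
      obtain ⟨i, hi, hx⟩ := hx
      exact ⟨i, hi, hf i n x hx⟩
    · exact ih A B hA hB hf fun σ hσ => h σ (hσ.trans (Finset.subset_insert _ _))
    · have := h {j} (by simp) (Finset.singleton_nonempty j)
      rwa [interOn_singleton, interOn_singleton] at this
    · rw [unionOn_inf, unionOn_inf]
      refine ih _ _ (fun i => (hA i).inf (hA j)) (fun i => (hB i).inf (hB j))
        (fun i n x hx => ⟨hf i n x hx.1, hf j n x hx.2⟩) fun σ hσ hne => ?_
      rw [interOn_insert _ _ _ hne, interOn_insert _ _ _ hne]
      exact h _ (Finset.insert_subset_insert _ hσ) (Finset.insert_nonempty _ _)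

/-- If all intersections are acyclic or empty, and no `d + 1` members meet, then the cohomology of
the union vanishes in degree `d`. -/
theorem exactOn_unionOn (s : Finset ι) :
    ∀ (A : ι → SimplexFamily S) (d : ℕ), (∀ i, FaceClosed (A i)) →
      (∀ σ ⊆ s, σ.Nonempty → Acyclic R (interOn A σ) ∨ ∀ n, interOn A σ n = ∅) →
      (∀ σ ⊆ s, σ.card = d + 1 → ∀ n, interOn A σ n = ∅) →
      ∀ φ : Cochain S R d, CocycleOn (unionOn A s) φ → ExactOn (unionOn A s) φ := by
  induction s using Finset.induction_on with
  | empty =>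
    intro A d _ _ _ φ _
    exact ⟨0, Submodule.zero_mem _, fun x hx => by simp [unionOn] at hx⟩
  | insert j s hj ih =>
    intro A d hA h hd φ hφ
    have hs : s ⊆ insert j s := Finset.subset_insert _ _
    cases d with
    | zero =>
      refine ⟨0, Submodule.zero_mem _, fun x hx => ?_⟩
      simp only [unionOn, Set.mem_iUnion] at hx
      obtain ⟨i, hi, hx⟩ := hx
      have := hd {i} (by simpa using hi) (by simp) 0
      rw [interOn_singleton] at this
      simp [this] at hx
    | succ d =>
      rw [unionOn_insert] at hφ ⊢
      refine exactOn_sup (faceClosed_unionOn hA s) (hA j) ?_ ?_ fun ψ hψ => ?_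
      · exact ih A _ hA (fun σ hσ => h σ (hσ.trans hs)) (fun σ hσ => hd σ (hσ.trans hs)) φ
          (hφ.mono le_sup_left)
      · have hj := h {j} (by simp) (Finset.singleton_nonempty j)
        rw [interOn_singleton] at hj
        rcases hj with hj | hj
        · exact hj.exact d φ (hφ.mono le_sup_right)
        · exact ⟨0, Submodule.zero_mem _, fun x hx => by simp [hj] at hx⟩
      -- Intersecting with A j lowers both numbers by one: d + 1 of the families A i ⊓ A j meet only
      -- where d + 2 of the original ones do.
      · rw [unionOn_inf] at hψ ⊢
        refine ih _ d (fun i => (hA i).inf (hA j)) (fun σ hσ hne => ?_) (fun σ hσ hc => ?_) ψ hψ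
        · rw [interOn_insert _ _ _ hne]
          exact h _ (Finset.insert_subset_insert _ hσ) (Finset.insert_nonempty _ _)
        · have hne : σ.Nonempty := Finset.card_pos.1 (by omega)
          rw [interOn_insert _ _ _ hne]
          refine hd _ (Finset.insert_subset_insert _ hσ) ?_
          rw [Finset.card_insert_of_notMem fun hh => hj (hσ hh), hc]

end LocalCohomology

end

end CoveringType

namespace CoveringType

noncomputable section

/-! ### Augmented chains of tuples, where a k-tuple has dimension k - 1: cones, homotopies,
subdivision, reversal. -/

section TupleChains

variable (R : Type v) [CommRing R]

/-- Formal `R`-linear combinations of `k`-tuples of points of `V`. -/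
abbrev TupleChain (V : Type*) (k : ℕ) := (Fin k → V) →₀ R

variable {R} {V W V' W' : Type*}

/-- The chain of a single tuple. -/
abbrev tuple (R : Type v) [CommRing R] {V : Type*} {k : ℕ} (v : Fin k → V) : TupleChain R V k :=
  Finsupp.single v 1

theorem tupleChain_induction {M : Type*} [AddCommMonoid M] [Module R M] {k : ℕ}
    {f g : TupleChain R V k →ₗ[R] M} (h : ∀ v, f (tuple R v) = g (tuple R v))
    (c : TupleChain R V k) : f c = g c := by
  have : f = g := Finsupp.lhom_ext' fun v => LinearMap.ext_ring (h v)
  rw [this]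

/-- Extend a function on tuples to chains. -/
def onTuples {M : Type*} [AddCommMonoid M] [Module R M] {k : ℕ} (F : (Fin k → V) → M) :
    TupleChain R V k →ₗ[R] M :=
  Finsupp.linearCombination R F

@[simp]
theorem onTuples_tuple {M : Type*} [AddCommMonoid M] [Module R M] {k : ℕ} (F : (Fin k → V) → M)
    (v : Fin k → V) : onTuples F (tuple R v) = F v := by
  simp [onTuples]

/-- The boundary of a chain of tuples. -/
def bd {k : ℕ} : TupleChain R V (k + 1) →ₗ[R] TupleChain R V k :=
  onTuples fun v => ∑ i : Fin (k + 1), (-1 : R) ^ (i : ℕ) • tuple R (v ∘ i.succAbove)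

/-- The cone operator with apex `b`. -/
def cone (b : V) {k : ℕ} : TupleChain R V k →ₗ[R] TupleChain R V (k + 1) :=
  onTuples fun v => tuple R (Fin.cons b v : Fin (k + 1) → V)

/-- The action of maps on chains of tuples. -/
def push (f : V → W) {k : ℕ} : TupleChain R V k →ₗ[R] TupleChain R W k :=
  onTuples fun v => tuple R (f ∘ v)

@[simp]
theorem cone_tuple (b : V) {k : ℕ} (v : Fin k → V) :
    cone b (tuple R v) = tuple R (Fin.cons b v : Fin (k + 1) → V) := onTuples_tuple _ _

@[simp]
theorem push_tuple (f : V → W) {k : ℕ} (v : Fin k → V) :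
    push f (tuple R v) = tuple R (f ∘ v) := onTuples_tuple _ _

theorem bd_tuple {k : ℕ} (v : Fin (k + 1) → V) :
    bd (tuple R v) = ∑ i : Fin (k + 1), (-1 : R) ^ (i : ℕ) • tuple R (v ∘ i.succAbove) :=
  onTuples_tuple _ _

theorem bd_cone_zero (b : V) (c : TupleChain R V 0) : bd (cone b c) = c := by
  revert c
  refine tupleChain_induction (R := R) (f := bd ∘ₗ cone b) (g := LinearMap.id) fun v => ?_
  simp only [LinearMap.comp_apply, cone_tuple, bd_tuple, LinearMap.id_apply]
  simp [Subsingleton.elim _ v]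

/-- The face opposite the apex is c; every other face keeps the apex and has its index shifted by
one, hence the minus sign. The chain identities for homotopies and subdivision rest on this formula.
-/
theorem bd_cone (b : V) {k : ℕ} (c : TupleChain R V (k + 1)) :
    bd (cone b c) = c - cone b (bd c) := by
  revert c
  refine tupleChain_induction (R := R) (f := bd ∘ₗ cone b) (g := LinearMap.id - cone b ∘ₗ bd) fun v => ?_
  simp only [LinearMap.comp_apply, LinearMap.sub_apply, cone_tuple, bd_tuple, LinearMap.id_apply,
    map_sum, map_smul]
  rw [Fin.sum_univ_succ, sub_eq_add_neg, ← Finset.sum_neg_distrib]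
  congr 1
  · simp only [Fin.val_zero, pow_zero, one_smul]
    congr 1
  · refine Finset.sum_congr rfl fun i _ => ?_
    rw [Fin.val_succ, pow_succ, mul_neg_one, neg_smul]
    congr 3
    funext j
    refine Fin.cases ?_ (fun j => ?_) j
    · simp
    · simp

theorem cone_tail {k : ℕ} (v : Fin (k + 1) → V) :
    tuple R v = cone (v 0) (tuple R (Fin.tail v)) := by
  rw [cone_tuple, Fin.cons_self_tail]

/-- Every tuple is the cone over its tail, so the cone formula reduces the claim to shorter tuples
and no signs have to be matched. -/
theorem bd_bd {k : ℕ} (c : TupleChain R V (k + 2)) : bd (bd c) = 0 := by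
  induction k with
  | zero =>
    revert c
    refine tupleChain_induction (R := R) (f := bd ∘ₗ bd) (g := 0) fun v => ?_
    rw [LinearMap.comp_apply, cone_tail, bd_cone, map_sub, bd_cone_zero, sub_self]
    rfl
  | succ k ih =>
    revert c
    refine tupleChain_induction (R := R) (f := bd ∘ₗ bd) (g := 0) fun v => ?_
    rw [LinearMap.comp_apply, cone_tail, bd_cone, map_sub, bd_cone, ih, map_zero, sub_zero,
      sub_self]
    rfl

theorem push_cone (f : V → W) (b : V) {k : ℕ} (c : TupleChain R V k) :
    push f (cone b c) = cone (f b) (push f c) := by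
  revert c
  refine tupleChain_induction (R := R) (f := push f ∘ₗ cone b) (g := cone (f b) ∘ₗ push f) fun v => ?_
  simp only [LinearMap.comp_apply, cone_tuple, push_tuple]
  congr 1
  funext j
  refine Fin.cases ?_ (fun j => ?_) j <;> simp

theorem push_bd (f : V → W) {k : ℕ} (c : TupleChain R V (k + 1)) :
    push f (bd c) = bd (push f c) := by
  revert c
  refine tupleChain_induction (R := R) (f := push f ∘ₗ bd) (g := bd ∘ₗ push f) fun v => ?_
  simp only [LinearMap.comp_apply, bd_tuple, push_tuple, map_sum, map_smul]
  rfl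

/-- The homotopy from `j` to the chain map `Φ` obtained by taking cones at the first vertices. -/
def homotopyOp (Φ : ∀ k, TupleChain R V k →ₗ[R] TupleChain R W k) (j : V → W) :
    ∀ k, TupleChain R V k →ₗ[R] TupleChain R W (k + 1)
  | 0 => 0
  | k + 1 => onTuples fun v =>
      cone (j (v 0)) (Φ (k + 1) (tuple R v) - homotopyOp Φ j k (tuple R (Fin.tail v)))

theorem homotopyOp_tuple (Φ : ∀ k, TupleChain R V k →ₗ[R] TupleChain R W k) (j : V → W) {k : ℕ}
    (v : Fin (k + 1) → V) : homotopyOp Φ j (k + 1) (tuple R v) =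
      cone (j (v 0)) (Φ (k + 1) (tuple R v) - homotopyOp Φ j k (tuple R (Fin.tail v))) :=
  onTuples_tuple _ _

theorem homotopyOp_cone (Φ : ∀ k, TupleChain R V k →ₗ[R] TupleChain R W k) (j : V → W) (b : V)
    {k : ℕ} (c : TupleChain R V k) : homotopyOp Φ j (k + 1) (cone b c) =
      cone (j b) (Φ (k + 1) (cone b c) - homotopyOp Φ j k c) := by
  revert c
  refine tupleChain_induction (R := R) (f := homotopyOp Φ j (k + 1) ∘ₗ cone b)
    (g := cone (j b) ∘ₗ (Φ (k + 1) ∘ₗ cone b - homotopyOp Φ j k)) fun v => ?_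
  simp only [LinearMap.comp_apply, LinearMap.sub_apply, cone_tuple, homotopyOp_tuple]
  simp

/-- With D for the operator, this is ∂D + D∂ = Φ - j. Write a tuple as a cone over its tail and
expand by the cone formula: the terms Φ of the tail cancel, and the cone at j(v₀) over j of the tail
reassembles j of the tuple. -/
theorem bd_homotopyOp {Φ : ∀ k, TupleChain R V k →ₗ[R] TupleChain R W k} {j : V → W}
    (hΦ : ∀ k c, bd (Φ (k + 1) c) = Φ k (bd c)) (h0 : ∀ c, Φ 0 c = push j c) {k : ℕ}
    (c : TupleChain R V (k + 1)) : bd (homotopyOp Φ j (k + 1) c) =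
      Φ (k + 1) c - push j c - homotopyOp Φ j k (bd c) := by
  induction k with
  | zero =>
    revert c
    refine tupleChain_induction (R := R) (f := bd ∘ₗ homotopyOp Φ j 1)
      (g := Φ 1 - push j - homotopyOp Φ j 0 ∘ₗ bd) fun v => ?_
    simp only [LinearMap.comp_apply, LinearMap.sub_apply]
    rw [cone_tail v, homotopyOp_cone, bd_cone, map_sub, hΦ, bd_cone_zero, h0, push_cone]
    simp [homotopyOp]
  | succ k ih =>
    revert c
    refine tupleChain_induction (R := R) (f := bd ∘ₗ homotopyOp Φ j (k + 2))
      (g := Φ (k + 2) - push j - homotopyOp Φ j (k + 1) ∘ₗ bd) fun v => ?_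
    simp only [LinearMap.comp_apply, LinearMap.sub_apply]
    rw [cone_tail v, homotopyOp_cone, bd_cone, map_sub (bd (R := R)), hΦ, bd_cone, ih, push_cone]
    simp only [map_sub]
    rw [homotopyOp_cone]
    simp only [map_sub]
    abel

/-- The homotopy involves no choice beyond Φ, j and the first vertex, so it is natural. This makes
it commute with passing to faces of a singular simplex. -/
theorem push_homotopyOp {Φ : ∀ k, TupleChain R V k →ₗ[R] TupleChain R W k} {j : V → W}
    {Φ' : ∀ k, TupleChain R V' k →ₗ[R] TupleChain R W' k} {j' : V' → W'} {f : V → V'} {g : W → W'}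
    (hΦ : ∀ k c, push g (Φ k c) = Φ' k (push f c)) (hj : ∀ x, g (j x) = j' (f x)) {k : ℕ}
    (c : TupleChain R V k) : push g (homotopyOp Φ j k c) = homotopyOp Φ' j' k (push f c) := by
  induction k with
  | zero => simp [homotopyOp]
  | succ k ih =>
    revert c
    refine tupleChain_induction (R := R) (f := push g ∘ₗ homotopyOp Φ j (k + 1))
      (g := homotopyOp Φ' j' (k + 1) ∘ₗ push f) fun v => ?_
    simp only [LinearMap.comp_apply]
    rw [homotopyOp_tuple, push_cone, map_sub, hΦ, ih, push_tuple, homotopyOp_tuple, push_tuple, hj]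
    rfl

/-- The subdivision operator that takes successive cones with apices given by `b`. -/
def sdOp (b : ∀ k, (Fin (k + 1) → V) → V) : ∀ k, TupleChain R V k →ₗ[R] TupleChain R V k
  | 0 => LinearMap.id
  | k + 1 => onTuples fun v => cone (b k v) (sdOp b k (bd (tuple R v)))

theorem sdOp_tuple (b : ∀ k, (Fin (k + 1) → V) → V) {k : ℕ} (v : Fin (k + 1) → V) :
    sdOp b (k + 1) (tuple R v) = cone (b k v) (sdOp b k (bd (tuple R v))) :=
  onTuples_tuple _ _

/-- The boundary of the cone over sd ∂v is sd ∂v minus the cone over ∂ sd ∂v, and the latter is sd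
∂∂v = 0 by induction. -/
theorem bd_sdOp (b : ∀ k, (Fin (k + 1) → V) → V) (k : ℕ) (c : TupleChain R V (k + 1)) :
    bd (sdOp b (k + 1) c) = sdOp b k (bd c) := by
  induction k with
  | zero =>
    revert c
    refine tupleChain_induction (R := R) (f := bd ∘ₗ sdOp b 1) (g := sdOp b 0 ∘ₗ bd) fun v => ?_
    simp only [LinearMap.comp_apply]
    rw [sdOp_tuple, bd_cone_zero]
  | succ k ih =>
    revert c
    refine tupleChain_induction (R := R) (f := bd ∘ₗ sdOp b (k + 2)) (g := sdOp b (k + 1) ∘ₗ bd)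
      fun v => ?_
    simp only [LinearMap.comp_apply]
    rw [sdOp_tuple, bd_cone, ih, bd_bd, map_zero, map_zero, sub_zero]

theorem push_sdOp {b : ∀ k, (Fin (k + 1) → V) → V} {b' : ∀ k, (Fin (k + 1) → W) → W} {f : V → W}
    (hf : ∀ k v, f (b k v) = b' k (f ∘ v)) (k : ℕ) (c : TupleChain R V k) :
    push f (sdOp b k c) = sdOp b' k (push f c) := by
  induction k with
  | zero => rfl
  | succ k ih =>
    revert c
    refine tupleChain_induction (R := R) (f := push f ∘ₗ sdOp b (k + 1))
      (g := sdOp b' (k + 1) ∘ₗ push f) fun v => ?_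
    simp only [LinearMap.comp_apply]
    rw [sdOp_tuple, push_cone, ih, push_bd, push_tuple, sdOp_tuple, hf]

/-- The sign of the reversal of `k` letters. -/
def revSign (R : Type v) [CommRing R] : ℕ → R
  | 0 => 1
  | k + 1 => (-1) ^ k * revSign R k

theorem revSign_mul_self (k : ℕ) : revSign R k * revSign R k = 1 := by
  induction k with
  | zero => simp [revSign]
  | succ k ih =>
    rw [revSign, mul_mul_mul_comm, ih, ← mul_pow]
    simp

theorem revSign_eq (k : ℕ) : revSign R k = 1 ∨ revSign R k = -1 := by
  induction k with
  | zero => exact Or.inl rfl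
  | succ k ih =>
    rw [revSign]
    rcases ih with h | h <;> rcases neg_one_pow_eq_or R k with h' | h' <;> rw [h, h'] <;> simp

/-- The signed reversal of tuples. -/
def revOp (k : ℕ) : TupleChain R V k →ₗ[R] TupleChain R V k :=
  onTuples fun v => revSign R k • tuple R (v ∘ Fin.rev)

theorem revOp_tuple {k : ℕ} (v : Fin k → V) :
    revOp k (tuple R v) = revSign R k • tuple R (v ∘ Fin.rev) := onTuples_tuple _ _

/-- Reversal turns face i into face k - i. The resulting sign (-1) ^ k is the quotient of the
reversal signs of k + 1 and k letters. -/
theorem bd_revOp (k : ℕ) (c : TupleChain R V (k + 1)) :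
    bd (revOp (k + 1) c) = revOp k (bd c) := by
  revert c
  refine tupleChain_induction (R := R) (f := bd ∘ₗ revOp (k + 1)) (g := revOp k ∘ₗ bd) fun v => ?_
  simp only [LinearMap.comp_apply, revOp_tuple, bd_tuple, map_sum, map_smul, Finset.smul_sum]
  rw [← Equiv.sum_comp Fin.revPerm]
  refine Finset.sum_congr rfl fun i _ => ?_
  rw [smul_smul, smul_smul, Fin.revPerm_apply]
  have h1 : (v ∘ Fin.rev) ∘ (Fin.rev i).succAbove = (v ∘ i.succAbove) ∘ Fin.rev := by
    funext j
    simp [Fin.rev_succAbove]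
  have h2 : revSign R (k + 1) * (-1) ^ (Fin.rev i : ℕ) = (-1) ^ (i : ℕ) * revSign R k := by
    have h3 : (-1 : R) ^ (Fin.rev i : ℕ) * (-1) ^ (i : ℕ) = (-1) ^ k := by
      rw [← pow_add, Fin.val_rev]
      congr 1
      omega
    have h4 : (-1 : R) ^ (i : ℕ) * (-1) ^ (i : ℕ) = 1 := by rw [← mul_pow]; simp
    have h5 : (-1 : R) ^ (Fin.rev i : ℕ) * (-1) ^ (Fin.rev i : ℕ) = 1 := by rw [← mul_pow]; simp
    rw [revSign, ← h3]
    linear_combination (-1) ^ (i : ℕ) * revSign R k * h5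
  rw [h1, h2]

theorem push_revOp (f : V → W) (k : ℕ) (c : TupleChain R V k) :
    push f (revOp k c) = revOp k (push f c) := by
  revert c
  refine tupleChain_induction (R := R) (f := push f ∘ₗ revOp k) (g := revOp k ∘ₗ push f) fun v => ?_
  simp only [LinearMap.comp_apply, revOp_tuple, push_tuple, map_smul]
  rfl

/-- The chains of tuples of points of `B`. -/
def tuplesIn (R : Type v) [CommRing R] (B : Set V) (k : ℕ) : Submodule R (TupleChain R V k) :=
  Finsupp.supported R R {v | ∀ i, v i ∈ B}

theorem tuple_mem_tuplesIn {B : Set V} {k : ℕ} {v : Fin k → V} (h : ∀ i, v i ∈ B) :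
    tuple R v ∈ tuplesIn R B k := Finsupp.single_mem_supported R 1 h

theorem map_mem_of_supported {M : Type*} [AddCommMonoid M] [Module R M] {k : ℕ}
    {f : TupleChain R V k →ₗ[R] M} {N : Submodule R M} {s : Set (Fin k → V)}
    (h : ∀ v ∈ s, f (tuple R v) ∈ N) {c : TupleChain R V k} (hc : c ∈ Finsupp.supported R R s) :
    f c ∈ N := by
  rw [Finsupp.supported_eq_span_single] at hc
  refine (Submodule.span_le (p := N.comap f)).2 ?_ hc
  rintro _ ⟨v, hv, rfl⟩
  exact h v hv

theorem cone_mem_tuplesIn {B : Set V} {b : V} (hb : b ∈ B) {k : ℕ} {c : TupleChain R V k}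
    (hc : c ∈ tuplesIn R B k) : cone b c ∈ tuplesIn R B (k + 1) := by
  refine map_mem_of_supported (fun v hv => ?_) hc
  rw [cone_tuple]
  exact tuple_mem_tuplesIn (Fin.cases hb hv)

theorem bd_mem_tuplesIn {B : Set V} {k : ℕ} {c : TupleChain R V (k + 1)}
    (hc : c ∈ tuplesIn R B (k + 1)) : bd c ∈ tuplesIn R B k := by
  refine map_mem_of_supported (fun v hv => ?_) hc
  rw [bd_tuple]
  exact Submodule.sum_mem _ fun i _ => Submodule.smul_mem _ _ (tuple_mem_tuplesIn fun j => hv _)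

theorem sdOp_mem_tuplesIn {B : Set V} {b : ∀ k, (Fin (k + 1) → V) → V}
    (hb : ∀ k v, (∀ i, v i ∈ B) → b k v ∈ B) (k : ℕ) {c : TupleChain R V k}
    (hc : c ∈ tuplesIn R B k) : sdOp b k c ∈ tuplesIn R B k := by
  induction k with
  | zero => exact hc
  | succ k ih =>
    refine map_mem_of_supported (fun v hv => ?_) hc
    rw [sdOp_tuple]
    exact cone_mem_tuplesIn (hb k v hv) (ih (bd_mem_tuplesIn (tuple_mem_tuplesIn hv)))

theorem homotopyOp_mem_tuplesIn {B : Set V} {Φ : ∀ k, TupleChain R V k →ₗ[R] TupleChain R V k}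
    (hΦ : ∀ k, ∀ c ∈ tuplesIn R B k, Φ k c ∈ tuplesIn R B k) (k : ℕ) {c : TupleChain R V k}
    (hc : c ∈ tuplesIn R B k) : homotopyOp Φ id k c ∈ tuplesIn R B (k + 1) := by
  induction k with
  | zero => exact Submodule.zero_mem _
  | succ k ih =>
    refine map_mem_of_supported (fun v hv => ?_) hc
    rw [homotopyOp_tuple]
    exact cone_mem_tuplesIn (hv 0) (Submodule.sub_mem _ (hΦ _ _ (tuple_mem_tuplesIn hv))
      (ih (tuple_mem_tuplesIn fun i => hv _)))

end TupleChains

end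

end CoveringType

namespace CoveringType

noncomputable section

/-! ### Evaluating singular cochains on affine chains: natural operators, homotopy invariance,
reversal. -/

section SingularSimplices

open CategoryTheory Simplicial

/-- The standard topological simplex. -/
abbrev Simplex (n : ℕ) : Type := stdSimplex ℝ (Fin (n + 1))

/-- The singular simplicial set. -/
abbrev Sing (X : Type u) [TopologicalSpace X] : SSet.{u} := TopCat.toSSet.obj (TopCat.of X)

variable {X Y : Type u} [TopologicalSpace X] [TopologicalSpace Y]

/-- The singular simplex given by a continuous map. -/
def sing {n : ℕ} (f : C(Simplex n, X)) : (Sing X) _⦋n⦌ :=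
  (TopCat.toSSetObjEquiv (TopCat.of X) (Opposite.op ⦋n⦌)).symm f

/-- The continuous map underlying a singular simplex. -/
def desing {n : ℕ} (x : (Sing X) _⦋n⦌) : C(Simplex n, X) :=
  TopCat.toSSetObjEquiv (TopCat.of X) (Opposite.op ⦋n⦌) x

@[simp]
theorem sing_desing {n : ℕ} (x : (Sing X) _⦋n⦌) : sing (desing x) = x :=
  Equiv.symm_apply_apply _ _

@[simp]
theorem desing_sing {n : ℕ} (f : C(Simplex n, X)) : desing (sing f) = f :=
  Equiv.apply_symm_apply _ _

/-- The affine map of simplices induced by a map of the vertices. -/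
def simplexMap {m n : ℕ} (θ : Fin (m + 1) → Fin (n + 1)) : C(Simplex m, Simplex n) :=
  ⟨stdSimplex.map θ, stdSimplex.continuous_map θ⟩

theorem map_sing {m n : ℕ} (θ : ⦋m⦌ ⟶ ⦋n⦌) (f : C(Simplex n, X)) :
    (Sing X).map θ.op (sing f) = sing (f.comp (simplexMap θ.toOrderHom)) := rfl

theorem δ_sing {n : ℕ} (i : Fin (n + 2)) (f : C(Simplex (n + 1), X)) :
    (Sing X).δ i (sing f) = sing (f.comp (simplexMap i.succAbove)) := rfl

theorem app_sing (g : C(X, Y)) {n : ℕ} (f : C(Simplex n, X)) :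
    (TopCat.toSSet.map (TopCat.ofHom g)).app (Opposite.op ⦋n⦌) (sing f) = sing (g.comp f) := rfl

theorem desing_δ {n : ℕ} (i : Fin (n + 2)) (x : (Sing X) _⦋n + 1⦌) :
    desing ((Sing X).δ i x) = (desing x).comp (simplexMap i.succAbove) := rfl

theorem desing_app (g : C(X, Y)) {n : ℕ} (x : (Sing X) _⦋n⦌) :
    desing ((TopCat.toSSet.map (TopCat.ofHom g)).app (Opposite.op ⦋n⦌) x) = g.comp (desing x) :=
  rfl

theorem simplexMap_apply {m n : ℕ} (θ : Fin (m + 1) → Fin (n + 1)) (t : Simplex m)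
    (j : Fin (n + 1)) : simplexMap θ t j = ∑ i with θ i = j, t i :=
  FunOnFinite.linearMap_apply_apply ℝ ℝ θ t j

theorem sum_simplexMap_smul {E : Type*} [AddCommGroup E] [Module ℝ E] {m n : ℕ}
    (θ : Fin (m + 1) → Fin (n + 1)) (t : Simplex m) (v : Fin (n + 1) → E) :
    ∑ j, simplexMap θ t j • v j = ∑ i, t i • v (θ i) := by
  simp only [simplexMap_apply, Finset.sum_smul]
  rw [← Finset.sum_fiberwise Finset.univ θ (fun i => t i • v (θ i))]
  refine Finset.sum_congr rfl fun j _ => Finset.sum_congr rfl fun i hi => ?_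
  rw [(Finset.mem_filter.1 hi).2]

variable {E E' : Type*} [AddCommGroup E] [Module ℝ E] [TopologicalSpace E] [ContinuousAdd E]
  [ContinuousSMul ℝ E] [AddCommGroup E'] [Module ℝ E'] [TopologicalSpace E'] [ContinuousAdd E']
  [ContinuousSMul ℝ E']

/-- The affine simplex with given vertices in a convex set. -/
def comb {s : Set E} (hs : Convex ℝ s) {k : ℕ} (v : Fin (k + 1) → s) : C(Simplex k, s) where
  toFun t := ⟨∑ i, t i • (v i : E),
    hs.sum_mem (fun i _ => stdSimplex.zero_le t i) (stdSimplex.sum_eq_one t) fun i _ => (v i).2⟩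
  continuous_toFun := by
    refine Continuous.subtype_mk (continuous_finsetSum _ fun i _ => ?_) _
    exact ((continuous_apply i).comp continuous_subtype_val).smul continuous_const

theorem comb_comp_simplexMap {s : Set E} (hs : Convex ℝ s) {k m : ℕ} (v : Fin (k + 1) → s)
    (θ : Fin (m + 1) → Fin (k + 1)) :
    (comb hs v).comp (simplexMap θ) = comb hs (v ∘ θ) := by
  ext t
  exact sum_simplexMap_smul θ t fun i => (v i : E)

/-- Maps between convex sets that preserve convex combinations. -/
def PreservesComb {s : Set E} {s' : Set E'} (hs : Convex ℝ s) (hs' : Convex ℝ s')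
    (g : C(s, s')) : Prop :=
  ∀ (k : ℕ) (v : Fin (k + 1) → s), g.comp (comb hs v) = comb hs' (g ∘ v)

theorem preservesComb_of_linear {s : Set E} {s' : Set E'} (hs : Convex ℝ s) (hs' : Convex ℝ s')
    (g : C(s, s')) (L : E →ₗ[ℝ] E') (h : ∀ x : s, (g x : E') = L x) : PreservesComb hs hs' g := by
  intro k v
  ext t
  refine (h _).trans ?_
  simp [comb, h]

theorem comb_vertex (n : ℕ) :
    comb (convex_stdSimplex ℝ (Fin (n + 1))) (fun i => stdSimplex.vertex i) =
      ContinuousMap.id _ := by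
  ext t j
  simp only [comb, ContinuousMap.coe_mk, ContinuousMap.id_apply]
  change (∑ i, t i • (Pi.single i 1 : Fin (n + 1) → ℝ)) j = t j
  simp [Finset.sum_apply, Pi.single_apply]

theorem preservesComb_simplexMap {m n : ℕ} (θ : Fin (m + 1) → Fin (n + 1)) :
    PreservesComb (convex_stdSimplex ℝ _) (convex_stdSimplex ℝ _) (simplexMap θ) :=
  preservesComb_of_linear _ _ _ (FunOnFinite.linearMap ℝ ℝ θ) fun _ => rfl

variable {R : Type v} [CommRing R]

/-- The value of a singular cochain on a chain of affine simplices in a convex set that is mapped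
to `X`. -/
def ev {s : Set E} (hs : Convex ℝ s) (f : C(s, X)) {k : ℕ} (φ : Cochain (Sing X) R k) :
    TupleChain R s (k + 1) →ₗ[R] R :=
  onTuples fun v => φ (sing (f.comp (comb hs v)))

@[simp]
theorem ev_tuple {s : Set E} (hs : Convex ℝ s) (f : C(s, X)) {k : ℕ} (φ : Cochain (Sing X) R k)
    (v : Fin (k + 1) → s) : ev hs f φ (tuple R v) = φ (sing (f.comp (comb hs v))) :=
  onTuples_tuple _ _

/-- Coboundary and boundary are adjoint. Through this, identities between chains of tuples become
statements about singular cochains. -/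
theorem ev_coboundary {s : Set E} (hs : Convex ℝ s) (f : C(s, X)) {k : ℕ}
    (φ : Cochain (Sing X) R k) (c : TupleChain R s (k + 2)) :
    ev hs f (coboundary _ R k φ) c = ev hs f φ (bd c) := by
  revert c
  refine tupleChain_induction (R := R) (g := ev hs f φ ∘ₗ bd) fun v => ?_
  simp only [LinearMap.comp_apply, bd_tuple, ev_tuple, map_sum, map_smul, coboundary,
    LinearMap.coe_mk, AddHom.coe_mk, δ_sing, smul_eq_mul]
  refine Finset.sum_congr rfl fun i _ => ?_
  rw [ContinuousMap.comp_assoc, comb_comp_simplexMap]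

theorem ev_push {s : Set E} {s' : Set E'} {hs : Convex ℝ s} {hs' : Convex ℝ s'} {g : C(s, s')}
    (hg : PreservesComb hs hs' g) (f : C(s', X)) {k : ℕ} (φ : Cochain (Sing X) R k)
    (c : TupleChain R s (k + 1)) : ev hs' f φ (push g c) = ev hs (f.comp g) φ c := by
  revert c
  refine tupleChain_induction (R := R) (f := ev hs' f φ ∘ₗ push g) fun v => ?_
  simp only [LinearMap.comp_apply, push_tuple, ev_tuple]
  rw [ContinuousMap.comp_assoc, hg]

theorem ev_zero {s : Set E} (hs : Convex ℝ s) (f : C(s, X)) {k : ℕ}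
    (c : TupleChain R s (k + 1)) : ev hs f (0 : Cochain (Sing X) R k) c = 0 := by
  revert c
  exact tupleChain_induction (R := R) (g := 0) fun v => by simp

/-- Evaluation on affine simplices in the standard simplex. -/
abbrev evS {n k : ℕ} (f : C(Simplex n, X)) (φ : Cochain (Sing X) R k) :
    TupleChain R (Simplex n) (k + 1) →ₗ[R] R := ev (convex_stdSimplex ℝ _) f φ

/-- The identity simplex as a chain of tuples. -/
def fundamental (R : Type v) [CommRing R] (n : ℕ) : TupleChain R (Simplex n) (n + 1) :=
  tuple R fun i => stdSimplex.vertex i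

theorem evS_fundamental {n : ℕ} (f : C(Simplex n, X)) (φ : Cochain (Sing X) R n) :
    evS f φ (fundamental R n) = φ (sing f) := by
  rw [fundamental, ev_tuple, comb_vertex, ContinuousMap.comp_id]

theorem bd_fundamental (n : ℕ) : bd (fundamental R (n + 1)) =
    ∑ i : Fin (n + 2), (-1 : R) ^ (i : ℕ) • push (simplexMap i.succAbove) (fundamental R n) := by
  rw [fundamental, bd_tuple]
  refine Finset.sum_congr rfl fun i _ => ?_
  rw [fundamental, push_tuple]
  congr 2
  funext j
  exact (stdSimplex.map_vertex i.succAbove j).symm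

/-- A natural chain operator that is the identity on empty tuples is cohomologous to the
identity. -/
theorem natural_sub_mem_coboundaries
    (Φ : ∀ n k, TupleChain R (Simplex n) k →ₗ[R] TupleChain R (Simplex n) k)
    (hΦ : ∀ n k c, bd (Φ n (k + 1) c) = Φ n k (bd c)) (h0 : ∀ n c, Φ n 0 c = c)
    (hnat : ∀ n (i : Fin (n + 2)) k c,
      push (simplexMap i.succAbove) (Φ n k c) = Φ (n + 1) k (push (simplexMap i.succAbove) c))
    {n : ℕ} {φ : Cochain (Sing X) R n} (hφ : φ ∈ cocycles (Sing X) R n) :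
    (fun x => evS (desing x) φ (Φ n (n + 1) (fundamental R n)) - φ x) ∈
      coboundaries (Sing X) R n := by
  have hpid : ∀ {n k : ℕ} (c : TupleChain R (Simplex n) k), push id c = c := fun c => by
    revert c
    exact tupleChain_induction (R := R) (f := push id) (g := LinearMap.id) fun v => by simp
  have hb := fun n (c : TupleChain R (Simplex n) (n + 1)) =>
    bd_homotopyOp (Φ := Φ n) (j := id) (hΦ n) (fun c => by rw [h0, hpid]) c
  -- Evaluate φ on Φ - id = ∂D + D∂ at the identity simplex; the cocycle φ kills the term ∂D. In
  -- degree 0 the operator D is zero as well, as it must be since 0 is the only coboundary there.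
  have key : ∀ x : (Sing X) _⦋n⦌,
      evS (desing x) φ (Φ n (n + 1) (fundamental R n)) - φ x =
      evS (desing x) φ (homotopyOp (Φ n) id n (bd (fundamental R n))) := by
    intro x
    have h1 := ev_coboundary (convex_stdSimplex ℝ _) (desing x) φ
      (homotopyOp (Φ n) id (n + 1) (fundamental R n))
    rw [LinearMap.mem_ker.1 hφ, ev_zero, hb, map_sub, map_sub, hpid, evS_fundamental,
      sing_desing] at h1
    exact sub_eq_zero.1 h1.symm
  cases n with
  | zero =>
    change _ = _
    funext x
    rw [key]
    simp [homotopyOp]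
  | succ n =>
    -- The primitive evaluates φ on D of the identity simplex; by naturality of D its coboundary is
    -- φ on D of the boundary.
    refine ⟨fun x => evS (desing x) φ (homotopyOp (Φ n) id (n + 1) (fundamental R n)), ?_⟩
    funext x
    rw [key, bd_fundamental]
    simp only [map_sum, map_smul, coboundary, LinearMap.coe_mk, AddHom.coe_mk, smul_eq_mul]
    refine Finset.sum_congr rfl fun i _ => ?_
    rw [desing_δ, ← ev_push (preservesComb_simplexMap i.succAbove),
      push_homotopyOp (j := id) (j' := id) (hnat n i) (fun _ => rfl)]

/-! ### Homotopy invariance -/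

/-- The prism over the standard simplex. -/
abbrev prism (n : ℕ) : Set ((Fin (n + 1) → ℝ) × ℝ) := stdSimplex ℝ (Fin (n + 1)) ×ˢ Set.Icc 0 1

theorem convex_prism (n : ℕ) : Convex ℝ (prism n) :=
  (convex_stdSimplex ℝ _).prod (convex_Icc 0 1)

/-- The inclusion of the simplex at a given height of the prism. -/
def prismIncl (n : ℕ) (a : unitInterval) : C(Simplex n, prism n) where
  toFun t := ⟨(t.1, a.1), t.2, a.2⟩
  continuous_toFun := by fun_prop

/-- The map of prisms induced by a map of the vertices. -/
def prismMap {m n : ℕ} (θ : Fin (m + 1) → Fin (n + 1)) : C(prism m, prism n) where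
  toFun z := ⟨((simplexMap θ ⟨z.1.1, z.2.1⟩).1, z.1.2), (simplexMap θ ⟨z.1.1, z.2.1⟩).2, z.2.2⟩
  continuous_toFun := by fun_prop

theorem preservesComb_prismMap {m n : ℕ} (θ : Fin (m + 1) → Fin (n + 1)) :
    PreservesComb (convex_prism m) (convex_prism n) (prismMap θ) :=
  preservesComb_of_linear _ _ _ ((FunOnFinite.linearMap ℝ ℝ θ).prodMap LinearMap.id) fun _ => rfl

theorem comb_prismIncl {n k : ℕ} (a : unitInterval) (v : Fin (k + 1) → Simplex n) :
    (prismIncl n a).comp (comb (convex_stdSimplex ℝ _) v) =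
      comb (convex_prism n) (prismIncl n a ∘ v) := by
  ext t
  · simp [prismIncl, comb, Prod.fst_sum]
  · simp [prismIncl, comb, Prod.snd_sum, ← Finset.sum_mul]

/-- The prism over a singular simplex. -/
def singPrism (F : C(unitInterval × X, Y)) {n : ℕ} (f : C(Simplex n, X)) : C(prism n, Y) where
  toFun z := F (⟨z.1.2, z.2.2⟩, f ⟨z.1.1, z.2.1⟩)
  continuous_toFun := by fun_prop

theorem homotopy_sub_mem_coboundaries {f₀ f₁ : C(X, Y)} (F : f₀.Homotopy f₁) {n : ℕ}
    {φ : Cochain (Sing Y) R n} (hφ : φ ∈ cocycles (Sing Y) R n) :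
    cochainPullback (TopCat.toSSet.map (TopCat.ofHom f₁)) R n φ -
      cochainPullback (TopCat.toSSet.map (TopCat.ofHom f₀)) R n φ ∈ coboundaries (Sing X) R n := by
  -- Cones at bottom vertices over the top simplex: unfolding the recursion gives the usual
  -- triangulation of the prism.
  let P : ∀ n k, TupleChain R (Simplex n) k →ₗ[R] TupleChain R (prism n) (k + 1) := fun n =>
    homotopyOp (fun k => push (prismIncl n 1)) (prismIncl n 0)
  have hempty : ∀ n (c : TupleChain R (Simplex n) 0),
      push (prismIncl n 1) c = push (prismIncl n 0) c := fun n c => by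
    revert c
    refine tupleChain_induction (R := R) fun v => ?_
    rw [push_tuple, push_tuple]
    congr 1
    exact Subsingleton.elim _ _
  have hb := fun n (c : TupleChain R (Simplex n) (n + 1)) =>
    bd_homotopyOp (Φ := fun k => push (prismIncl n 1)) (j := prismIncl n 0)
      (fun k c => (push_bd _ _).symm) (hempty n) c
  have key : ∀ x : (Sing X) _⦋n⦌,
      (cochainPullback (TopCat.toSSet.map (TopCat.ofHom f₁)) R n φ -
        cochainPullback (TopCat.toSSet.map (TopCat.ofHom f₀)) R n φ) x =
      ev (convex_prism n) (singPrism F.toContinuousMap (desing x)) φ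
        (P n n (bd (fundamental R n))) := by
    intro x
    have h1 := ev_coboundary (convex_prism n) (singPrism F.toContinuousMap (desing x)) φ
      (P n (n + 1) (fundamental R n))
    have e1 : ∀ a : unitInterval, ev (convex_prism n) (singPrism F.toContinuousMap (desing x)) φ
        (push (prismIncl n a) (fundamental R n)) =
        φ (sing ((singPrism F.toContinuousMap (desing x)).comp (prismIncl n a))) := fun a => by
      rw [ev_push (fun k v => comb_prismIncl a v), evS_fundamental]
    rw [LinearMap.mem_ker.1 hφ, ev_zero, hb, map_sub, map_sub, e1, e1] at h1
    have e0 : (singPrism F.toContinuousMap (desing x)).comp (prismIncl n 0) =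
        f₀.comp (desing x) := by
      ext t
      exact F.apply_zero _
    have e2 : (singPrism F.toContinuousMap (desing x)).comp (prismIncl n 1) =
        f₁.comp (desing x) := by
      ext t
      exact F.apply_one _
    rw [e0, e2] at h1
    exact sub_eq_zero.1 h1.symm
  cases n with
  | zero =>
    change _ = _
    funext x
    rw [key]
    simp [P, homotopyOp]
  | succ n =>
    refine ⟨fun x => ev (convex_prism n) (singPrism F.toContinuousMap (desing x)) φ
      (P n (n + 1) (fundamental R n)), ?_⟩
    funext x
    rw [key, bd_fundamental]
    simp only [map_sum, map_smul, coboundary, LinearMap.coe_mk, AddHom.coe_mk, smul_eq_mul]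
    refine Finset.sum_congr rfl fun i _ => ?_
    congr 1
    have e3 : singPrism F.toContinuousMap (desing ((Sing X).δ i x)) =
        (singPrism F.toContinuousMap (desing x)).comp (prismMap i.succAbove) := rfl
    rw [e3, ← ev_push (preservesComb_prismMap i.succAbove)]
    congr 1
    exact push_homotopyOp (g := prismMap i.succAbove) (f := simplexMap i.succAbove)
      (fun k c => by
        revert c
        exact tupleChain_induction (R := R) (f := push (prismMap i.succAbove) ∘ₗ push (prismIncl n 1))
          (g := push (prismIncl (n + 1) 1) ∘ₗ push (simplexMap i.succAbove)) fun v => by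
            simp only [LinearMap.comp_apply, push_tuple]
            rfl) (fun _ => rfl) _

/-! ### Reversal of simplices -/

/-- Signed reversal is a natural chain operator. It serves to commute cup products, because it
exchanges front and back faces. -/
theorem reverse_sub_mem_coboundaries {n : ℕ} {φ : Cochain (Sing X) R n}
    (hφ : φ ∈ cocycles (Sing X) R n) :
    (fun x => revSign R (n + 1) * φ (sing ((desing x).comp (simplexMap Fin.rev))) - φ x) ∈
      coboundaries (Sing X) R n := by
  have h := natural_sub_mem_coboundaries (fun n => revOp) (fun n k c => bd_revOp k c)
    (fun n c => by
      revert c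
      refine tupleChain_induction (R := R) (f := revOp 0) (g := LinearMap.id) fun v => ?_
      rw [revOp_tuple, revSign, one_smul, Subsingleton.elim (v ∘ Fin.rev) v]
      rfl)
    (fun n i k c => push_revOp _ k c) hφ
  convert h using 3 with x
  rw [fundamental, revOp_tuple, map_smul, ev_tuple, smul_eq_mul]
  congr 3
  rw [← comb_comp_simplexMap, comb_vertex, ContinuousMap.id_comp]

end SingularSimplices

end

end CoveringType

namespace CoveringType

noncomputable section

/-! ### Barycentric subdivision and small simplices. -/

section SmallSimplices

open CategoryTheory Simplicial

variable {R : Type v} [CommRing R] {E E' : Type*} [NormedAddCommGroup E] [NormedSpace ℝ E]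
  [NormedAddCommGroup E'] [NormedSpace ℝ E']

/-- The barycenter of a tuple of points in a convex set. -/
def bary {s : Set E} (hs : Convex ℝ s) (k : ℕ) (v : Fin (k + 1) → s) : s :=
  comb hs v stdSimplex.barycenter

theorem map_bary {s : Set E} {s' : Set E'} {hs : Convex ℝ s} {hs' : Convex ℝ s'} {g : C(s, s')}
    (hg : PreservesComb hs hs' g) (k : ℕ) (v : Fin (k + 1) → s) :
    g (bary hs k v) = bary hs' k (g ∘ v) :=
  DFunLike.congr_fun (hg k v) _

theorem comb_mem_closedBall {s : Set E} (hs : Convex ℝ s) {k : ℕ} {v : Fin (k + 1) → s} {p : s}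
    {ρ : ℝ} (h : ∀ i, v i ∈ Metric.closedBall p ρ) (t : Simplex k) :
    comb hs v t ∈ Metric.closedBall p ρ :=
  (convex_closedBall (p : E) ρ).sum_mem (fun i _ => stdSimplex.zero_le t i)
    (stdSimplex.sum_eq_one t) fun i _ => h i

/-- The difference is the average of k + 1 vectors of length at most ρ, one of which is zero. -/
theorem dist_bary_le {s : Set E} (hs : Convex ℝ s) {k : ℕ} {v : Fin (k + 1) → s} {ρ : ℝ}
    (h : ∀ i j, dist (v i) (v j) ≤ ρ) (i : Fin (k + 1)) :
    dist (v i) (bary hs k v) ≤ k / (k + 1) * ρ := by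
  have hk : (0 : ℝ) < k + 1 := by positivity
  have e : (bary hs k v : E) - v i = ∑ j, ((k : ℝ) + 1)⁻¹ • ((v j : E) - v i) := by
    have e1 : (bary hs k v : E) = ∑ j, ((k : ℝ) + 1)⁻¹ • (v j : E) := by
      have e2 : ∀ j, (stdSimplex.barycenter : Simplex k) j = ((k : ℝ) + 1)⁻¹ := fun j => by
        change ((Fintype.card (Fin (k + 1)) : ℝ))⁻¹ = _
        rw [Fintype.card_fin]
        push_cast
        rfl
      change (∑ j, (stdSimplex.barycenter : Simplex k) j • (v j : E)) = _
      simp only [e2]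
    simp only [e1, smul_sub, Finset.sum_sub_distrib]
    congr 1
    rw [Finset.sum_const, Finset.card_univ, Fintype.card_fin, ← Nat.cast_smul_eq_nsmul ℝ,
      smul_smul]
    push_cast
    rw [mul_inv_cancel₀ hk.ne', one_smul]
  rw [dist_comm, Subtype.dist_eq, dist_eq_norm, e]
  refine (norm_sum_le _ _).trans ?_
  rw [← Finset.add_sum_erase _ _ (Finset.mem_univ i), sub_self, smul_zero, norm_zero, zero_add]
  refine (Finset.sum_le_card_nsmul _ _ (((k : ℝ) + 1)⁻¹ * ρ) fun j _ => ?_).trans ?_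
  · rw [norm_smul, Real.norm_of_nonneg (by positivity), ← dist_eq_norm]
    exact mul_le_mul_of_nonneg_left (h j i) (by positivity)
  · rw [Finset.card_erase_of_mem (Finset.mem_univ i), Finset.card_univ, Fintype.card_fin,
      Nat.add_sub_cancel, nsmul_eq_mul, div_eq_mul_inv, mul_assoc]

/-- The chains of tuples of diameter at most `ρ`. -/
def tuplesOfMesh (R : Type v) [CommRing R] {V : Type*} [PseudoMetricSpace V] (ρ : ℝ) (k : ℕ) :
    Submodule R (TupleChain R V k) :=
  Finsupp.supported R R {v | ∀ i j, dist (v i) (v j) ≤ ρ}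

theorem tuple_mem_tuplesOfMesh {V : Type*} [PseudoMetricSpace V] {ρ : ℝ} {k : ℕ} {v : Fin k → V}
    (h : ∀ i j, dist (v i) (v j) ≤ ρ) : tuple R v ∈ tuplesOfMesh R ρ k :=
  Finsupp.single_mem_supported R 1 h

/-- One factor serves all faces, since k/(k + 1) ≤ m/(m + 1) for k ≤ m. The subdivided boundary has
small mesh by induction and stays, by convexity, in the ball around the new apex that contains all
vertices; hence the cone has small mesh too. -/
theorem sdOp_mem_tuplesOfMesh {s : Set E} (hs : Convex ℝ s) {ρ : ℝ} (hρ : 0 ≤ ρ) (m : ℕ) {k : ℕ}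
    (hk : k ≤ m + 1) {c : TupleChain R s k} (hc : c ∈ tuplesOfMesh R ρ k) :
    sdOp (bary hs) k c ∈ tuplesOfMesh R (m / (m + 1) * ρ) k := by
  induction k with
  | zero =>
    refine map_mem_of_supported (fun v _ => ?_) hc
    exact tuple_mem_tuplesOfMesh fun i => i.elim0
  | succ k ih =>
    refine map_mem_of_supported (fun v hv => ?_) hc
    have hr : (k : ℝ) / (k + 1) ≤ m / (m + 1) := by
      have : (k : ℝ) ≤ m := by exact_mod_cast Nat.le_of_succ_le_succ hk
      rw [div_le_div_iff₀ (by positivity) (by positivity)]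
      nlinarith
    have hball : ∀ i, v i ∈ Metric.closedBall (bary hs k v) (m / (m + 1) * ρ) := fun i =>
      (dist_bary_le hs hv i).trans (mul_le_mul_of_nonneg_right hr hρ)
    have h1 : bd (tuple R v) ∈ tuplesOfMesh R ρ k := by
      rw [bd_tuple]
      exact Submodule.sum_mem _ fun i _ => Submodule.smul_mem _ _
        (tuple_mem_tuplesOfMesh fun a b => hv _ _)
    have h2 := ih (by omega) h1
    have h3 := sdOp_mem_tuplesIn (R := R) (B := Metric.closedBall (bary hs k v) (m / (m + 1) * ρ))
      (b := bary hs) (fun k v hv => comb_mem_closedBall hs hv _) k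
      (bd_mem_tuplesIn (tuple_mem_tuplesIn hball))
    rw [sdOp_tuple]
    have h4 : sdOp (bary hs) k (bd (tuple R v)) ∈ tuplesOfMesh R (m / (m + 1) * ρ) k ⊓
        tuplesIn R (Metric.closedBall (bary hs k v) (m / (m + 1) * ρ)) k := ⟨h2, h3⟩
    rw [tuplesOfMesh, tuplesIn, ← Finsupp.supported_inter] at h4
    refine map_mem_of_supported (fun w hw => ?_) h4
    rw [cone_tuple]
    refine tuple_mem_tuplesOfMesh fun a b => ?_
    have h5 : (0 : ℝ) ≤ m / (m + 1) * ρ := by positivity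
    refine Fin.cases ?_ (fun a => ?_) a <;> refine Fin.cases ?_ (fun b => ?_) b
    · simpa using h5
    · simpa [dist_comm] using hw.2 b
    · simpa using hw.2 a
    · simpa using hw.1 a b

/-- Iterated barycentric subdivision. -/
def sdIter {s : Set E} (hs : Convex ℝ s) (j k : ℕ) (c : TupleChain R s k) : TupleChain R s k :=
  (sdOp (bary hs) k)^[j] c

theorem sdIter_mem_tuplesOfMesh {s : Set E} (hs : Convex ℝ s) {ρ : ℝ} (hρ : 0 ≤ ρ) {k : ℕ}
    {c : TupleChain R s (k + 1)} (hc : c ∈ tuplesOfMesh R ρ (k + 1)) (j : ℕ) :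
    sdIter hs j (k + 1) c ∈ tuplesOfMesh R ((k / (k + 1)) ^ j * ρ) (k + 1) := by
  induction j with
  | zero => simpa [sdIter] using hc
  | succ j ih =>
    rw [sdIter, Function.iterate_succ_apply', pow_succ', mul_assoc]
    exact sdOp_mem_tuplesOfMesh hs (by positivity) k le_rfl ih

theorem bd_sdIter {s : Set E} (hs : Convex ℝ s) (j k : ℕ) (c : TupleChain R s (k + 1)) :
    bd (sdIter hs j (k + 1) c) = sdIter hs j k (bd c) := by
  induction j with
  | zero => rfl
  | succ j ih =>
    rw [sdIter, Function.iterate_succ_apply', bd_sdOp]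
    rw [sdIter, Function.iterate_succ_apply']
    exact congrArg _ ih

theorem push_sdIter {s : Set E} {s' : Set E'} {hs : Convex ℝ s} {hs' : Convex ℝ s'} {g : C(s, s')}
    (hg : PreservesComb hs hs' g) (j k : ℕ) (c : TupleChain R s k) :
    push g (sdIter hs j k c) = sdIter hs' j k (push g c) := by
  induction j with
  | zero => rfl
  | succ j ih =>
    rw [sdIter, Function.iterate_succ_apply', push_sdOp (map_bary hg)]
    rw [sdIter, Function.iterate_succ_apply']
    exact congrArg _ ih

theorem map_sum_sdIter {s : Set E} (hs : Convex ℝ s) (j k : ℕ) {α : Type*} (A : Finset α)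
    (a : α → R) (c : α → TupleChain R s k) :
    sdIter hs j k (∑ i ∈ A, a i • c i) = ∑ i ∈ A, a i • sdIter hs j k (c i) := by
  induction j with
  | zero => rfl
  | succ j ih =>
    simp only [sdIter, Function.iterate_succ_apply'] at ih ⊢
    rw [ih, map_sum]
    simp

variable {X : Type u} [TopologicalSpace X]

/-- The singular simplices with image in `U`. -/
def singIn (U : Set X) : SimplexFamily (Sing X) := fun _ => {x | ∀ t, desing x t ∈ U}

theorem faceClosed_singIn (U : Set X) : FaceClosed (singIn U) := fun n i x hx t => by
  rw [desing_δ]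
  exact hx _

theorem ev_eq_zero_of_mem_tuplesIn {s : Set E} (hs : Convex ℝ s) (f : C(s, X)) {U : Set X} {k : ℕ}
    {φ : Cochain (Sing X) R k} (hφ : ∀ x ∈ singIn U k, φ x = 0) {p : s} {ρ : ℝ}
    (hU : ∀ z ∈ Metric.closedBall p ρ, f z ∈ U) {c : TupleChain R s (k + 1)}
    (hc : c ∈ tuplesIn R (Metric.closedBall p ρ) (k + 1)) : ev hs f φ c = 0 := by
  refine (Submodule.mem_bot R).1 (map_mem_of_supported (fun v hv => ?_) hc)
  rw [ev_tuple, Submodule.mem_bot]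
  refine hφ _ fun t => ?_
  rw [desing_sing]
  exact hU _ (comb_mem_closedBall hs hv t)

/-- A singular cocycle that vanishes on the simplices inside the members of an open cover is a
coboundary. -/
theorem mem_coboundaries_of_small {ι : Type*} {U : ι → Set X} (hU : ∀ i, IsOpen (U i))
    (hcov : ⋃ i, U i = Set.univ) {n : ℕ} {φ : Cochain (Sing X) R n}
    (hφ : φ ∈ cocycles (Sing X) R n) (hsmall : ∀ i, ∀ x ∈ singIn (U i) n, φ x = 0) :
    φ ∈ coboundaries (Sing X) R n := by
  cases n with
  | zero =>
    change φ = 0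
    funext x
    obtain ⟨i, hi⟩ := Set.mem_iUnion.1 (hcov.symm ▸ Set.mem_univ (desing x default))
    exact hsmall i x fun t => by rwa [Subsingleton.elim t default]
  | succ n =>
    let hs := fun k => convex_stdSimplex ℝ (Fin (k + 1))
    let D : ∀ m k, TupleChain R (Simplex m) k →ₗ[R] TupleChain R (Simplex m) (k + 1) :=
      fun m => homotopyOp (sdOp (bary (hs m))) id
    have hpid : ∀ {m k : ℕ} (c : TupleChain R (Simplex m) k), push id c = c := fun c => by
      revert c
      exact tupleChain_induction (R := R) (f := push id) (g := LinearMap.id) fun v => by simp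
    have hD : ∀ m k (c : TupleChain R (Simplex m) (k + 1)), D m k (bd c) =
        sdOp (bary (hs m)) (k + 1) c - c - bd (D m (k + 1) c) := fun m k c => by
      have := bd_homotopyOp (Φ := sdOp (bary (hs m))) (j := id)
        (fun k c => bd_sdOp _ k c) (fun c => (hpid c).symm) c
      rw [hpid] at this
      simp only [D, this]
      abel
    -- Since m/(m + 1) < 1, iteration brings the mesh below a Lebesgue number of the cover pulled
    -- back to the simplex.
    have hsm : ∀ (m : ℕ) (f : C(Simplex m, X)), ∃ N : ℕ, ∀ j ≥ N, ∃ ρ : ℝ,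
        sdIter (hs m) j (m + 1) (fundamental R m) ∈ tuplesOfMesh R ρ (m + 1) ∧
        ∀ p : Simplex m, ∃ i, ∀ z ∈ Metric.closedBall p ρ, f z ∈ U i := by
      intro m f
      obtain ⟨δ, hδ, hleb⟩ := lebesgue_number_lemma_of_metric (s := Set.univ)
        (c := fun i => f ⁻¹' U i) isCompact_univ (fun i => (hU i).preimage f.continuous)
        (by rw [← Set.preimage_iUnion, hcov, Set.preimage_univ])
      have hr : (m : ℝ) / (m + 1) < 1 := by
        rw [div_lt_one (by positivity)]
        linarith
      have hlim := (tendsto_pow_atTop_nhds_zero_of_lt_one (by positivity) hr).mul_const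
        (Metric.diam (Set.univ : Set (Simplex m)))
      rw [zero_mul] at hlim
      obtain ⟨N, hN⟩ := Filter.eventually_atTop.1 (hlim.eventually_lt_const hδ)
      refine ⟨N, fun j hj => ⟨_, sdIter_mem_tuplesOfMesh (hs m) Metric.diam_nonneg
        (tuple_mem_tuplesOfMesh fun a b => Metric.dist_le_diam_of_mem
          isCompact_univ.isBounded (Set.mem_univ _) (Set.mem_univ _)) j, fun p => ?_⟩⟩
      obtain ⟨i, hi⟩ := hleb p (Set.mem_univ _)
      exact ⟨i, fun z hz => hi (Metric.closedBall_subset_ball (hN j hj) hz)⟩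
    choose N hN using hsm
    have hvan : ∀ (m : ℕ) (f : C(Simplex m, X)), ∀ j ≥ N m f, ∀ ψ : Cochain (Sing X) R m,
        (∀ i, ∀ x ∈ singIn (U i) m, ψ x = 0) →
        evS f ψ (sdIter (hs m) j (m + 1) (fundamental R m)) = 0 := by
      intro m f j hj ψ hψ
      obtain ⟨ρ, h1, h2⟩ := hN m f j hj
      refine (Submodule.mem_bot R).1 (map_mem_of_supported (fun v hv => ?_) h1)
      obtain ⟨i, hi⟩ := h2 (v 0)
      exact ev_eq_zero_of_mem_tuplesIn _ f (hψ i) hi (tuple_mem_tuplesIn fun a => hv a 0)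
    have hvanD : ∀ (f : C(Simplex n, X)), ∀ j ≥ N n f,
        evS f φ (D n (n + 1) (sdIter (hs n) j (n + 1) (fundamental R n))) = 0 := by
      intro f j hj
      obtain ⟨ρ, h1, h2⟩ := hN n f j hj
      refine (Submodule.mem_bot R).1 (map_mem_of_supported (f := evS f φ ∘ₗ D n (n + 1))
        (fun v hv => ?_) h1)
      obtain ⟨i, hi⟩ := h2 (v 0)
      exact ev_eq_zero_of_mem_tuplesIn _ f (hsmall i) hi (homotopyOp_mem_tuplesIn
        (fun k c hc => sdOp_mem_tuplesIn (fun k v hv => comb_mem_closedBall _ hv _) k hc) _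
        (tuple_mem_tuplesIn fun a => hv a 0))
    -- Morally the infinite sum of φ(D sdʲ): the terms vanish from N on, because D keeps a small
    -- tuple inside its ball. Faces may have different N, but the sum does not depend on the cutoff,
    -- so it is compatible with faces.
    let ψ : Cochain (Sing X) R n := fun y => ∑ j ∈ Finset.range (N n (desing y)),
      evS (desing y) φ (D n (n + 1) (sdIter (hs n) j (n + 1) (fundamental R n)))
    have hψ : ∀ (y : (Sing X) _⦋n⦌) (M : ℕ), N n (desing y) ≤ M → ψ y =
        ∑ j ∈ Finset.range M,
          evS (desing y) φ (D n (n + 1) (sdIter (hs n) j (n + 1) (fundamental R n))) := by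
      intro y M hM
      refine Finset.sum_subset (Finset.range_mono hM) fun j _ hj => ?_
      exact hvanD _ j (by simpa using hj)
    refine ⟨-ψ, ?_⟩
    rw [map_neg, neg_eq_iff_eq_neg]
    funext x
    -- A common cutoff for x and all its faces. With it the coboundary of ψ telescopes to φ(sdᴹ) -
    -- φ, and φ(sdᴹ) = 0 because the tuples are small.
    let M := N (n + 1) (desing x) +
      ∑ i : Fin (n + 2), N n (desing ((Sing X).δ i x))
    have hM : ∀ i, N n (desing ((Sing X).δ i x)) ≤ M := fun i =>
      (Finset.single_le_sum (f := fun i => N n (desing ((Sing X).δ i x)))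
        (fun _ _ => Nat.zero_le _) (Finset.mem_univ i)).trans (Nat.le_add_left _ _)
    calc coboundary _ R n ψ x
        = ∑ i : Fin (n + 2), (-1 : R) ^ (i : ℕ) * ∑ j ∈ Finset.range M,
            evS (desing x) φ (D (n + 1) (n + 1) (sdIter (hs (n + 1)) j (n + 1)
              (push (simplexMap i.succAbove) (fundamental R n)))) := by
          simp only [coboundary, LinearMap.coe_mk, AddHom.coe_mk]
          refine Finset.sum_congr rfl fun i _ => ?_
          rw [hψ _ M (hM i)]
          congr 1
          refine Finset.sum_congr rfl fun j _ => ?_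
          have hi := preservesComb_simplexMap (m := n) (n := n + 1) i.succAbove
          rw [desing_δ, ← ev_push hi, ← push_sdIter hi]
          congr 1
          exact push_homotopyOp (j := id) (j' := id) (fun k c => push_sdOp (map_bary hi) k c)
            (fun _ => rfl) _
      _ = ∑ j ∈ Finset.range M, evS (desing x) φ (D (n + 1) (n + 1)
            (sdIter (hs (n + 1)) j (n + 1) (bd (fundamental R (n + 1))))) := by
          simp only [Finset.mul_sum]
          rw [Finset.sum_comm]
          refine Finset.sum_congr rfl fun j _ => ?_
          rw [bd_fundamental, map_sum_sdIter, map_sum, map_sum]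
          simp
      _ = ∑ j ∈ Finset.range M,
            (evS (desing x) φ (sdIter (hs (n + 1)) (j + 1) (n + 2) (fundamental R (n + 1))) -
              evS (desing x) φ (sdIter (hs (n + 1)) j (n + 2) (fundamental R (n + 1)))) := by
          refine Finset.sum_congr rfl fun j _ => ?_
          rw [← bd_sdIter, hD, map_sub, map_sub, ← ev_coboundary, LinearMap.mem_ker.1 hφ, ev_zero,
            sub_zero, sdIter, sdIter, Function.iterate_succ_apply']
      _ = - φ x := by
          rw [Finset.sum_range_sub (fun j => evS (desing x) φ
            (sdIter (hs (n + 1)) j (n + 2) (fundamental R (n + 1)))),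
            hvan (n + 1) _ M (Nat.le_add_right _ _) φ hsmall, zero_sub]
          change -(evS (desing x) φ (fundamental R (n + 1))) = _
          rw [evS_fundamental, sing_desing]

end SmallSimplices

end

end CoveringType

namespace CoveringType

noncomputable section

/-! ### Cohomology classes: products up to sign, restriction to open sets, vanishing on families. -/

section Classes

open CategoryTheory Simplicial

variable {S T : SSet.{u}} {R : Type v} [CommRing R]

/-- The cohomology class of a cocycle. -/
def cls {n : ℕ} (φ : Cochain S R n) (hφ : φ ∈ cocycles S R n) : SCohomology S R n :=
  Submodule.Quotient.mk ⟨φ, hφ⟩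

theorem exists_cls {n : ℕ} (u : SCohomology S R n) :
    ∃ (φ : Cochain S R n) (hφ : φ ∈ cocycles S R n), u = cls φ hφ := by
  obtain ⟨⟨φ, hφ⟩, rfl⟩ := Submodule.Quotient.mk_surjective _ u
  exact ⟨φ, hφ, rfl⟩

theorem cls_eq_iff {n : ℕ} {φ ψ : Cochain S R n} {hφ : φ ∈ cocycles S R n}
    {hψ : ψ ∈ cocycles S R n} : cls φ hφ = cls ψ hψ ↔ φ - ψ ∈ coboundaries S R n :=
  Submodule.Quotient.eq _

theorem cls_eq_zero_iff {n : ℕ} {φ : Cochain S R n} {hφ : φ ∈ cocycles S R n} :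
    cls φ hφ = 0 ↔ φ ∈ coboundaries S R n :=
  Submodule.Quotient.mk_eq_zero _

theorem cls_smul {n : ℕ} (r : R) (φ : Cochain S R n) (hφ : φ ∈ cocycles S R n) :
    cls (r • φ) (Submodule.smul_mem _ r hφ) = r • cls φ hφ := rfl

variable {X Y : Type u} [TopologicalSpace X] [TopologicalSpace Y]

/-- The product of homogeneous classes. -/
def hmul (a b : HomogeneousClass X R) : HomogeneousClass X R := ⟨a.1 + b.1, cup a.2 b.2⟩

theorem cupList_cons (a : HomogeneousClass X R) (s : List (HomogeneousClass X R)) :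
    cupList (a :: s) = hmul a (cupList s) := rfl

theorem hmul_cls {p q n : ℕ} (h : p + q = n) {φ : Cochain (Sing X) R p} {ψ : Cochain (Sing X) R q}
    (hφ : φ ∈ cocycles (Sing X) R p) (hψ : ψ ∈ cocycles (Sing X) R q) :
    hmul ⟨p, cls φ hφ⟩ ⟨q, cls ψ hψ⟩ =
      (⟨n, cls (cupCochain h φ ψ) (cupCochain_mem_cocycles h hφ hψ)⟩ : HomogeneousClass X R) := by
  subst h
  rfl

theorem hmul_assoc (a b c : HomogeneousClass X R) :
    hmul (hmul a b) c = hmul a (hmul b c) := by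
  obtain ⟨p, u⟩ := a
  obtain ⟨q, v⟩ := b
  obtain ⟨r, w⟩ := c
  obtain ⟨φ, hφ, rfl⟩ := exists_cls u
  obtain ⟨ψ, hψ, rfl⟩ := exists_cls v
  obtain ⟨χ, hχ, rfl⟩ := exists_cls w
  rw [hmul_cls rfl hφ hψ, hmul_cls rfl hψ hχ, hmul_cls rfl, hmul_cls (add_assoc p q r).symm]
  congr 2
  funext x
  simp only [cupCochain, map_map_op]
  have hm : ∀ {l m : ℕ} (f g : ⦋l⦌ ⟶ ⦋m⦌) (y : (Sing X).obj (Opposite.op ⦋m⦌)),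
      f = g → (Sing X).map f.op y = (Sing X).map g.op y := fun _ _ _ e => by rw [e]
  rw [mul_assoc]
  congr 2
  congr 1
  rw [hm _ _ x]
  apply hom_ext_val
  intro j
  simp [subinterval_val]
  omega

/-- Two homogeneous classes agree up to sign. -/
def SignEq (a b : HomogeneousClass X R) : Prop :=
  ∃ (n : ℕ) (u : Cohomology X R n), a = ⟨n, u⟩ ∧ (b = ⟨n, u⟩ ∨ b = ⟨n, -u⟩)

theorem SignEq.refl (a : HomogeneousClass X R) : SignEq a a := ⟨a.1, a.2, rfl, Or.inl rfl⟩

theorem SignEq.trans {a b c : HomogeneousClass X R} (h : SignEq a b) (h' : SignEq b c) :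
    SignEq a c := by
  obtain ⟨n, u, rfl, h⟩ := h
  obtain ⟨m, w, rfl, h'⟩ := h'
  rcases h with h | h <;> cases h <;> rcases h' with rfl | rfl
  · exact ⟨n, u, rfl, Or.inl rfl⟩
  · exact ⟨n, u, rfl, Or.inr rfl⟩
  · exact ⟨n, u, rfl, Or.inr rfl⟩
  · exact ⟨n, u, rfl, Or.inl (by rw [neg_neg])⟩

theorem SignEq.ne_zero {a b : HomogeneousClass X R} (h : SignEq a b) (ha : a.2 ≠ 0) :
    b.2 ≠ 0 := by
  obtain ⟨n, u, rfl, rfl | rfl⟩ := h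
  · exact ha
  · exact neg_ne_zero.2 ha

theorem hmul_neg (a : HomogeneousClass X R) (n : ℕ) (u : Cohomology X R n) :
    hmul a ⟨n, -u⟩ = ⟨a.1 + n, -(hmul a ⟨n, u⟩).2⟩ := by
  obtain ⟨p, w⟩ := a
  obtain ⟨φ, hφ, rfl⟩ := exists_cls u
  obtain ⟨ψ, hψ, rfl⟩ := exists_cls w
  refine congrArg (Sigma.mk (p + n)) (cls_eq_iff.2 ?_)
  convert Submodule.zero_mem _
  funext x
  change ψ _ * (-(φ _)) - -(ψ _ * φ _) = 0
  ring

theorem neg_hmul (a : HomogeneousClass X R) (n : ℕ) (u : Cohomology X R n) :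
    hmul ⟨n, -u⟩ a = ⟨n + a.1, -(hmul ⟨n, u⟩ a).2⟩ := by
  obtain ⟨p, w⟩ := a
  obtain ⟨φ, hφ, rfl⟩ := exists_cls u
  obtain ⟨ψ, hψ, rfl⟩ := exists_cls w
  refine congrArg (Sigma.mk (n + p)) (cls_eq_iff.2 ?_)
  convert Submodule.zero_mem _
  funext x
  change -(φ _) * ψ _ - -(φ _ * ψ _) = 0
  ring

theorem SignEq.hmul_left {a b : HomogeneousClass X R} (c : HomogeneousClass X R)
    (h : SignEq a b) : SignEq (hmul c a) (hmul c b) := by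
  obtain ⟨n, u, rfl, rfl | rfl⟩ := h
  · exact SignEq.refl _
  · exact ⟨_, _, rfl, Or.inr (hmul_neg c n u)⟩

theorem SignEq.hmul_right {a b : HomogeneousClass X R} (c : HomogeneousClass X R)
    (h : SignEq a b) : SignEq (hmul a c) (hmul b c) := by
  obtain ⟨n, u, rfl, rfl | rfl⟩ := h
  · exact SignEq.refl _
  · exact ⟨_, _, rfl, Or.inr (neg_hmul c n u)⟩

theorem simplexMap_comp {l m n : ℕ} (θ : Fin (m + 1) → Fin (n + 1)) (η : Fin (l + 1) → Fin (m + 1)) :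
    (simplexMap θ).comp (simplexMap η) = simplexMap (θ ∘ η) := by
  ext1 t
  exact stdSimplex.map_comp_apply η θ t

/-- The signed reversal of a cochain. -/
def reverse {n : ℕ} (φ : Cochain (Sing X) R n) : Cochain (Sing X) R n := fun x =>
  revSign R (n + 1) * φ (sing ((desing x).comp (simplexMap Fin.rev)))

theorem reverse_mem_cocycles {n : ℕ} {φ : Cochain (Sing X) R n} (hφ : φ ∈ cocycles (Sing X) R n) :
    reverse φ ∈ cocycles (Sing X) R n := by
  have h := coboundary_eq_zero_of_mem (reverse_sub_mem_coboundaries hφ)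
  rw [show (fun x => revSign R (n + 1) * φ (sing ((desing x).comp (simplexMap Fin.rev))) - φ x) =
    reverse φ - φ from rfl, map_sub, LinearMap.mem_ker.1 hφ, sub_zero] at h
  exact LinearMap.mem_ker.2 h

theorem cls_reverse {n : ℕ} {φ : Cochain (Sing X) R n} (hφ : φ ∈ cocycles (Sing X) R n) :
    cls (reverse φ) (reverse_mem_cocycles hφ) = cls φ hφ :=
  cls_eq_iff.2 (reverse_sub_mem_coboundaries hφ)

/-- The front p-face of a reversed simplex is the reversed back p-face. -/
theorem reverse_cupCochain {p q n : ℕ} (h : p + q = n) (φ : Cochain (Sing X) R p)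
    (ψ : Cochain (Sing X) R q) : reverse (cupCochain h φ ψ) =
      (revSign R (n + 1) * revSign R (p + 1) * revSign R (q + 1)) •
        cupCochain ((add_comm q p).trans h) (reverse ψ) (reverse φ) := by
  funext x
  obtain ⟨f, rfl⟩ : ∃ f, x = sing f := ⟨desing x, (sing_desing x).symm⟩
  have e1 : (f.comp (simplexMap Fin.rev)).comp (simplexMap
      (SimplexCategory.subinterval (n := n) 0 p (by omega)).toOrderHom) =
      (f.comp (simplexMap (SimplexCategory.subinterval (n := n) q p (by omega)).toOrderHom)).comp
        (simplexMap Fin.rev) := by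
    rw [ContinuousMap.comp_assoc, ContinuousMap.comp_assoc, simplexMap_comp, simplexMap_comp]
    congr 2
    funext j
    apply Fin.ext
    have := j.2
    simp only [Function.comp_apply, Fin.val_rev, subinterval_val, SimplexCategory.len_mk] at this ⊢
    omega
  have e2 : (f.comp (simplexMap Fin.rev)).comp (simplexMap
      (SimplexCategory.subinterval (n := n) p q (by omega)).toOrderHom) =
      (f.comp (simplexMap (SimplexCategory.subinterval (n := n) 0 q (by omega)).toOrderHom)).comp
        (simplexMap Fin.rev) := by
    rw [ContinuousMap.comp_assoc, ContinuousMap.comp_assoc, simplexMap_comp, simplexMap_comp]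
    congr 2
    funext j
    apply Fin.ext
    have := j.2
    simp only [Function.comp_apply, Fin.val_rev, subinterval_val, SimplexCategory.len_mk] at this ⊢
    omega
  simp only [reverse, cupCochain, map_sing, desing_sing, Pi.smul_apply, smul_eq_mul]
  rw [e1, e2]
  have hp := revSign_mul_self (R := R) (p + 1)
  have hq := revSign_mul_self (R := R) (q + 1)
  generalize φ _ = A
  generalize ψ _ = B
  linear_combination (-revSign R (n + 1) * A * B) * hp -
    (revSign R (n + 1) * A * B) * revSign R (p + 1) * revSign R (p + 1) * hq

/-- A cocycle and its signed reversal are cohomologous, and reversal exchanges the factors. The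
exact sign is not needed: only the non-vanishing of permuted products is used. -/
theorem signEq_hmul_comm (a b : HomogeneousClass X R) : SignEq (hmul a b) (hmul b a) := by
  obtain ⟨p, u⟩ := a
  obtain ⟨q, w⟩ := b
  obtain ⟨φ, hφ, rfl⟩ := exists_cls u
  obtain ⟨ψ, hψ, rfl⟩ := exists_cls w
  have h1 : hmul ⟨p, cls φ hφ⟩ ⟨q, cls ψ hψ⟩ = (⟨p + q, _⟩ : HomogeneousClass X R) :=
    hmul_cls rfl hφ hψ
  have h3 : hmul ⟨q, cls ψ hψ⟩ ⟨p, cls φ hφ⟩ =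
      (⟨p + q, cls (cupCochain (add_comm q p) (reverse ψ) (reverse φ))
        (cupCochain_mem_cocycles _ (reverse_mem_cocycles hψ) (reverse_mem_cocycles hφ))⟩ :
        HomogeneousClass X R) := by
    rw [← cls_reverse hφ, ← cls_reverse hψ]
    exact hmul_cls (add_comm q p) (reverse_mem_cocycles hψ) (reverse_mem_cocycles hφ)
  have h4 := cls_reverse (cupCochain_mem_cocycles (rfl : p + q = p + q) hφ hψ)
  simp only [reverse_cupCochain] at h4
  rw [cls_smul] at h4
  rw [h1, h3, ← h4]
  have hs : revSign R (p + q + 1) * revSign R (p + 1) * revSign R (q + 1) = 1 ∨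
      revSign R (p + q + 1) * revSign R (p + 1) * revSign R (q + 1) = -1 := by
    rcases revSign_eq (R := R) (p + q + 1) with e | e <;>
      rcases revSign_eq (R := R) (p + 1) with e' | e' <;>
      rcases revSign_eq (R := R) (q + 1) with e'' | e'' <;> rw [e, e', e''] <;> simp
  refine ⟨_, _, rfl, ?_⟩
  rcases hs with e | e
  · left
    rw [e, one_smul]
  · right
    rw [e, neg_one_smul, neg_neg]

theorem signEq_cupList_of_perm {s t : List (HomogeneousClass X R)} (h : s.Perm t) :
    SignEq (cupList s) (cupList t) := by
  induction h with
  | nil => exact SignEq.refl _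
  | cons a _ ih => exact ih.hmul_left a
  | swap a b l =>
    rw [cupList_cons, cupList_cons, cupList_cons, cupList_cons, ← hmul_assoc, ← hmul_assoc]
    exact (signEq_hmul_comm b a).hmul_right _
  | trans _ _ ih ih' => exact ih.trans ih'

/-- The pullback of homogeneous classes. -/
def hpull (f : C(X, Y)) (a : HomogeneousClass Y R) : HomogeneousClass X R :=
  ⟨a.1, pullback f R a.1 a.2⟩

theorem hpull_hmul (f : C(X, Y)) (a b : HomogeneousClass Y R) :
    hpull f (hmul a b) = hmul (hpull f a) (hpull f b) := by
  obtain ⟨p, u⟩ := a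
  obtain ⟨q, w⟩ := b
  obtain ⟨φ, hφ, rfl⟩ := exists_cls u
  obtain ⟨ψ, hψ, rfl⟩ := exists_cls w
  rfl

theorem hpull_cupList (f : C(X, Y)) (s : List (HomogeneousClass Y R)) :
    hpull f (cupList s) = cupList (s.map (hpull f)) := by
  induction s with
  | nil => rfl
  | cons a s ih => rw [cupList_cons, hpull_hmul, ih, List.map_cons, cupList_cons]

theorem pullback_comp {Z : Type u} [TopologicalSpace Z] (g : C(Y, Z)) (f : C(X, Y)) (n : ℕ)
    (u : Cohomology Z R n) : pullback (g.comp f) R n u = pullback f R n (pullback g R n u) := by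
  obtain ⟨φ, hφ, rfl⟩ := exists_cls u
  rfl

theorem pullback_id (n : ℕ) (u : Cohomology X R n) : pullback (ContinuousMap.id X) R n u = u := by
  obtain ⟨φ, hφ, rfl⟩ := exists_cls u
  rfl

theorem pullback_eq_of_homotopic {f g : C(X, Y)} (h : f.Homotopic g) (n : ℕ)
    (u : Cohomology Y R n) : pullback f R n u = pullback g R n u := by
  obtain ⟨φ, hφ, rfl⟩ := exists_cls u
  obtain ⟨F⟩ := h.symm
  exact cls_eq_iff.2 (homotopy_sub_mem_coboundaries F hφ)

theorem pullback_eq_zero_of_isEmpty [IsEmpty X] (f : C(X, Y)) (n : ℕ) (u : Cohomology Y R n) :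
    pullback f R n u = 0 := by
  obtain ⟨φ, hφ, rfl⟩ := exists_cls u
  refine cls_eq_zero_iff.2 ?_
  convert Submodule.zero_mem _
  funext x
  exact isEmptyElim (desing x (stdSimplex.vertex 0))

/-! ### Restriction to subspaces -/

/-- The inclusion of a subspace. -/
def incl (U : Set X) : C(U, X) := ⟨Subtype.val, continuous_subtype_val⟩

/-- The inclusion of singular simplicial sets induced by the inclusion of a subspace. -/
abbrev singIncl (U : Set X) : Sing U ⟶ Sing X := TopCat.toSSet.map (TopCat.ofHom (incl U))

theorem singIncl_injective (U : Set X) (n : ℕ) :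
    Function.Injective ((singIncl U).app (Opposite.op ⦋n⦌)) := by
  intro x y h
  have h' := congrArg desing h
  rw [desing_app, desing_app] at h'
  rw [← sing_desing x, ← sing_desing y]
  congr 1
  ext t
  exact DFunLike.congr_fun h' t

theorem singIncl_mem (U : Set X) (n : ℕ) (y : (Sing U) _⦋n⦌) :
    (singIncl U).app (Opposite.op ⦋n⦌) y ∈ singIn U n := fun t => by
  rw [desing_app]
  exact (desing y t).2

theorem exists_of_mem_singIn {U : Set X} {n : ℕ} {x : (Sing X) _⦋n⦌} (hx : x ∈ singIn U n) :
    ∃ y, (singIncl U).app (Opposite.op ⦋n⦌) y = x := by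
  refine ⟨sing ⟨fun t => ⟨desing x t, hx t⟩, by fun_prop⟩, ?_⟩
  rw [app_sing]
  exact sing_desing x

theorem exactOn_singIn {U : Set X} {n : ℕ} {φ : Cochain (Sing X) R n}
    (h : cochainPullback (singIncl U) R n φ ∈ coboundaries (Sing U) R n) :
    ExactOn (singIn U) φ := by
  obtain ⟨β, hβ, e⟩ := exists_coboundary_extend (singIncl U) (singIncl_injective U) h
  refine ⟨β, hβ, fun x hx => ?_⟩
  obtain ⟨y, rfl⟩ := exists_of_mem_singIn hx
  exact (congrFun e y).symm

/-- These cochains are not normalized, so constants must be handled by parity: the coboundary of the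
constant r in degree m is 0 for even m and r for odd m. The simplex x is where the cocycle condition
forces r = 0 in odd degrees. -/
theorem const_mem_coboundaries {n : ℕ} {r : R} {x : S _⦋n + 2⦌}
    (h : (fun _ => r : Cochain S R (n + 1)) ∈ cocycles S R (n + 1)) :
    (fun _ => r : Cochain S R (n + 1)) ∈ coboundaries S R (n + 1) := by
  have hc : ∀ (m : ℕ) (y : S _⦋m + 1⦌), coboundary S R m (fun _ => r) y =
      if Even m then 0 else r := fun m y => by
    simp only [coboundary, LinearMap.coe_mk, AddHom.coe_mk, ← Finset.sum_mul]
    rw [Fin.sum_univ_eq_sum_range (fun i => (-1 : R) ^ i), neg_one_geom_sum]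
    by_cases hm : Even m
    · have : Even (m + 2) := by simpa [Nat.even_add] using hm
      simp [hm, this]
    · have : ¬ Even (m + 2) := by simpa [Nat.even_add] using hm
      simp [hm, this]
  by_cases hn : Even n
  · have h1 := congrFun (LinearMap.mem_ker.1 h) x
    rw [hc, if_neg (by simpa [Nat.even_add_one] using hn)] at h1
    obtain rfl : r = 0 := h1
    exact Submodule.zero_mem _
  · refine ⟨fun _ => r, ?_⟩
    funext y
    rw [hc, if_neg hn]

/-- A contraction makes every cocycle on U cohomologous to its pullback along a constant map, which
is a constant cochain. -/
theorem acyclic_singIn (U : Set X) [ContractibleSpace U] : Acyclic R (singIn U) := by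
  obtain ⟨c, ⟨F⟩⟩ := id_nullhomotopic U
  have hφU : ∀ {n : ℕ} {φ : Cochain (Sing X) R n}, CocycleOn (singIn U) φ →
      cochainPullback (singIncl U) R n φ ∈ cocycles (Sing U) R n := by
    intro n φ hφ
    rw [LinearMap.mem_ker, coboundary_pullback]
    funext y
    exact hφ _ (singIncl_mem U _ y)
  have hconst : ∀ {n : ℕ} {φ : Cochain (Sing X) R n}, CocycleOn (singIn U) φ →
      ∃ r : R, (fun _ => r : Cochain (Sing U) R n) ∈ cocycles (Sing U) R n ∧
      cochainPullback (singIncl U) R n φ - (fun _ => r) ∈ coboundaries (Sing U) R n := by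
    intro n φ hφ
    refine ⟨cochainPullback (singIncl U) R n φ (sing (ContinuousMap.const _ c)), ?_, ?_⟩
    · have h1 := coboundary_pullback (TopCat.toSSet.map (TopCat.ofHom (ContinuousMap.const U c))) n
        (cochainPullback (singIncl U) R n φ)
      rw [LinearMap.mem_ker.1 (hφU hφ), map_zero] at h1
      exact LinearMap.mem_ker.2 h1
    · have h2 := homotopy_sub_mem_coboundaries F (hφU hφ)
      rw [← Submodule.neg_mem_iff, neg_sub] at h2
      exact h2
  refine ⟨⟨sing (ContinuousMap.const _ (c : X)), fun t => ?_⟩, fun φ hφ => ?_, fun n φ hφ => ?_⟩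
  · rw [desing_sing]
    exact c.2
  · obtain ⟨r, -, h⟩ := hconst hφ
    refine ⟨r, fun x hx => ?_⟩
    obtain ⟨y, rfl⟩ := exists_of_mem_singIn hx
    exact sub_eq_zero.1 (congrFun (show _ = 0 from h) y)
  · obtain ⟨r, hr, h⟩ := hconst hφ
    refine exactOn_singIn ?_
    have h2 := Submodule.add_mem _ h
      (const_mem_coboundaries (x := sing (ContinuousMap.const _ c)) hr)
    rwa [sub_add_cancel] at h2

theorem interOn_singIn {ι : Type*} (U : ι → Set X) (σ : Finset ι) :
    interOn (fun i => singIn (U i)) σ = singIn (⋂ i ∈ σ, U i) := by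
  funext n
  ext x
  simp only [interOn, singIn, Set.mem_iInter, Set.mem_ofPred_eq]
  exact ⟨fun h t i hi => h i hi t, fun h i hi t => h t i hi⟩

theorem singIn_empty (n : ℕ) : singIn (∅ : Set X) n = ∅ :=
  Set.eq_empty_of_forall_notMem fun _ hx => hx (stdSimplex.vertex 0)

/-- A map that is compatible with open covers whose intersections are contractible or empty in the
same way is injective in cohomology. -/
theorem pullback_injective_of_covers {ι : Type*} [Fintype ι] (g : C(Y, X)) {U : ι → Set X}
    {V : ι → Set Y} (hU : ∀ i, IsOpen (U i)) (hcov : ⋃ i, U i = Set.univ)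
    (hg : ∀ i, ∀ y ∈ V i, g y ∈ U i)
    (hσ : ∀ σ : Finset ι, σ.Nonempty →
      (ContractibleSpace (⋂ i ∈ σ, V i : Set Y) ∧ ContractibleSpace (⋂ i ∈ σ, U i : Set X)) ∨
      ((⋂ i ∈ σ, V i) = ∅ ∧ (⋂ i ∈ σ, U i) = ∅)) (n : ℕ) (u : Cohomology X R n)
    (hu : pullback g R n u = 0) : u = 0 := by
  classical
  obtain ⟨φ, hφ, rfl⟩ := exists_cls u
  have h1 : cochainPullback _ R n φ ∈ coboundaries (Sing Y) R n := cls_eq_zero_iff.1 hu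
  have hf : ∀ (A : Set Y) (B : Set X), (∀ y ∈ A, g y ∈ B) → ∀ n, ∀ x ∈ singIn A n,
      (TopCat.toSSet.map (TopCat.ofHom g)).app (Opposite.op ⦋n⦌) x ∈ singIn B n := by
    intro A B hAB n x hx t
    rw [desing_app]
    exact hAB _ (hx t)
  -- Only the small simplices are compared here. As injectivity is all that is claimed, the sets V i
  -- need not cover Y.
  have iso := IsoOn.unionOn (R := R) (TopCat.toSSet.map (TopCat.ofHom g)) Finset.univ
    (fun i => singIn (V i)) (fun i => singIn (U i)) (fun i => faceClosed_singIn _)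
    (fun i => faceClosed_singIn _) (fun i => hf _ _ (hg i)) (by
      intro σ _ hne
      rw [interOn_singIn, interOn_singIn]
      rcases hσ σ hne with ⟨h2, h3⟩ | ⟨h2, h3⟩
      · exact IsoOn.of_acyclic _ (hf _ _ fun y hy => by
          simp only [Set.mem_iInter] at hy ⊢
          exact fun i hi => hg i y (hy i hi)) (acyclic_singIn _) (acyclic_singIn _)
      · rw [h2, h3]
        exact IsoOn.of_empty _ singIn_empty singIn_empty)
  obtain ⟨β, hβ, e⟩ := iso.inj n φ (fun x _ => congrFun (LinearMap.mem_ker.1 hφ) x)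
    ⟨_, h1, fun _ _ => rfl⟩
  refine cls_eq_zero_iff.2 ?_
  -- The cocycle φ - β vanishes on all simplices inside members of the cover of X, hence is a
  -- coboundary on all simplices.
  have h2 := mem_coboundaries_of_small hU hcov
    (Submodule.sub_mem _ hφ (LinearMap.mem_ker.2 (coboundary_eq_zero_of_mem hβ)))
    (fun i x hx => sub_eq_zero.2 (e x (Set.mem_iUnion₂.2 ⟨i, Finset.mem_univ i, hx⟩)))
  simpa using Submodule.add_mem _ h2 hβ

/-! ### Classes that vanish on families of subspaces -/

/-- The class `a` is represented by a cocycle that vanishes on all simplices inside members of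
`𝒜`. -/
def VanishesOn (𝒜 : Set (Set X)) (a : HomogeneousClass X R) : Prop :=
  ∃ (φ : Cochain (Sing X) R a.1) (hφ : φ ∈ cocycles (Sing X) R a.1), a.2 = cls φ hφ ∧
    ∀ U ∈ 𝒜, ∀ x ∈ singIn U a.1, φ x = 0

theorem vanishesOn_empty (a : HomogeneousClass X R) : VanishesOn ∅ a := by
  obtain ⟨φ, hφ, h⟩ := exists_cls a.2
  exact ⟨φ, hφ, h, by simp⟩

/-- The relative cup product at the level of cochains: the faces of a simplex inside U are inside U,
so one vanishing factor suffices. -/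
theorem VanishesOn.hmul {𝒜 ℬ : Set (Set X)} {a b : HomogeneousClass X R} (ha : VanishesOn 𝒜 a)
    (hb : VanishesOn ℬ b) : VanishesOn (𝒜 ∪ ℬ) (hmul a b) := by
  obtain ⟨φ, hφ, ha, h1⟩ := ha
  obtain ⟨ψ, hψ, hb, h2⟩ := hb
  have hf : ∀ {m k : ℕ} (θ : ⦋m⦌ ⟶ ⦋k⦌) {U : Set X} {x : (Sing X) _⦋k⦌}, x ∈ singIn U k →
      (Sing X).map θ.op x ∈ singIn U m := fun θ U x hx t => by
    rw [← sing_desing x, map_sing, desing_sing]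
    exact hx _
  refine ⟨cupCochain rfl φ ψ, cupCochain_mem_cocycles rfl hφ hψ, ?_, fun U hU x hx => ?_⟩
  · change cup a.2 b.2 = _
    rw [ha, hb]
    rfl
  · change φ _ * ψ _ = 0
    rcases hU with hU | hU
    · rw [h1 U hU _ (hf _ hx), zero_mul]
    · rw [h2 U hU _ (hf _ hx), mul_zero]

theorem vanishesOn_of_exactOn {𝒜 : Set (Set X)} {n : ℕ} {φ : Cochain (Sing X) R n}
    (hφ : φ ∈ cocycles (Sing X) R n) {A : SimplexFamily (Sing X)} (hA : ∀ U ∈ 𝒜, singIn U ≤ A)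
    (h : ExactOn A φ) : VanishesOn 𝒜 (⟨n, cls φ hφ⟩ : HomogeneousClass X R) := by
  obtain ⟨β, hβ, e⟩ := h
  refine ⟨φ - β, Submodule.sub_mem _ hφ (LinearMap.mem_ker.2 (coboundary_eq_zero_of_mem hβ)),
    ?_, fun U hU x hx => sub_eq_zero.2 (e x (hA U hU _ hx))⟩
  exact cls_eq_iff.2 (by simpa using hβ)

theorem vanishesOn_of_pullback {U : Set X} {a : HomogeneousClass X R}
    (h : pullback (incl U) R a.1 a.2 = 0) : VanishesOn {U} a := by
  obtain ⟨n, u⟩ := a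
  obtain ⟨φ, hφ, rfl⟩ := exists_cls u
  exact vanishesOn_of_exactOn hφ (A := singIn U) (by rintro _ rfl; exact le_rfl)
    (exactOn_singIn (cls_eq_zero_iff.1 h))

theorem VanishesOn.eq_zero {𝒜 : Set (Set X)} {a : HomogeneousClass X R} (h : VanishesOn 𝒜 a)
    (ho : ∀ U ∈ 𝒜, IsOpen U) (hcov : ⋃₀ 𝒜 = Set.univ) : a.2 = 0 := by
  obtain ⟨φ, hφ, ha, h1⟩ := h
  rw [ha]
  exact cls_eq_zero_iff.2 (mem_coboundaries_of_small (U := fun U : 𝒜 => (U : Set X))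
    (fun U => ho U U.2) (by rw [← Set.sUnion_eq_iUnion, hcov]) hφ fun U x hx => h1 U U.2 x hx)

/-- If no `d + 1` members of a family with contractible intersections meet, then the classes of
degree `d` vanish on the family. -/
theorem vanishesOn_of_nerve {ι : Type*} {U : ι → Set X} (s : Finset ι)
    (hσ : ∀ σ ⊆ s, σ.Nonempty → ContractibleSpace (⋂ i ∈ σ, U i : Set X) ∨ (⋂ i ∈ σ, U i) = ∅)
    (a : HomogeneousClass X R) (hd : ∀ σ ⊆ s, σ.card = a.1 + 1 → (⋂ i ∈ σ, U i) = ∅) :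
    VanishesOn (U '' s) a := by
  classical
  obtain ⟨n, u⟩ := a
  obtain ⟨φ, hφ, rfl⟩ := exists_cls u
  refine vanishesOn_of_exactOn hφ (A := unionOn (fun i => singIn (U i)) s) ?_
    (exactOn_unionOn s _ n (fun i => faceClosed_singIn _) ?_ ?_ φ
      fun x _ => congrFun (LinearMap.mem_ker.1 hφ) x)
  · rintro _ ⟨i, hi, rfl⟩ m x hx
    exact Set.mem_iUnion₂.2 ⟨i, hi, hx⟩
  · intro σ h1 h2
    rw [interOn_singIn]
    rcases hσ σ h1 h2 with h3 | h3
    · exact Or.inl (acyclic_singIn _)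
    · rw [h3]
      exact Or.inr singIn_empty
  · intro σ h1 h2
    rw [interOn_singIn, hd σ h1 h2]
    exact singIn_empty

end Classes

end

end CoveringType

namespace CoveringType

noncomputable section

/-! ### The polyhedron of a complex, with unnormalized coordinates, and the stars of its vertices.
-/

section Polyhedron

open scoped Classical in
/-- The indices of the positive coordinates. -/
def posSupport {ι : Type*} [Fintype ι] (t : ι → ℝ) : Finset ι := Finset.univ.filter fun i => 0 < t i

theorem mem_posSupport {ι : Type*} [Fintype ι] {t : ι → ℝ} {i : ι} :
    i ∈ posSupport t ↔ 0 < t i := by simp [posSupport]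

/-- A simplicial complex with vertex set `ι`, as a set of non-empty finite sets. -/
structure IsComplex {ι : Type*} (K : Set (Finset ι)) : Prop where
  nonempty : ∀ σ ∈ K, σ.Nonempty
  down : ∀ σ ∈ K, ∀ τ ⊆ σ, τ.Nonempty → τ ∈ K

/-- The points with non-negative coordinates whose positive coordinates form a simplex of `K`. -/
def polyhedron {ι : Type*} [Fintype ι] (K : Set (Finset ι)) : Set (ι → ℝ) :=
  {t | (∀ i, 0 ≤ t i) ∧ posSupport t ∈ K}

variable {ι : Type u} {K : Set (Finset ι)}

open scoped Classical in
/-- The indicator vector of a finite set. -/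
def indVec (σ : Finset ι) : ι → ℝ := fun i => if i ∈ σ then 1 else 0

theorem indVec_nonneg (σ : Finset ι) (i : ι) : 0 ≤ indVec σ i := by
  unfold indVec; split_ifs <;> norm_num

theorem indVec_le_one (σ : Finset ι) (i : ι) : indVec σ i ≤ 1 := by
  unfold indVec; split_ifs <;> norm_num

theorem indVec_of_mem {σ : Finset ι} {i : ι} (h : i ∈ σ) : indVec σ i = 1 := if_pos h

theorem indVec_of_notMem {σ : Finset ι} {i : ι} (h : i ∉ σ) : indVec σ i = 0 := if_neg h

theorem contractibleSpace_of_starConvex {Q : Set (ι → ℝ)} {B : Set Q} {p : ι → ℝ} {hp : p ∈ Q}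
    (hpB : (⟨p, hp⟩ : Q) ∈ B) (h : ∀ t ∈ B, ∀ a b : ℝ, 0 ≤ a → 0 ≤ b → a + b = 1 →
      ∃ hq : a • p + b • t.1 ∈ Q, (⟨_, hq⟩ : Q) ∈ B) : ContractibleSpace B := by
  have h1 : StarConvex ℝ p (Subtype.val '' B) := by
    rintro _ ⟨t, ht, rfl⟩ a b ha hb hab
    obtain ⟨hq, hm⟩ := h t ht a b ha hb hab
    exact ⟨_, hm, rfl⟩
  have h2 : ContractibleSpace (Subtype.val '' B : Set (ι → ℝ)) :=
    h1.contractibleSpace ⟨_, _, hpB, rfl⟩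
  exact (Topology.IsEmbedding.subtypeVal.homeomorphImage B).contractibleSpace

variable [Fintype ι]

theorem mem_polyhedron_of_subset (hK : IsComplex K) {t : ι → ℝ} (h0 : ∀ i, 0 ≤ t i) {σ : Finset ι}
    (hσ : σ ∈ K) (hsub : ∀ i, 0 < t i → i ∈ σ) {i : ι} (hi : 0 < t i) : t ∈ polyhedron K :=
  ⟨h0, hK.down σ hσ _ (fun j hj => hsub j (mem_posSupport.1 hj)) ⟨i, mem_posSupport.2 hi⟩⟩

theorem exists_pos_of_mem_polyhedron (hK : IsComplex K) {t : ι → ℝ} (ht : t ∈ polyhedron K) :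
    ∃ i, 0 < t i :=
  let ⟨i, hi⟩ := hK.nonempty _ ht.2
  ⟨i, mem_posSupport.1 hi⟩

theorem indVec_mem (hK : IsComplex K) {σ : Finset ι} (hσ : σ ∈ K) : indVec σ ∈ polyhedron K := by
  obtain ⟨i, hi⟩ := hK.nonempty σ hσ
  refine mem_polyhedron_of_subset hK (indVec_nonneg σ) hσ (fun j hj => ?_) (i := i)
    (by rw [indVec_of_mem hi]; norm_num)
  by_contra h
  rw [indVec_of_notMem h] at hj
  exact lt_irrefl _ hj

/-- The open star of a vertex. -/
def openStar (K : Set (Finset ι)) (i : ι) : Set (polyhedron K) := {t | 0 < t.1 i}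

/-- The points at which the coordinate `i` is more than half of the largest coordinate. -/
def bigStar (K : Set (Finset ι)) (i : ι) : Set (polyhedron K) := {t | ∀ j, t.1 j < 2 * t.1 i}

theorem isOpen_openStar (i : ι) : IsOpen (openStar K i) :=
  isOpen_lt continuous_const ((continuous_apply i).comp continuous_subtype_val)

theorem mem_openStar_of_mem_bigStar {i : ι} {t : polyhedron K} (h : t ∈ bigStar K i) :
    t ∈ openStar K i := by
  have := h i
  change 0 < t.1 i
  linarith

theorem iUnion_openStar (hK : IsComplex K) : ⋃ i, openStar K i = Set.univ :=
  Set.eq_univ_of_forall fun t =>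
    let ⟨i, hi⟩ := exists_pos_of_mem_polyhedron hK t.2
    Set.mem_iUnion.2 ⟨i, hi⟩

/-- As σ lies in the support of t, no point of the segment from the indicator of σ to t has a larger
support than t. -/
theorem segment_mem (hK : IsComplex K) {σ : Finset ι} (hne : σ.Nonempty) {t : polyhedron K}
    (ht : ∀ i ∈ σ, 0 < t.1 i) {a b : ℝ} (ha : 0 ≤ a) (hb : 0 ≤ b) (hab : a + b = 1) :
    (∀ i ∈ σ, 0 < (a • indVec σ + b • t.1) i) ∧ a • indVec σ + b • t.1 ∈ polyhedron K := by
  have h1 : ∀ i ∈ σ, 0 < (a • indVec σ + b • t.1) i := by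
    intro i hi
    have h2 := ht i hi
    simp only [Pi.add_apply, Pi.smul_apply, smul_eq_mul, indVec_of_mem hi]
    rcases ha.eq_or_lt with rfl | ha
    · obtain rfl : b = 1 := by linarith
      linarith
    · nlinarith
  obtain ⟨i, hi⟩ := hne
  refine ⟨h1, mem_polyhedron_of_subset hK (fun j => ?_) t.2.2 (fun j hj => ?_) (h1 i hi)⟩
  · exact add_nonneg (mul_nonneg ha (indVec_nonneg σ j)) (mul_nonneg hb (t.2.1 j))
  · rw [mem_posSupport]
    by_cases hjσ : j ∈ σ
    · exact ht j hjσ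
    · simp only [Pi.add_apply, Pi.smul_apply, smul_eq_mul, indVec_of_notMem hjσ] at hj
      refine (t.2.1 j).lt_of_ne fun h => ?_
      rw [← h] at hj
      simp at hj

theorem contractibleSpace_iInter_openStar (hK : IsComplex K) {σ : Finset ι} (hσ : σ ∈ K) :
    ContractibleSpace (⋂ i ∈ σ, openStar K i : Set (polyhedron K)) := by
  refine contractibleSpace_of_starConvex (p := indVec σ) (hp := indVec_mem hK hσ) ?_ ?_
  · refine Set.mem_iInter₂.2 fun i hi => ?_
    change 0 < indVec σ i
    rw [indVec_of_mem hi]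
    norm_num
  · intro t ht a b ha hb hab
    obtain ⟨h1, h2⟩ := segment_mem hK (hK.nonempty σ hσ) (Set.mem_iInter₂.1 ht) ha hb hab
    exact ⟨h2, Set.mem_iInter₂.2 h1⟩

/-- The inequalities that define the shrunken stars are linear, and the indicator of σ satisfies
them because 1 < 2, so they hold along segments. -/
theorem contractibleSpace_iInter_bigStar (hK : IsComplex K) {σ : Finset ι} (hσ : σ ∈ K) :
    ContractibleSpace (⋂ i ∈ σ, bigStar K i : Set (polyhedron K)) := by
  refine contractibleSpace_of_starConvex (p := indVec σ) (hp := indVec_mem hK hσ) ?_ ?_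
  · refine Set.mem_iInter₂.2 fun i hi j => ?_
    change indVec σ j < 2 * indVec σ i
    rw [indVec_of_mem hi]
    linarith [indVec_le_one σ j]
  · intro t ht a b ha hb hab
    have ht' := Set.mem_iInter₂.1 ht
    obtain ⟨h1, h2⟩ := segment_mem hK (hK.nonempty σ hσ)
      (fun i hi => mem_openStar_of_mem_bigStar (ht' i hi)) ha hb hab
    refine ⟨h2, Set.mem_iInter₂.2 fun i hi j => ?_⟩
    have h3 := ht' i hi j
    simp only [Pi.add_apply, Pi.smul_apply, smul_eq_mul, indVec_of_mem hi]
    have h4 := indVec_le_one σ j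
    rcases ha.eq_or_lt with rfl | ha
    · obtain rfl : b = 1 := by linarith
      linarith
    · nlinarith

theorem iInter_openStar_eq_empty (hK : IsComplex K) {σ : Finset ι} (hne : σ.Nonempty)
    (hσ : σ ∉ K) : ⋂ i ∈ σ, openStar K i = ∅ := by
  refine Set.eq_empty_of_forall_notMem fun t ht => hσ (hK.down _ t.2.2 _ (fun i hi => ?_) hne)
  exact mem_posSupport.2 (Set.mem_iInter₂.1 ht i hi)

theorem iInter_bigStar_eq_empty (hK : IsComplex K) {σ : Finset ι} (hne : σ.Nonempty)
    (hσ : σ ∉ K) : ⋂ i ∈ σ, bigStar K i = ∅ := by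
  refine Set.eq_empty_of_forall_notMem fun t ht => ?_
  have : t ∈ ⋂ i ∈ σ, openStar K i := Set.mem_iInter₂.2 fun i hi =>
    mem_openStar_of_mem_bigStar (Set.mem_iInter₂.1 ht i hi)
  rwa [iInter_openStar_eq_empty hK hne hσ] at this

open scoped Classical in
/-- The union of the open stars of the vertices of a simplex is categorical. -/
theorem nullhomotopic_incl_iUnion_openStar (hK : IsComplex K) {σ : Finset ι} (hσ : σ ∈ K) :
    (incl (⋃ i ∈ σ, openStar K i)).Nullhomotopic := by
  -- During the first half α shrinks the coordinates outside σ to 0; during the second half β moves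
  -- those in σ to 1. The support stays first in that of t, then in σ, and a coordinate of σ that is
  -- positive at t stays positive.
  let α : ℝ → ℝ := fun r => max 0 (1 - 2 * r)
  let β : ℝ → ℝ := fun r => max 0 (2 * r - 1)
  let F : ℝ → (ι → ℝ) → ι → ℝ := fun r t i =>
    if i ∈ σ then (1 - β r) * t i + β r else α r * t i
  have hF : ∀ r ∈ Set.Icc (0 : ℝ) 1, ∀ t ∈ ⋃ i ∈ σ, openStar K i, F r t.1 ∈ polyhedron K := by
    intro r hr t ht
    obtain ⟨i, hi, hti⟩ := Set.mem_iUnion₂.1 ht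
    have hti : 0 < t.1 i := hti
    have hβ0 : 0 ≤ β r := le_max_left _ _
    have hα0 : 0 ≤ α r := le_max_left _ _
    have hβ1 : β r ≤ 1 := max_le zero_le_one (by linarith [hr.2])
    have h0 : ∀ j, 0 ≤ F r t.1 j := fun j => by
      have := t.2.1 j
      simp only [F]
      split_ifs
      · nlinarith
      · positivity
    have hpos : 0 < F r t.1 i := by
      simp only [F, if_pos hi]
      rcases hβ0.eq_or_lt with h | h
      · rw [← h]
        linarith
      · nlinarith
    by_cases h2 : r ≤ 1 / 2
    · have hβ : β r = 0 := max_eq_left (by linarith)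
      refine mem_polyhedron_of_subset hK h0 t.2.2 (fun j hj => ?_) hpos
      rw [mem_posSupport]
      refine (t.2.1 j).lt_of_ne fun h => ?_
      simp only [F, hβ, ← h] at hj
      simp at hj
    · have hα : α r = 0 := max_eq_left (by linarith)
      refine mem_polyhedron_of_subset hK h0 hσ (fun j hj => ?_) hpos
      by_contra h
      simp only [F, hα, if_neg h, zero_mul] at hj
      exact lt_irrefl _ hj
  have hcont : Continuous fun p : ℝ × (ι → ℝ) => F p.1 p.2 := by
    refine continuous_pi fun i => ?_
    by_cases h : i ∈ σ
    · simp only [F, if_pos h, β]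
      fun_prop
    · simp only [F, if_neg h, α]
      fun_prop
  refine ⟨⟨indVec σ, indVec_mem hK hσ⟩, ⟨⟨⟨fun p => ⟨F p.1 p.2.1.1, hF _ p.1.2 _ p.2.2⟩, ?_⟩,
    fun t => ?_, fun t => ?_⟩⟩⟩
  · exact Continuous.subtype_mk (hcont.comp (show Continuous fun p : unitInterval × ↥(⋃ i ∈ σ, openStar K i) =>
      ((p.1 : ℝ), (p.2.1.1 : ι → ℝ)) by fun_prop)) _
  · refine Subtype.ext (funext fun i => ?_)
    simp [F, α, β, incl]
  · refine Subtype.ext (funext fun i => ?_)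
    by_cases h : i ∈ σ
    · simp [F, α, β, h, indVec]
      norm_num
    · simp [F, α, β, h, indVec]

end Polyhedron

end

end CoveringType

namespace CoveringType

noncomputable section

/-! ### The map from the polyhedron of the nerve, built over dual blocks. -/

section MapFromPolyhedron

variable {ι : Type u} [Fintype ι] {K : Set (Finset ι)} {X : Type u} [TopologicalSpace X]

/-- The contraction is extended to a total function, with irrelevant values elsewhere, so that maps
can be glued with `ContinuousOn`. -/
theorem exists_contraction (A : Set X) [ContractibleSpace A] :
    ∃ (H : ℝ × X → X) (c : X), c ∈ A ∧ ContinuousOn H (Set.Icc 0 1 ×ˢ A) ∧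
      (∀ x ∈ A, H (0, x) = x) ∧ (∀ x ∈ A, H (1, x) = c) ∧
      ∀ r ∈ Set.Icc (0 : ℝ) 1, ∀ x ∈ A, H (r, x) ∈ A := by
  classical
  obtain ⟨c, ⟨F⟩⟩ := id_nullhomotopic A
  let H : ℝ × X → X := fun p =>
    if h : p.1 ∈ Set.Icc (0 : ℝ) 1 ∧ p.2 ∈ A then (F (⟨p.1, h.1⟩, ⟨p.2, h.2⟩) : A) else p.2
  have hH : ∀ (r : ℝ) (hr : r ∈ Set.Icc (0 : ℝ) 1) (x : X) (hx : x ∈ A),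
      H (r, x) = (F (⟨r, hr⟩, ⟨x, hx⟩) : A) := fun r hr x hx => dif_pos ⟨hr, hx⟩
  refine ⟨H, c, c.2, ?_, fun x hx => ?_, fun x hx => ?_, fun r hr x hx => ?_⟩
  · rw [continuousOn_iff_continuous_domRestrict]
    have h2 : (Set.Icc (0 : ℝ) 1 ×ˢ A).domRestrict H = fun p =>
        ((F (⟨p.1.1, p.2.1⟩, ⟨p.1.2, p.2.2⟩) : A) : X) := by
      funext p
      exact hH _ p.2.1 _ p.2.2
    rw [h2]
    fun_prop
  · rw [hH 0 (by simp) x hx]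
    exact congrArg Subtype.val (F.apply_zero ⟨x, hx⟩)
  · rw [hH 1 (by simp) x hx]
    exact congrArg Subtype.val (F.apply_one ⟨x, hx⟩)
  · rw [hH r hr x hx]
    exact Subtype.coe_prop _

/-- The points of the polyhedron with largest coordinate `1`, attained at all elements of `τ`. -/
def dualBlock (K : Set (Finset ι)) (τ : Finset ι) : Set (ι → ℝ) :=
  {t | (∀ i, t i ≤ 1) ∧ t ∈ polyhedron K ∧ ∀ i ∈ τ, t i = 1}

/-- The polyhedron need not be closed, as its points may tend to 0. The equations t i = 1 on the
non-empty set τ prevent this, and then the support condition is a finite union of closed conditions.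
-/
theorem isClosed_dualBlock (hK : IsComplex K) {τ : Finset ι} (hτ : τ.Nonempty) :
    IsClosed (dualBlock K τ) := by
  have h : dualBlock K τ = ⋃ σ ∈ K, {t | (∀ i, t i ≤ 1) ∧ (∀ i, 0 ≤ t i) ∧
      (∀ i, i ∉ σ → t i = 0) ∧ ∀ i ∈ τ, t i = 1} := by
    ext t
    simp only [Set.mem_iUnion, exists_prop]
    constructor
    · rintro ⟨h1, h2, h3⟩
      refine ⟨_, h2.2, h1, h2.1, fun i hi => ?_, h3⟩
      rw [mem_posSupport, not_lt] at hi
      exact le_antisymm hi (h2.1 i)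
    · rintro ⟨σ, hσ, h1, h2, h3, h4⟩
      obtain ⟨i, hi⟩ := hτ
      refine ⟨h1, mem_polyhedron_of_subset hK h2 hσ (fun j hj => ?_) (i := i) ?_, h4⟩
      · by_contra h
        rw [h3 j h] at hj
        exact lt_irrefl _ hj
      · rw [h4 i hi]
        exact one_pos
  rw [h]
  refine Set.Finite.isClosed_biUnion (Set.toFinite _) fun σ _ => ?_
  simp only [Set.ofPred_and, Set.ofPred_forall]
  refine IsClosed.inter ?_ (IsClosed.inter ?_ (IsClosed.inter ?_ ?_))
  · exact isClosed_iInter fun i => isClosed_le (continuous_apply i) continuous_const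
  · exact isClosed_iInter fun i => isClosed_le continuous_const (continuous_apply i)
  · exact isClosed_iInter fun i => isClosed_iInter fun _ =>
      isClosed_eq (continuous_apply i) continuous_const
  · exact isClosed_iInter fun i => isClosed_iInter fun _ =>
      isClosed_eq (continuous_apply i) continuous_const

theorem mem_of_mem_dualBlock (hK : IsComplex K) {t : ι → ℝ} {τ : Finset ι} (hτ : τ.Nonempty)
    (ht : t ∈ dualBlock K τ) : τ ∈ K :=
  hK.down _ ht.2.1.2 _ (fun i hi => mem_posSupport.2 (by rw [ht.2.2 i hi]; exact one_pos)) hτ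

/-- The union of the dual blocks of the simplices of `F`. -/
def dualBlocks (K : Set (Finset ι)) (F : Finset (Finset ι)) : Set (ι → ℝ) :=
  ⋃ ρ ∈ F, dualBlock K ρ

theorem isClosed_dualBlocks (hK : IsComplex K) {F : Finset (Finset ι)} (hF : ∀ ρ ∈ F, ρ ∈ K) :
    IsClosed (dualBlocks K F) :=
  isClosed_biUnion_finset fun ρ hρ => isClosed_dualBlock hK (hK.nonempty ρ (hF ρ hρ))

variable [DecidableEq ι]

/-- The largest coordinate outside `τ`. -/
def outerMax [Nonempty ι] (τ : Finset ι) (t : ι → ℝ) : ℝ :=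
  Finset.univ.sup' Finset.univ_nonempty fun j => if j ∈ τ then 0 else t j

theorem continuous_outerMax [Nonempty ι] (τ : Finset ι) : Continuous (outerMax τ) := by
  refine Continuous.finset_sup'_apply _ fun j _ => ?_
  by_cases h : j ∈ τ
  · simp only [if_pos h]
    fun_prop
  · simp only [if_neg h]
    fun_prop

theorem le_outerMax [Nonempty ι] {τ : Finset ι} {j : ι} (h : j ∉ τ) (t : ι → ℝ) :
    t j ≤ outerMax τ t := by
  have := Finset.le_sup' (fun j => if j ∈ τ then 0 else t j) (Finset.mem_univ j)
  rwa [if_neg h] at this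

theorem outerMax_le_one [Nonempty ι] {τ : Finset ι} {t : ι → ℝ} (h : ∀ i, t i ≤ 1) :
    outerMax τ t ≤ 1 := by
  refine Finset.sup'_le _ _ fun j _ => ?_
  split_ifs
  · exact zero_le_one
  · exact h j

theorem exists_eq_outerMax [Nonempty ι] {τ : Finset ι} {t : ι → ℝ} (h : 0 < outerMax τ t) :
    ∃ j ∉ τ, t j = outerMax τ t := by
  obtain ⟨j, -, hj⟩ := Finset.exists_mem_eq_sup' Finset.univ_nonempty
    fun j => if j ∈ τ then 0 else t j
  change outerMax τ t = _ at hj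
  by_cases hjτ : j ∈ τ
  · rw [if_pos hjτ] at hj
    exact absurd hj h.ne'
  · rw [if_neg hjτ] at hj
    exact ⟨j, hjτ, hj.symm⟩

/-- The radial retraction away from the barycenter of `τ`. -/
def pushOut [Nonempty ι] (τ : Finset ι) (t : ι → ℝ) : ι → ℝ :=
  fun j => min 1 (t j / max (outerMax τ t) (1 / 2))

theorem continuous_pushOut [Nonempty ι] (τ : Finset ι) : Continuous (pushOut τ) := by
  refine continuous_pi fun j => continuous_const.min ?_
  refine (continuous_apply j).div ((continuous_outerMax τ).max continuous_const) fun t => ?_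
  have : (1 / 2 : ℝ) ≤ max (outerMax τ t) (1 / 2) := le_max_right _ _
  linarith

theorem pushOut_eq_self [Nonempty ι] {τ : Finset ι} {t : ι → ℝ} (h : ∀ i, t i ≤ 1)
    (hm : outerMax τ t = 1) : pushOut τ t = t := by
  funext j
  rw [pushOut, hm, max_eq_left (by norm_num), div_one, min_eq_right (h j)]

/-- Dividing by the largest outer coordinate makes that coordinate 1, while the coordinates in τ are
cut back to 1 and the support is unchanged. -/
theorem pushOut_mem [Nonempty ι] {τ : Finset ι} {t : ι → ℝ} (ht : t ∈ dualBlock K τ)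
    (hm : 1 / 2 ≤ outerMax τ t) : ∃ j ∉ τ, pushOut τ t ∈ dualBlock K (insert j τ) := by
  have hpos : 0 < outerMax τ t := by linarith
  obtain ⟨j, hj, e⟩ := exists_eq_outerMax hpos
  have h1 := outerMax_le_one (τ := τ) ht.1
  have hval : ∀ i, pushOut τ t i = min 1 (t i / outerMax τ t) := fun i => by
    rw [pushOut, max_eq_left hm]
  have hsupp : posSupport (pushOut τ t) = posSupport t := by
    ext i
    rw [mem_posSupport, mem_posSupport, hval, lt_min_iff]
    constructor
    · rintro ⟨-, h⟩
      by_contra h2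
      exact absurd h (not_lt.2 (div_nonpos_of_nonpos_of_nonneg (not_lt.1 h2) hpos.le))
    · exact fun h => ⟨one_pos, div_pos h hpos⟩
  refine ⟨j, hj, fun i => min_le_left _ _, ⟨fun i => ?_, ?_⟩, fun i hi => ?_⟩
  · rw [hval]
    exact le_min zero_le_one (div_nonneg (ht.2.1.1 i) hpos.le)
  · rw [hsupp]
    exact ht.2.1.2
  · rw [hval]
    refine min_eq_left ?_
    rw [le_div_iff₀ hpos, one_mul]
    rcases Finset.mem_insert.1 hi with rfl | hi
    · exact e.ge
    · rw [ht.2.2 i hi]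
      exact h1

-- The block of τ is a cone with apex `indVec τ`. Its base, where some coordinate outside τ equals
-- 1, lies in blocks of larger simplices. A map already defined on the base takes values there in
-- the intersection of the U i, i ∈ τ, and contractibility of this intersection extends it over the
-- cone.
open scoped Classical in
theorem exists_map_dualBlocks [Nonempty X] (hK : IsComplex K) {U : ι → Set X}
    (hc : ∀ τ ∈ K, ContractibleSpace (⋂ i ∈ τ, U i : Set X)) (n : ℕ) :
    ∀ F : Finset (Finset ι), F.card = n → (∀ ρ ∈ F, ρ ∈ K) →
      (∀ ρ ∈ F, ∀ ρ' ∈ K, ρ ⊆ ρ' → ρ' ∈ F) →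
      ∃ g : (ι → ℝ) → X, ContinuousOn g (dualBlocks K F) ∧
        ∀ t ∈ dualBlocks K F, ∀ i, t i = 1 → g t ∈ U i := by
  induction n with
  | zero =>
    intro F hF _ _
    obtain rfl := Finset.card_eq_zero.1 hF
    exact ⟨fun _ => Classical.arbitrary X, by simp [dualBlocks], by simp [dualBlocks]⟩
  | succ n ih =>
    intro F hF hFK hup
    -- Minimal cardinality keeps F upward closed when τ is removed, and makes the block of τ meet
    -- the other blocks only where a coordinate outside τ equals 1.
    obtain ⟨τ, hτF, hmin⟩ := F.exists_min_image Finset.card (Finset.card_pos.1 (by omega))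
    have hτK := hFK τ hτF
    have hτne := hK.nonempty τ hτK
    have : Nonempty ι := ⟨hτne.choose⟩
    have hFK' : ∀ ρ ∈ F.erase τ, ρ ∈ K := fun ρ hρ => hFK ρ (Finset.mem_of_mem_erase hρ)
    obtain ⟨g, hg, hgU⟩ := ih (F.erase τ) (by rw [Finset.card_erase_of_mem hτF, hF]; rfl) hFK' (by
      intro ρ hρ ρ' hρ' hsub
      refine Finset.mem_erase.2 ⟨?_, hup ρ (Finset.mem_of_mem_erase hρ) ρ' hρ' hsub⟩
      rintro rfl
      exact (Finset.mem_erase.1 hρ).1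
        (Finset.eq_of_subset_of_card_le hsub (hmin ρ (Finset.mem_of_mem_erase hρ))))
    have hext : ∀ (t : ι → ℝ) (j : ι), j ∉ τ → t ∈ dualBlock K (insert j τ) →
        t ∈ dualBlocks K (F.erase τ) := by
      intro t j hj ht
      refine Set.mem_iUnion₂.2 ⟨insert j τ, Finset.mem_erase.2 ⟨fun h => hj ?_, ?_⟩, ht⟩
      · rw [← h]
        exact Finset.mem_insert_self j τ
      · exact hup τ hτF _ (mem_of_mem_dualBlock hK (Finset.insert_nonempty _ _) ht)
          (Finset.subset_insert _ _)
    have hmax : ∀ t ∈ dualBlock K τ, t ∈ dualBlocks K (F.erase τ) → outerMax τ t = 1 := by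
      intro t ht ht'
      obtain ⟨ρ, hρ, htρ⟩ := Set.mem_iUnion₂.1 ht'
      have hns : ¬ ρ ⊆ τ := fun h => (Finset.mem_erase.1 hρ).1
        (Finset.eq_of_subset_of_card_le h (hmin ρ (Finset.mem_of_mem_erase hρ)))
      obtain ⟨j, hjρ, hjτ⟩ := Finset.not_subset.1 hns
      exact le_antisymm (outerMax_le_one ht.1) ((htρ.2.2 j hjρ).symm.le.trans (le_outerMax hjτ t))
    have := hc τ hτK
    obtain ⟨H, c, hcU, hHc, hH0, hH1, hHU⟩ := exists_contraction (⋂ i ∈ τ, U i)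
    have hgτ : ∀ t ∈ dualBlocks K (F.erase τ), (∀ i ∈ τ, t i = 1) → g t ∈ ⋂ i ∈ τ, U i :=
      fun t ht h => Set.mem_iInter₂.2 fun i hi => hgU t ht i (h i hi)
    have hpush : ∀ t ∈ dualBlock K τ, 1 / 2 ≤ outerMax τ t →
        pushOut τ t ∈ dualBlocks K (F.erase τ) ∧ g (pushOut τ t) ∈ ⋂ i ∈ τ, U i := by
      intro t ht hm
      obtain ⟨j, hj, h⟩ := pushOut_mem ht hm
      have h' := hext _ j hj h
      exact ⟨h', hgτ _ h' fun i hi => h.2.2 i (Finset.mem_insert_of_mem hi)⟩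
    have hIcc : ∀ t ∈ dualBlock K τ, 1 / 2 ≤ outerMax τ t →
        2 * (1 - outerMax τ t) ∈ Set.Icc (0 : ℝ) 1 := fun t ht hm => by
      have := outerMax_le_one (τ := τ) ht.1
      constructor <;> linarith
    -- The contraction time runs from 0 on the base, where `outerMax` is 1, to 1 at `outerMax` =
    -- 1/2; closer to the apex the map is constant.
    let h : (ι → ℝ) → X := fun t => H (2 * (1 - outerMax τ t), g (pushOut τ t))
    let G : (ι → ℝ) → X := fun t =>
      if t ∈ dualBlocks K (F.erase τ) then g t else if 1 / 2 ≤ outerMax τ t then h t else c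
    have hG1 : ∀ t ∈ dualBlocks K (F.erase τ), G t = g t := fun t ht => if_pos ht
    have hG2 : ∀ t ∈ dualBlock K τ ∩ {t | 1 / 2 ≤ outerMax τ t}, G t = h t := by
      rintro t ⟨ht, hm⟩
      by_cases htF : t ∈ dualBlocks K (F.erase τ)
      · have h1 := hmax t ht htF
        rw [hG1 t htF]
        simp only [h]
        rw [pushOut_eq_self ht.1 h1, h1, sub_self, mul_zero, hH0 _ (hgτ t htF ht.2.2)]
      · simp only [G, if_neg htF]
        exact if_pos hm
    have hG3 : ∀ t ∈ dualBlock K τ ∩ {t | outerMax τ t ≤ 1 / 2}, G t = c := by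
      rintro t ⟨ht, hm⟩
      have hm : outerMax τ t ≤ 1 / 2 := hm
      have htF : t ∉ dualBlocks K (F.erase τ) := fun htF => by
        have := hmax t ht htF
        linarith
      by_cases hm' : 1 / 2 ≤ outerMax τ t
      · have h1 := le_antisymm hm hm'
        rw [hG2 t ⟨ht, hm'⟩]
        simp only [h]
        rw [show 2 * (1 - outerMax τ t) = 1 by rw [h1]; norm_num, hH1 _ (hpush t ht hm').2]
      · simp only [G, if_neg htF, if_neg hm']
    have hunion : dualBlocks K F = dualBlocks K (F.erase τ) ∪
        (dualBlock K τ ∩ {t | 1 / 2 ≤ outerMax τ t} ∪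
          dualBlock K τ ∩ {t | outerMax τ t ≤ 1 / 2}) := by
      have h1 : dualBlock K τ ∩ {t | 1 / 2 ≤ outerMax τ t} ∪
          dualBlock K τ ∩ {t | outerMax τ t ≤ 1 / 2} = dualBlock K τ := by
        rw [← Set.inter_union_distrib_left]
        exact Set.inter_eq_left.2 fun t _ =>
          show 1 / 2 ≤ outerMax τ t ∨ outerMax τ t ≤ 1 / 2 from le_total _ _
      rw [h1, Set.union_comm]
      conv_lhs => rw [← Finset.insert_erase hτF]
      exact Finset.set_biUnion_insert _ _ _
    have cl0 := isClosed_dualBlocks hK hFK'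
    have cl1 : IsClosed (dualBlock K τ ∩ {t | 1 / 2 ≤ outerMax τ t}) :=
      (isClosed_dualBlock hK hτne).inter (isClosed_le continuous_const (continuous_outerMax τ))
    have cl2 : IsClosed (dualBlock K τ ∩ {t | outerMax τ t ≤ 1 / 2}) :=
      (isClosed_dualBlock hK hτne).inter (isClosed_le (continuous_outerMax τ) continuous_const)
    refine ⟨G, ?_, ?_⟩
    · rw [hunion]
      refine ContinuousOn.union_of_isClosed (hg.congr hG1)
        (ContinuousOn.union_of_isClosed (ContinuousOn.congr ?_ hG2)
          (continuousOn_const.congr hG3) cl1 cl2) cl0 (cl1.union cl2)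
      refine hHc.comp (ContinuousOn.prodMk ?_ ?_) fun t ht =>
        ⟨hIcc t ht.1 ht.2, (hpush t ht.1 ht.2).2⟩
      · have := continuous_outerMax τ
        exact Continuous.continuousOn (by fun_prop)
      · exact hg.comp (continuous_pushOut τ).continuousOn fun t ht => (hpush t ht.1 ht.2).1
    · intro t ht i hi
      by_cases htF : t ∈ dualBlocks K (F.erase τ)
      · rw [hG1 t htF]
        exact hgU t htF i hi
      · have htτ : t ∈ dualBlock K τ := by
          obtain ⟨ρ, hρ, htρ⟩ := Set.mem_iUnion₂.1 ht
          by_cases e : ρ = τ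
          · exact e ▸ htρ
          · exact absurd (Set.mem_iUnion₂.2 ⟨ρ, Finset.mem_erase.2 ⟨e, hρ⟩, htρ⟩) htF
        have hiτ : i ∈ τ := by
          by_contra hiτ
          refine htF (hext t i hiτ ⟨htτ.1, htτ.2.1, fun j hj => ?_⟩)
          rcases Finset.mem_insert.1 hj with rfl | hj
          · exact hi
          · exact htτ.2.2 j hj
        rcases le_total (1 / 2) (outerMax τ t) with hm | hm
        · rw [hG2 t ⟨htτ, hm⟩]
          exact Set.mem_iInter₂.1 (hHU _ (hIcc t htτ hm) _ (hpush t htτ hm).2) i hiτ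
        · rw [hG3 t ⟨htτ, hm⟩]
          exact Set.mem_iInter₂.1 hcU i hiτ

/-- There is a map from the polyhedron of the nerve of a good cover to the space that is compatible
with the covers. -/
theorem exists_map_polyhedron [Nonempty X] (hK : IsComplex K) {U : ι → Set X}
    (hc : ∀ τ ∈ K, ContractibleSpace (⋂ i ∈ τ, U i : Set X)) :
    ∃ g : C(polyhedron K, X), ∀ i, ∀ t ∈ bigStar K i, g t ∈ U i := by
  classical
  rcases isEmpty_or_nonempty ι with hι | hι
  · exact ⟨ContinuousMap.const _ (Classical.arbitrary X), fun i => isEmptyElim i⟩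
  obtain ⟨g, hg, hgU⟩ := exists_map_dualBlocks hK hc _ (Finset.univ.filter (· ∈ K)) rfl
    (fun ρ hρ => (Finset.mem_filter.1 hρ).2)
    (fun _ _ ρ' hρ' _ => Finset.mem_filter.2 ⟨Finset.mem_univ _, hρ'⟩)
  let M : (ι → ℝ) → ℝ := fun t => Finset.univ.sup' Finset.univ_nonempty t
  have hM : Continuous M := Continuous.finset_sup'_apply _ fun j _ => continuous_apply j
  have hle : ∀ t i, t i ≤ M t := fun t i => Finset.le_sup' t (Finset.mem_univ i)
  have hpos : ∀ t ∈ polyhedron K, 0 < M t := fun t ht =>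
    let ⟨i, hi⟩ := exists_pos_of_mem_polyhedron hK ht
    hi.trans_le (hle t i)
  -- Rescaling by twice the inverse of the largest coordinate and cutting at 1 sends every
  -- coordinate above half of the maximum to 1. This is why the shrunken stars have the factor 2.
  let clip : (ι → ℝ) → ι → ℝ := fun t i => min 1 (2 * t i / M t)
  have hclip : ∀ t ∈ polyhedron K, clip t ∈ dualBlocks K (Finset.univ.filter (· ∈ K)) := by
    intro t ht
    have h0 := hpos t ht
    obtain ⟨i, -, hi⟩ := Finset.exists_mem_eq_sup' Finset.univ_nonempty t
    change M t = t i at hi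
    have h1 : clip t i = 1 := by
      simp only [clip]
      rw [← hi, mul_div_assoc, div_self h0.ne']
      norm_num
    have hmem : clip t ∈ polyhedron K := by
      refine mem_polyhedron_of_subset hK (fun j => ?_) ht.2 (fun j hj => ?_) (i := i)
        (by rw [h1]; exact one_pos)
      · exact le_min zero_le_one (div_nonneg (mul_nonneg zero_le_two (ht.1 j)) h0.le)
      · rw [mem_posSupport]
        refine (ht.1 j).lt_of_ne fun e => ?_
        simp [clip, ← e] at hj
    have hb : clip t ∈ dualBlock K {i} := ⟨fun j => min_le_left _ _, hmem, by simpa using h1⟩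
    exact Set.mem_iUnion₂.2 ⟨{i}, Finset.mem_filter.2 ⟨Finset.mem_univ _,
      mem_of_mem_dualBlock hK (Finset.singleton_nonempty i) hb⟩, hb⟩
  refine ⟨⟨fun t => g (clip t.1), ?_⟩, fun i t ht => ?_⟩
  · refine hg.comp_continuous ?_ fun t => hclip _ t.2
    refine continuous_pi fun i => continuous_const.min (Continuous.div ?_ ?_ fun t =>
      (hpos _ t.2).ne')
    · exact continuous_const.mul ((continuous_apply i).comp continuous_subtype_val)
    · exact hM.comp continuous_subtype_val
  · refine hgU _ (hclip _ t.2) i (min_eq_left ?_)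
    rw [le_div_iff₀ (hpos _ t.2), one_mul]
    exact Finset.sup'_le _ _ fun j _ => (ht j).le

end MapFromPolyhedron

end

end CoveringType

namespace CoveringType

noncomputable section

/-! ### Category weight and the greedy count of vertices. -/

section WeightedBound

variable {X : Type u} [TopologicalSpace X] {R : Type v} [CommRing R]

theorem mapCategory_le {A : Type u} [TopologicalSpace A] {f : C(A, X)} {k : ℕ} (U : Fin k → Set A)
    (hU : ∀ i, IsOpen (U i)) (hcov : ⋃ i, U i = Set.univ)
    (hnull : ∀ i, (f.restrict (U i)).Nullhomotopic) : mapCategory f ≤ k :=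
  iInf₂_le k ⟨U, hU, hcov, hnull⟩

theorem mapCategory_comp_le {A Y : Type u} [TopologicalSpace A] [TopologicalSpace Y] (g : C(Y, X))
    (f : C(A, Y)) : mapCategory (g.comp f) ≤ mapCategory f := by
  refine le_iInf₂ fun k ⟨U, hU, hcov, hnull⟩ => mapCategory_le U hU hcov fun i => ?_
  exact (hnull i).comp_right g

theorem isEmpty_of_mapCategory_le_zero {A : Type u} [TopologicalSpace A] {f : C(A, X)}
    (h : mapCategory f ≤ 0) : IsEmpty A := by
  by_contra hne
  refine absurd h (not_le.2 (lt_of_lt_of_le (zero_lt_one (α := ℕ∞)) ?_))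
  refine le_iInf₂ fun k hk => ?_
  obtain ⟨U, -, hcov, -⟩ := hk
  cases k with
  | zero =>
    refine absurd ⟨fun x => ?_⟩ hne
    obtain ⟨i, -⟩ := Set.mem_iUnion.1 (hcov.symm ▸ Set.mem_univ x)
    exact i.elim0
  | succ k => exact_mod_cast Nat.succ_le_succ (Nat.zero_le k)

theorem pullback_eq_zero_of_le_swgt {a : HomogeneousClass X R} {A : Type u} [TopologicalSpace A]
    {f : C(A, X)} {k : ℕ} (hf : mapCategory f ≤ k) (hk : k ≤ swgt a) :
    pullback f R a.1 a.2 = 0 := by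
  have h0 : 0 ∈ {k : ℕ | ∀ (A : Type u) [TopologicalSpace A] (f : C(A, X)),
      mapCategory f ≤ k → pullback f R a.1 a.2 = 0} := fun A _ f hf => by
    have := isEmpty_of_mapCategory_le_zero (by simpa using hf)
    exact pullback_eq_zero_of_isEmpty f _ _
  have hmem : swgt a ∈ {k : ℕ | ∀ (A : Type u) [TopologicalSpace A] (f : C(A, X)),
      mapCategory f ≤ k → pullback f R a.1 a.2 = 0} := by
    by_cases hb : BddAbove {k : ℕ | ∀ (A : Type u) [TopologicalSpace A] (f : C(A, X)),
      mapCategory f ≤ k → pullback f R a.1 a.2 = 0}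
    · exact Nat.sSup_mem ⟨0, h0⟩ hb
    -- The supremum of an unbounded set of naturals is 0 by default, and 0 is admissible because a
    -- map of category 0 has empty source.
    · have : swgt a = 0 := Nat.sSup_of_not_bddAbove hb
      rw [this]
      exact h0
  exact hmem A f (hf.trans (by exact_mod_cast hk))

/-- The union of a list of sets. -/
def listUnion (L : List (Set X)) : Set X := {x | ∃ B ∈ L, x ∈ B}

theorem mapCategory_incl_listUnion_le {L : List (Set X)} (ho : ∀ B ∈ L, IsOpen B)
    (hn : ∀ B ∈ L, (incl B).Nullhomotopic) : mapCategory (incl (listUnion L)) ≤ L.length := by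
  refine mapCategory_le (fun i => {x | x.1 ∈ L.get i})
    (fun i => (ho _ (L.get_mem i)).preimage continuous_subtype_val) ?_ fun i => ?_
  · refine Set.eq_univ_of_forall fun x => ?_
    obtain ⟨B, hB, hx⟩ := x.2
    obtain ⟨i, rfl⟩ := List.get_of_mem hB
    exact Set.mem_iUnion.2 ⟨i, hx⟩
  · let q : C({x : listUnion L | x.1 ∈ L.get i}, L.get i) := ⟨fun x => ⟨x.1.1, x.2⟩, by fun_prop⟩
    exact (hn _ (L.get_mem i)).comp_left q

/-- The cohomology classes of a sequence vanish on the union of categorical sets whose number is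
at most the weight. -/
theorem exists_vanishesOn_append {Y : Type u} [TopologicalSpace Y] (g : C(Y, X))
    (w : HomogeneousClass X R → ℕ) (s' : List (HomogeneousClass X R)) {ℬ : Set (Set Y)}
    (hℬ : VanishesOn ℬ (hpull g (cupList s'))) (s : List (HomogeneousClass X R)) :
    ∀ L : List (Set Y), (∀ a ∈ s, w a ≤ swgt a) → (∀ B ∈ L, IsOpen B) →
      (∀ B ∈ L, (incl B).Nullhomotopic) → L.length ≤ seqWeight w s →
      ∃ 𝒜 : Set (Set Y), (∀ A ∈ 𝒜, IsOpen A) ∧ ⋃₀ 𝒜 = listUnion L ∧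
        VanishesOn (𝒜 ∪ ℬ) (hpull g (cupList (s ++ s'))) := by
  induction s with
  | nil =>
    intro L _ _ _ hL
    obtain rfl : L = [] := List.length_eq_zero_iff.1 (Nat.le_zero.1 hL)
    refine ⟨∅, by simp, ?_, ?_⟩
    · simp [listUnion]
    · rwa [Set.empty_union]
  | cons a s ih =>
    intro L hw ho hn hL
    have hL' : L.length ≤ w a + seqWeight w s := by simpa [seqWeight] using hL
    have hopen : ∀ L' : List (Set Y), (∀ B ∈ L', B ∈ L) → IsOpen (listUnion L') := by
      intro L' h
      have : listUnion L' = ⋃ B ∈ L', B := by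
        ext x
        simp [listUnion]
      rw [this]
      exact isOpen_biUnion fun B hB => ho B (h B hB)
    -- Each class absorbs as many categorical sets as its weight: a takes the first w a sets of L,
    -- the other classes take the rest.
    obtain ⟨𝒜, h1, h2, h3⟩ := ih (L.drop (w a)) (fun b hb => hw b (List.mem_cons_of_mem _ hb))
      (fun B hB => ho B (List.mem_of_mem_drop hB)) (fun B hB => hn B (List.mem_of_mem_drop hB))
      (by rw [List.length_drop]; omega)
    refine ⟨insert (listUnion (L.take (w a))) 𝒜, ?_, ?_, ?_⟩
    · rintro A (rfl | hA)
      · exact hopen _ fun B hB => List.mem_of_mem_take hB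
      · exact h1 A hA
    · rw [Set.sUnion_insert, h2]
      ext x
      constructor
      · rintro (⟨B, hB, hx⟩ | ⟨B, hB, hx⟩)
        · exact ⟨B, List.mem_of_mem_take hB, hx⟩
        · exact ⟨B, List.mem_of_mem_drop hB, hx⟩
      · rintro ⟨B, hB, hx⟩
        rw [← List.take_append_drop (w a) L, List.mem_append] at hB
        exact hB.imp (fun h => ⟨B, h, hx⟩) fun h => ⟨B, h, hx⟩
    · rw [List.cons_append, cupList_cons, hpull_hmul, Set.insert_union, Set.insert_eq]
      refine VanishesOn.hmul (vanishesOn_of_pullback ?_) h3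
      change pullback _ R a.1 (pullback g R a.1 a.2) = 0
      rw [← pullback_comp]
      refine pullback_eq_zero_of_le_swgt (((mapCategory_comp_le _ _).trans
        (mapCategory_incl_listUnion_le (fun B hB => ho B (List.mem_of_mem_take hB))
        fun B hB => hn B (List.mem_of_mem_take hB))).trans ?_)
        (hw a List.mem_cons_self)
      exact_mod_cast List.length_take_le _ _

theorem cupList_fst (s : List (HomogeneousClass X R)) :
    (cupList s).1 = (s.map Sigma.fst).sum := by
  induction s with
  | nil => rfl
  | cons a s ih =>
    rw [List.map_cons, List.sum_cons, ← ih]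
    rfl

theorem seqDim_of_ne_nil {s : List (HomogeneousClass X R)} (h : s ≠ []) :
    seqDim s = (cupList s).1 := by
  cases s with
  | nil => exact absurd rfl h
  | cons a s => rfl

theorem seqDim_le (s : List (HomogeneousClass X R)) : seqDim s ≤ (s.map Sigma.fst).sum := by
  by_cases h : s = []
  · subst h
    simp [seqDim]
  · rw [seqDim_of_ne_nil h, cupList_fst]

theorem neg_one_le_seqDim (s : List (HomogeneousClass X R)) : -1 ≤ seqDim s := by
  by_cases h : s = []
  · subst h
    simp [seqDim]
  · rw [seqDim_of_ne_nil h]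
    omega

theorem exists_complement {s s' : List (HomogeneousClass X R)} (h : s'.Subperm s) :
    ∃ s'', (s'' ++ s').Perm s := by
  obtain ⟨l, hl, hls⟩ := h
  obtain ⟨s'', h⟩ := hls.exists_perm_append
  exact ⟨s'', List.perm_append_comm.trans ((hl.symm.append_right s'').trans h.symm)⟩

theorem seqWeight_perm {s t : List (HomogeneousClass X R)} (w : HomogeneousClass X R → ℕ)
    (h : s.Perm t) : seqWeight w s = seqWeight w t := (h.map w).sum_eq

theorem seqWeight_append (w : HomogeneousClass X R → ℕ) (s t : List (HomogeneousClass X R)) :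
    seqWeight w (s ++ t) = seqWeight w s + seqWeight w t := by
  simp [seqWeight]

/-- The largest dimension of a product of a part of `s` of weight at most `k`. -/
def maxDim (w : HomogeneousClass X R → ℕ) (s : List (HomogeneousClass X R)) (k : ℕ) : ℤ :=
  sSup {d : ℤ | ∃ s' : List (HomogeneousClass X R),
    s'.Subperm s ∧ seqWeight w s' ≤ k ∧ d = seqDim s'}

theorem bddAbove_dims (w : HomogeneousClass X R → ℕ) (s : List (HomogeneousClass X R)) (k : ℕ) :
    BddAbove {d : ℤ | ∃ s' : List (HomogeneousClass X R),
      s'.Subperm s ∧ seqWeight w s' ≤ k ∧ d = seqDim s'} := by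
  refine ⟨((s.map Sigma.fst).sum : ℕ), ?_⟩
  rintro _ ⟨s', h, -, rfl⟩
  obtain ⟨s'', h⟩ := exists_complement h
  refine (seqDim_le s').trans ?_
  rw [← (h.map Sigma.fst).sum_eq, List.map_append, List.sum_append]
  exact_mod_cast Nat.le_add_left _ _

theorem exists_maxDim (w : HomogeneousClass X R → ℕ) (s : List (HomogeneousClass X R)) (k : ℕ) :
    ∃ s' : List (HomogeneousClass X R),
      s'.Subperm s ∧ seqWeight w s' ≤ k ∧ maxDim w s k = seqDim s' :=
  Int.csSup_mem (s := {d : ℤ | ∃ s' : List (HomogeneousClass X R),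
    s'.Subperm s ∧ seqWeight w s' ≤ k ∧ d = seqDim s'}) ⟨-1, [], List.nil_subperm, by simp [seqWeight], rfl⟩ (bddAbove_dims w s k)

theorem seqDim_le_maxDim (w : HomogeneousClass X R → ℕ) {s s' : List (HomogeneousClass X R)}
    {k : ℕ} (h : s'.Subperm s) (hk : seqWeight w s' ≤ k) : seqDim s' ≤ maxDim w s k :=
  le_csSup (bddAbove_dims w s k) ⟨s', h, hk, rfl⟩

/-- Put k = w(s) - j. The summand is then the number of vertices removed in step j of the greedy
count; the value -1 for the empty sequence makes an idle step contribute 0. -/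
theorem wct_eq (s : List (HomogeneousClass X R)) (w : HomogeneousClass X R → ℕ) :
    wct s w = 1 + ∑ j ∈ Finset.range (seqWeight w s), (maxDim w s (seqWeight w s - j) + 1) := by
  have h : ∑ k ∈ Finset.Icc 1 (seqWeight w s), maxDim w s k =
      ∑ j ∈ Finset.range (seqWeight w s), maxDim w s (seqWeight w s - j) := by
    rw [← Finset.sum_range_reflect]
    have : Finset.Icc 1 (seqWeight w s) = Finset.Ico 1 (seqWeight w s + 1) := by
      ext k
      simp
    rw [this, Finset.sum_Ico_eq_sum_range]
    refine Finset.sum_congr rfl fun j hj => ?_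
    have := Finset.mem_range.1 hj
    congr 1
    omega
  change 1 + (seqWeight w s : ℤ) + ∑ k ∈ Finset.Icc 1 (seqWeight w s), maxDim w s k = _
  rw [h, Finset.sum_add_distrib]
  simp
  ring

/-- Compare the terms with equal j in `wct_eq`. If w(s') ≤ w(s) - j, the complement of s' has
w-weight at least j, hence w'-weight at least j, so s' is also allowed for w' and j. The additional
terms for w' are non-negative. -/
theorem wct_mono {s : List (HomogeneousClass X R)} {w w' : HomogeneousClass X R → ℕ}
    (h : ∀ a ∈ s, w a ≤ w' a) : wct s w ≤ wct s w' := by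
  have hle : ∀ t : List (HomogeneousClass X R), t ⊆ s → seqWeight w t ≤ seqWeight w' t :=
    fun t ht => List.sum_le_sum fun a ha => h a (ht ha)
  rw [wct_eq, wct_eq]
  refine add_le_add_right ((Finset.sum_le_sum fun j _ => ?_).trans
    (Finset.sum_le_sum_of_subset_of_nonneg (Finset.range_mono (hle s (List.Subset.refl s)))
      fun j _ _ => ?_)) 1
  · obtain ⟨s', h1, h2, h3⟩ := exists_maxDim w s (seqWeight w s - j)
    obtain ⟨s'', hs⟩ := exists_complement h1
    refine add_le_add_left ?_ 1
    rw [h3]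
    refine seqDim_le_maxDim w' h1 ?_
    have e1 := seqWeight_perm w hs
    have e2 := seqWeight_perm w' hs
    rw [seqWeight_append] at e1 e2
    have := hle s'' fun a ha => hs.subset (List.mem_append_left _ ha)
    by_cases hj : j ≤ seqWeight w s
    · omega
    · have h4 := Finset.mem_range.1 ‹j ∈ _›
      omega
  · obtain ⟨s', -, -, h3⟩ := exists_maxDim w' s (seqWeight w' s - j)
    have := neg_one_le_seqDim s'
    omega

/-- The estimate for a space that receives a map, injective in cohomology, from a space with an open
cover that behaves like the cover of a polyhedron by the open stars of its vertices. -/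
theorem wct_le_of_cover {Y : Type u} [TopologicalSpace Y] (g : C(Y, X))
    (hg : ∀ (n : ℕ) (u : Cohomology X R n), pullback g R n u = 0 → u = 0)
    {ι : Type u} [Fintype ι] {K : Set (Finset ι)} {O : ι → Set Y} (hO : ∀ i, IsOpen (O i))
    (hcov : ⋃ i, O i = Set.univ)
    (hcontr : ∀ σ ∈ K, ContractibleSpace (⋂ i ∈ σ, O i : Set Y))
    (hempty : ∀ σ : Finset ι, σ.Nonempty → σ ∉ K → (⋂ i ∈ σ, O i) = ∅)
    (hnull : ∀ σ ∈ K, (incl (⋃ i ∈ σ, O i)).Nullhomotopic)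
    {s : List (HomogeneousClass X R)} (hs : (cupList s).2 ≠ 0) {w : HomogeneousClass X R → ℕ}
    (hw : ∀ a ∈ s, w a ≤ swgt a) : wct s w ≤ Fintype.card ι := by
  classical
  -- When the classes of s'' absorb the sets of L, the product of s' must survive on the remaining
  -- sets; otherwise ŝ would vanish on an open cover of Y.
  have main : ∀ (s' s'' : List (HomogeneousClass X R)) (L : List (Set Y)) (ℬ : Set (Set Y)),
      (s'' ++ s').Perm s → (∀ B ∈ L, IsOpen B) → (∀ B ∈ L, (incl B).Nullhomotopic) →
      L.length ≤ seqWeight w s'' → (∀ B ∈ ℬ, IsOpen B) → listUnion L ∪ ⋃₀ ℬ = Set.univ →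
      ¬ VanishesOn ℬ (hpull g (cupList s')) := by
    intro s' s'' L ℬ hperm ho hn hL hℬ hu hv
    obtain ⟨𝒜, h1, h2, h3⟩ := exists_vanishesOn_append g w s' hv s'' L
      (fun a ha => hw a (hperm.subset (List.mem_append_left _ ha))) ho hn hL
    have h4 := h3.eq_zero (fun A hA => hA.elim (h1 A) (hℬ A)) (by rw [Set.sUnion_union, h2, hu])
    exact (signEq_cupList_of_perm hperm.symm).ne_zero hs (hg _ _ h4)
  have step : ∀ j ≤ seqWeight w s, ∃ (L : List (Set Y)) (T : Finset ι), L.length ≤ j ∧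
      (∀ B ∈ L, IsOpen B) ∧ (∀ B ∈ L, (incl B).Nullhomotopic) ∧ listUnion L = ⋃ i ∈ T, O i ∧
      (T.card : ℤ) = ∑ k ∈ Finset.range j, (maxDim w s (seqWeight w s - k) + 1) := by
    intro j
    induction j with
    | zero =>
      intro _
      refine ⟨[], ∅, le_rfl, by simp, by simp, ?_, by simp⟩
      simp [listUnion]
    | succ j ih =>
      intro hj
      obtain ⟨L, T, h1, h2, h3, h4, h5⟩ := ih (by omega)
      obtain ⟨s', k1, k2, k3⟩ := exists_maxDim w s (seqWeight w s - j)
      rw [Finset.sum_range_succ, ← h5, k3]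
      by_cases hnil : s' = []
      -- The empty part contributes -1 + 1 = 0 vertices, so nothing is removed.
      · subst hnil
        exact ⟨L, T, by omega, h2, h3, h4, by simp [seqDim]⟩
      obtain ⟨s'', hperm⟩ := exists_complement k1
      have e1 := seqWeight_perm w hperm
      rw [seqWeight_append] at e1
      -- Otherwise the nerve of the stars outside T has dimension less than |ŝ'|, and the product of
      -- s' vanishes on these stars.
      have hex : ∃ σ ⊆ Tᶜ, σ.card = (cupList s').1 + 1 ∧ σ ∈ K := by
        by_contra hno
        push Not at hno
        refine main s' s'' L (O '' (Tᶜ : Finset ι)) hperm h2 h3 (by omega) ?_ ?_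
          (vanishesOn_of_nerve _ ?_ _ ?_)
        · rintro _ ⟨i, -, rfl⟩
          exact hO i
        · refine Set.eq_univ_of_forall fun y => ?_
          obtain ⟨i, hi⟩ := Set.mem_iUnion.1 (hcov.symm ▸ Set.mem_univ y)
          by_cases hiT : i ∈ T
          · left
            rw [h4]
            exact Set.mem_iUnion₂.2 ⟨i, hiT, hi⟩
          · right
            exact ⟨_, ⟨i, by simpa using hiT, rfl⟩, hi⟩
        · intro σ _ hne
          by_cases hσ : σ ∈ K
          · exact Or.inl (hcontr σ hσ)
          · exact Or.inr (hempty σ hne hσ)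
        · intro σ hσ hc
          exact hempty σ (Finset.card_pos.1 (by omega)) (hno σ hσ hc)
      obtain ⟨σ, hσT, hσc, hσK⟩ := hex
      refine ⟨(⋃ i ∈ σ, O i) :: L, T ∪ σ, ?_, ?_, ?_, ?_, ?_⟩
      · simpa using h1
      · intro B hB
        rcases List.mem_cons.1 hB with rfl | hB
        · exact isOpen_biUnion fun i _ => hO i
        · exact h2 B hB
      · intro B hB
        rcases List.mem_cons.1 hB with rfl | hB
        · exact hnull σ hσK
        · exact h3 B hB
      · rw [Finset.set_biUnion_union, ← h4, Set.union_comm]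
        ext y
        simp [listUnion]
      · rw [Finset.card_union_of_disjoint (Finset.disjoint_left.2 fun i hi hi' =>
          Finset.mem_compl.1 (hσT hi') hi), hσc, seqDim_of_ne_nil hnil]
        push_cast
        ring
  obtain ⟨L, T, h1, h2, h3, h4, h5⟩ := step _ le_rfl
  -- This is the summand 1 of wct: if the stars over T covered Y, the whole of s would absorb them
  -- and ŝ would vanish. Here s' is empty and its product is the unit class.
  have hT : T ≠ Finset.univ := by
    rintro rfl
    refine main [] s L ∅ (by simp) h2 h3 h1 (by simp) ?_ (vanishesOn_empty _)
    rw [h4, Set.sUnion_empty, Set.union_empty]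
    simpa using hcov
  have hlt : T.card < Fintype.card ι := by
    rw [← Finset.card_univ]
    exact Finset.card_lt_card (Finset.ssubset_univ_iff.2 hT)
  rw [wct_eq, ← h5]
  omega

/-- The number of members of a finite good cover is at least every weighted estimate. -/
theorem wct_le_ncard [Nonempty X] {𝒰 : Set (Set X)} (hfin : 𝒰.Finite) (hgood : IsGoodCover 𝒰)
    {s : List (HomogeneousClass X R)} (hs : (cupList s).2 ≠ 0) {w : HomogeneousClass X R → ℕ}
    (hw : ∀ a ∈ s, w a ≤ swgt a) : wct s w ≤ 𝒰.ncard := by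
  classical
  have : Fintype 𝒰 := hfin.fintype
  let U : 𝒰 → Set X := Subtype.val
  let K : Set (Finset 𝒰) := {σ | σ.Nonempty ∧ (⋂ i ∈ σ, U i).Nonempty}
  have hK : IsComplex K := by
    refine ⟨fun σ hσ => hσ.1, fun σ hσ τ hτ hne => ⟨hne, hσ.2.mono ?_⟩⟩
    exact Set.biInter_subset_biInter_left hτ
  have hc : ∀ τ ∈ K, ContractibleSpace (⋂ i ∈ τ, U i : Set X) := by
    intro τ hτ
    have e : (⋂ i ∈ τ, U i) = ⋂₀ (U '' τ) := by
      rw [Set.sInter_image]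
      rfl
    have h2 := hτ.2
    rw [e] at h2 ⊢
    refine hgood.contractible_inter _ ?_ ((Finset.finite_toSet τ).image _)
      (Set.Nonempty.image _ hτ.1) h2
    rintro _ ⟨i, -, rfl⟩
    exact i.2
  have hcov : ⋃ i, U i = Set.univ := by
    rw [← hgood.cover, Set.sUnion_eq_iUnion]
  obtain ⟨g, hg⟩ := exists_map_polyhedron hK hc
  have hinj := pullback_injective_of_covers (R := R) g (U := U) (V := bigStar K)
    (fun i => hgood.isOpen i i.2) hcov hg (by
      intro σ hne
      by_cases hσ : σ ∈ K
      · exact Or.inl ⟨contractibleSpace_iInter_bigStar hK hσ, hc σ hσ⟩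
      · refine Or.inr ⟨iInter_bigStar_eq_empty hK hne hσ, ?_⟩
        exact Set.not_nonempty_iff_eq_empty.1 fun h => hσ ⟨hne, h⟩)
  have h := wct_le_of_cover g hinj isOpen_openStar (iUnion_openStar hK)
    (fun σ hσ => contractibleSpace_iInter_openStar hK hσ)
    (fun σ hne hσ => iInter_openStar_eq_empty hK hne hσ)
    (fun σ hσ => nullhomotopic_incl_iUnion_openStar hK hσ) hs hw
  rwa [← Nat.card_eq_fintype_card, Nat.card_coe_set_eq] at h

end WeightedBound

end

end CoveringType

namespace CoveringType

noncomputable section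

/-! ### Homotopy invariance and the passage to the covering type. -/

section Invariance

open CategoryTheory Simplicial

variable {X Y : Type u} [TopologicalSpace X] [TopologicalSpace Y] {R : Type v} [CommRing R]

theorem hmul_eq_zero_of_left {a : HomogeneousClass X R} (h : a.2 = 0) (b : HomogeneousClass X R) :
    (hmul a b).2 = 0 := by
  obtain ⟨p, u⟩ := a
  obtain ⟨q, v⟩ := b
  obtain rfl : u = 0 := h
  obtain ⟨ψ, hψ, rfl⟩ := exists_cls v
  refine cls_eq_zero_iff.2 (cupCochain_left_mem rfl (Submodule.zero_mem _) hψ)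

theorem hmul_eq_zero_of_right (a : HomogeneousClass X R) {b : HomogeneousClass X R}
    (h : b.2 = 0) : (hmul a b).2 = 0 := by
  obtain ⟨p, u⟩ := a
  obtain ⟨q, v⟩ := b
  obtain rfl : v = 0 := h
  obtain ⟨φ, hφ, rfl⟩ := exists_cls u
  refine cls_eq_zero_iff.2 (cupCochain_right_mem rfl hφ (Submodule.zero_mem _))

/-- Needed because estimators are constrained only on non-zero classes. -/
theorem ne_zero_of_cupList_ne_zero {s : List (HomogeneousClass X R)} (hs : (cupList s).2 ≠ 0) :
    ∀ a ∈ s, a.2 ≠ 0 := by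
  induction s with
  | nil => simp
  | cons b s ih =>
    intro a ha h
    rw [cupList_cons] at hs
    rcases List.mem_cons.1 ha with rfl | ha
    · exact hs (hmul_eq_zero_of_left h _)
    · exact ih (fun h' => hs (hmul_eq_zero_of_right b h')) a ha h

theorem unitClass_ne_zero [Nonempty X] [Nontrivial R] : (unitClass : Cohomology X R 0) ≠ 0 := by
  obtain ⟨x⟩ := ‹Nonempty X›
  intro h
  have h' : (fun _ => 1 : Cochain (Sing X) R 0) = 0 := cls_eq_zero_iff.1 h
  exact one_ne_zero (congrFun h' (sing (ContinuousMap.const _ x)))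

theorem pullback_invFun_toFun (h : ContinuousMap.HomotopyEquiv X Y) (n : ℕ) (u : Cohomology Y R n) :
    pullback h.invFun R n (pullback h.toFun R n u) = u := by
  rw [← pullback_comp, pullback_eq_of_homotopic h.right_inv, pullback_id]

theorem pullback_eq_zero_of_hpull (f : C(X, Y)) {b : HomogeneousClass Y R} {k : ℕ}
    (hb : ∀ (A : Type u) [TopologicalSpace A] (g : C(A, Y)),
      mapCategory g ≤ k → pullback g R b.1 b.2 = 0)
    (A : Type u) [TopologicalSpace A] (g : C(A, X)) (hg : mapCategory g ≤ k) :
    pullback g R (hpull f b).1 (hpull f b).2 = 0 :=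
  (pullback_comp f g _ _).symm.trans (hb A (f.comp g) ((mapCategory_comp_le _ _).trans hg))

/-- Composing test maps with the equivalence or with its inverse does not raise their category, so
the same k are admissible for both classes. -/
theorem swgt_hpull (h : ContinuousMap.HomotopyEquiv X Y) (b : HomogeneousClass Y R) :
    swgt (hpull h.toFun b) = swgt b := by
  refine congrArg sSup (Set.Subset.antisymm (fun k hk => ?_)
    fun k hk => pullback_eq_zero_of_hpull h.toFun hk)
  have h1 := pullback_eq_zero_of_hpull h.invFun hk
  have h2 : hpull h.invFun (hpull h.toFun b) = b :=
    congrArg (Sigma.mk b.1) (pullback_invFun_toFun h _ _)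
  rwa [h2] at h1

theorem seqWeight_swgt_hpull (h : ContinuousMap.HomotopyEquiv X Y)
    (s : List (HomogeneousClass Y R)) :
    seqWeight swgt (s.map (hpull h.toFun)) = seqWeight swgt s := by
  rw [seqWeight, seqWeight, List.map_map]
  exact congrArg List.sum (List.map_congr_left fun a _ => swgt_hpull h a)

theorem seqDim_hpull (f : C(X, Y)) (s : List (HomogeneousClass Y R)) :
    seqDim (s.map (hpull f)) = seqDim s := by
  by_cases hs : s = []
  · subst hs
    rfl
  · rw [seqDim_of_ne_nil hs, seqDim_of_ne_nil (by simpa using hs), ← hpull_cupList]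
    rfl

theorem seqDim_perm {s t : List (HomogeneousClass X R)} (h : s.Perm t) : seqDim s = seqDim t := by
  by_cases hs : s = []
  · subst hs
    rw [h.nil_eq]
  · rw [seqDim_of_ne_nil hs, seqDim_of_ne_nil fun ht => hs (ht ▸ h).eq_nil, cupList_fst,
      cupList_fst, (h.map Sigma.fst).sum_eq]

theorem wct_hpull (h : ContinuousMap.HomotopyEquiv X Y) (s : List (HomogeneousClass Y R)) :
    wct (s.map (hpull h.toFun)) swgt = wct s swgt := by
  rw [wct, wct, seqWeight_swgt_hpull]
  refine congrArg _ (Finset.sum_congr rfl fun k _ => congrArg sSup (Set.ext fun d => ⟨?_, ?_⟩))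
  · rintro ⟨s', ⟨l, hl, hls⟩, hk, rfl⟩
    obtain ⟨l', hl', rfl⟩ := List.sublist_map_iff.1 hls
    refine ⟨l', hl'.subperm, ?_, ?_⟩
    · rwa [← seqWeight_swgt_hpull h, seqWeight_perm _ hl]
    · rw [← seqDim_perm hl, seqDim_hpull]
  · rintro ⟨s', ⟨l, hl, hls⟩, hk, rfl⟩
    exact ⟨s'.map (hpull h.toFun), ⟨l.map _, hl.map _, hls.map _⟩,
      (seqWeight_swgt_hpull h s').trans_le hk, (seqDim_hpull _ _).symm⟩

theorem swctValues_subset (h : ContinuousMap.HomotopyEquiv X Y) :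
    swctValues.{u, v} Y ⊆ swctValues.{u, v} X := by
  rintro _ ⟨R, _, s, ⟨hs1, hs2⟩, rfl⟩
  refine ⟨R, _, s.map (hpull h.toFun), ⟨?_, ?_⟩, (wct_hpull h s).symm⟩
  · intro a ha
    obtain ⟨b, hb, rfl⟩ := List.mem_map.1 ha
    exact hs1 b hb
  · rw [← hpull_cupList]
    intro h0
    refine hs2 ?_
    rw [← pullback_invFun_toFun h _ (cupList s).2]
    exact (congrArg _ h0).trans (map_zero _)

theorem swctValues_eq (h : ContinuousMap.HomotopyEquiv X Y) :
    swctValues.{u, v} Y = swctValues.{u, v} X :=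
  (swctValues_subset h).antisymm (swctValues_subset h.symm)

/-- The witness is the empty sequence, whose product, the unit class, is non-zero over a non-trivial
ring; `ULift` only adjusts the universe of ℤ. -/
theorem swctValues_nonempty [Nonempty X] : (swctValues.{u, v} X).Nonempty :=
  ⟨_, ULift.{v} ℤ, inferInstance, [], ⟨by simp, unitClass_ne_zero⟩, rfl⟩

theorem le_ncard_of_mem_swctValues [Nonempty X] {𝒰 : Set (Set X)} (hfin : 𝒰.Finite)
    (hgood : IsGoodCover 𝒰) {m : ℤ} (hm : m ∈ swctValues.{u, v} X) : m ≤ 𝒰.ncard := by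
  obtain ⟨R, _, s, hs, rfl⟩ := hm
  exact wct_le_ncard hfin hgood hs.2 fun a _ => le_rfl

theorem isGreatest_swct [Nonempty X] {𝒰 : Set (Set X)} (hfin : 𝒰.Finite)
    (hgood : IsGoodCover 𝒰) : IsGreatest (swctValues.{u, v} X) (swct.{u, v} X) := by
  have hb : BddAbove (swctValues.{u, v} X) :=
    ⟨_, fun _ hm => le_ncard_of_mem_swctValues hfin hgood hm⟩
  exact ⟨Int.csSup_mem swctValues_nonempty hb, fun m hm => le_csSup hb hm⟩

theorem swct_le_strictCoveringType [Nonempty X] {m : ℤ} (hm : m ∈ swctValues.{u, v} X) :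
    (m.toNat : ℕ∞) ≤ strictCoveringType X := by
  refine le_iInf₂ fun 𝒰 hgood => ?_
  by_cases hfin : 𝒰.Finite
  · rw [← hfin.cast_ncard_eq]
    have := le_ncard_of_mem_swctValues hfin hgood hm
    exact_mod_cast Int.toNat_le.2 this
  · rw [Set.Infinite.encard_eq hfin]
    exact le_top

theorem swct_le_coveringType [Nonempty X] {m : ℤ} (hm : m ∈ swctValues.{u, v} X) :
    (m.toNat : ℕ∞) ≤ coveringType X := by
  refine le_iInf fun Y => le_iInf₂ fun _ ⟨h⟩ => ?_
  have : Nonempty Y := ‹Nonempty X›.map h.toFun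
  exact swct_le_strictCoveringType ((swctValues_eq h).symm ▸ hm)

theorem coveringType_le_encard {𝒰 : Set (Set X)} (hgood : IsGoodCover 𝒰) :
    coveringType X ≤ 𝒰.encard :=
  (iInf_le_of_le X (iInf₂_le_of_le ‹_› ⟨.refl X⟩ le_rfl)).trans (iInf₂_le 𝒰 hgood)

end Invariance

end

end CoveringType

theorem theorem3p3 (X : Type u) [TopologicalSpace X] [PathConnectedSpace X]
    (hX : ∃ 𝒰 : Set (Set X), 𝒰.Finite ∧ CoveringType.IsGoodCover 𝒰) :
    IsGreatest (CoveringType.swctValues.{u, v} X) (CoveringType.swct.{u, v} X) ∧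
    (∀ (Y : Type u) [TopologicalSpace Y], Nonempty (ContinuousMap.HomotopyEquiv X Y) →
      CoveringType.swct.{u, v} Y = CoveringType.swct.{u, v} X) ∧
    (∃ n : ℕ, CoveringType.coveringType X = n ∧ CoveringType.swct.{u, v} X ≤ n) ∧
    (∀ (R : Type v) [CommRing R] (w : CoveringType.HomogeneousClass X R → ℕ),
      CoveringType.IsStrictWeightEstimator w →
      ∀ s : List (CoveringType.HomogeneousClass X R), CoveringType.IsAdmissible s →
        CoveringType.wct s w ≤ CoveringType.swct.{u, v} X) := by
  obtain ⟨𝒰, hfin, hgood⟩ := hX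
  have hmax := CoveringType.isGreatest_swct.{u, v} hfin hgood
  refine ⟨hmax, fun Y _ ⟨h⟩ => congrArg sSup (CoveringType.swctValues_eq h), ?_, ?_⟩
  · have hlt : CoveringType.coveringType X ≠ ⊤ :=
      ((CoveringType.coveringType_le_encard hgood).trans_lt hfin.encard_lt_top).ne
    refine ⟨(CoveringType.coveringType X).toNat, (ENat.natCast_toNat hlt).symm, ?_⟩
    -- The maximum is itself one of the values, so the bound for single values applies to it.
    have h := CoveringType.swct_le_coveringType hmax.1
    rw [← ENat.natCast_toNat hlt] at h
    exact Int.toNat_le.1 (by exact_mod_cast h)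
  · intro R _ w hw s hs
    have hne := CoveringType.ne_zero_of_cupList_ne_zero hs.2
    exact (CoveringType.wct_mono fun a ha => (hw a (hs.1 a ha) (hne a ha)).2).trans
      (hmax.2 ⟨R, _, s, hs, rfl⟩)
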